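/- **Setting.** Let $n\ge 1$, let $\mathbb B_n$ be the open unit ball of $\mathbb C^n$ and $dV$ the normalized volume measure on it. A *radial weight* is a nonnegative measurable function $\omega$ on $\mathbb B_n$ with $\omega(z)=\omega(|z|)$ and $\int_{\mathbb B_n}\omega\,dV<\infty$; put $\hat\omega(r)=\int_r^1\omega(s)\,ds$ for $0\le r<1$. We write $\omega\in\mathcal D$ if there are constants $C\ge1$ and $C',K>1$ such that $$\hat\omega(r)<C\,\hat\omega\Big(\frac{1+r}2\Big)\quad\text{and}\quad \hat\omega(r)\ge C'\,\hat\omega\Big(1-\frac{1-r}{K}\Big)\qquad\text{for all } r\in[0,1).$$ For $0<p<\infty$, $A^p_\omega$ is the space of holomorphic functions $f$ on $\mathbb B_n$ with $\|f\|_{A^p_\omega}^p=\int_{\mathbb B_n}|f|^p\omega\,dV<\infty$. For a positive Borel measure $\mu$ on $\mathbb B_n$ and $0<q<\infty$, $\mu$ is a *$q$-Carleson measure* for $A^p_\omega$ if the identity map $A^p_\omega\to L^q_\mu$ is well defined and bounded, and a *vanishing $q$-Carleson measure* if it is compact, i.e. the image of every bounded sequence of $A^p_\omega$ has a subsequence converging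 in $L^q_\mu$. For $a\in\mathbb B_n$ let $\varphi_a(z)=\dfrac{a-P_az-\sqrt{1-|a|^2}\,Q_az}{1-\langle z,a\rangle}$, where $P_a$ is the orthogonal projection onto the span of $a$ and $Q_a=I-P_a$; let $\rho(a,z)=|\varphi_a(z)|$ be the pseudohyperbolic distance. For $0<r<1$ let $D(z,r)=\{w\in\mathbb B_n:\rho(z,w)<r\}$; this is the ball of radius $\frac12\log\frac{1+r}{1-r}$ centred at $z$ in the Bergman metric $\beta=\frac12\log\frac{1+\rho}{1-\rho}$. With $\omega(E)=\int_E\omega\,dV$ put $$\hat\mu_{\omega,r,s}(z)=\frac{\mu(D(z,r))}{\omega(D(z,r))^{s}},\qquad z\in\mathbb B_n .$$ **Theorem.** Let $\omega\in\mathcal D$. There is $r_0=r_0(\omega,n)\in(0,1)$ such that for all $0<p\le q<\infty$ and every positive Borel measure $\mu$ on $\mathbb B_n$ the following hold. (i) The following are equivalent: $\mu$ is a $q$-Carleson measure for $A^p_\omega$; $\hat\mu_{\omega,r,q/p}\in L^\infty(\mathbb B_n)$ for some $r\in[r_0,1)$; $\hat\mu_{\omega,r,q/p}\in L^\infty(\mathbb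 B_n)$ for all $r\in[r_0,1)$. (ii) If $\mu$ is finite on compact subsets of $\mathbb B_n$, the following are equivalent: $\mu$ is a vanishing $q$-Carleson measure for $A^p_\omega$; $\hat\mu_{\omega,r,q/p}(a)\to0$ as $|a|\to1$ for some $r\in[r_0,1)$; $\hat\mu_{\omega,r,q/p}(a)\to0$ as $|a|\to1$ for all $r\in[r_0,1)$. -/

import Mathlib

open MeasureTheory Set Filter Topology
open scoped ENNReal NNReal

noncomputable section

namespace BergmanBall

/-- Complex `n`-space with its Hermitian inner product. In the usual notation `⟨z, w⟩`, linear in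
`z`, is `inner ℂ w z`. -/
abbrev Cn (n : ℕ) : Type := EuclideanSpace ℂ (Fin n)

/-- The open unit ball of complex `n`-space. -/
def unitBall (n : ℕ) : Set (Cn n) := Metric.ball 0 1

/-- The normalized volume measure on the unit ball (total mass one), as a measure on `Cn n` that
is carried by the ball. -/
def vol (n : ℕ) : Measure (Cn n) :=
  ((Measure.addHaar : Measure (Cn n)) (unitBall n))⁻¹ •
    (Measure.addHaar : Measure (Cn n)).restrict (unitBall n)

/-- A radial weight on the unit ball is given by its profile `ω` on `[0, 1)`: the weight is
`z ↦ ω ‖z‖`. It is nonnegative, measurable, and integrable on the ball. -/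
structure IsRadialWeight (n : ℕ) (ω : ℝ → ℝ) : Prop where
  nonneg : ∀ s ∈ Ico (0 : ℝ) 1, 0 ≤ ω s
  aemeasurable : AEMeasurable ω (volume.restrict (Ico (0 : ℝ) 1))
  integrable : Integrable (fun z : Cn n => ω ‖z‖) (vol n)

/-- The tail integral `∫_r^1 ω(s) ds`, with values in `[0, ∞]`. -/
def tail (ω : ℝ → ℝ) (r : ℝ) : ℝ≥0∞ := ∫⁻ s in Ioo r 1, ENNReal.ofReal (ω s)

/-- The doubling condition. The strict inequality makes all tail integrals positive and finite. -/
def IsUpperDoubling (ω : ℝ → ℝ) : Prop :=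
  ∃ C : ℝ, 1 ≤ C ∧ ∀ r ∈ Ico (0 : ℝ) 1, tail ω r < ENNReal.ofReal C * tail ω ((r + 1) / 2)

/-- The reverse doubling condition. -/
def IsReverseDoubling (ω : ℝ → ℝ) : Prop :=
  ∃ C K : ℝ, 1 < C ∧ 1 < K ∧
    ∀ r ∈ Ico (0 : ℝ) 1, ENNReal.ofReal C * tail ω (1 - (1 - r) / K) ≤ tail ω r

/-- The class of two-sided doubling radial weights on the unit ball. -/
structure IsTwoSidedDoubling (n : ℕ) (ω : ℝ → ℝ) : Prop where
  radialWeight : IsRadialWeight n ω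
  upper : IsUpperDoubling ω
  reverse : IsReverseDoubling ω

/-- The measure `ω dV` on the unit ball. -/
def weightMeasure (n : ℕ) (ω : ℝ → ℝ) : Measure (Cn n) :=
  (vol n).withDensity fun z => ENNReal.ofReal (ω ‖z‖)

/-- The weighted Bergman space: functions that are holomorphic in the unit ball and satisfy
`∫ |f|^p ω dV < ∞`. Only the values in the ball matter. -/
def bergmanSpace (n : ℕ) (ω : ℝ → ℝ) (p : ℝ) : Set (Cn n → ℂ) :=
  {f | DifferentiableOn ℂ f (unitBall n) ∧ MemLp f (ENNReal.ofReal p) (weightMeasure n ω)}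

/-- The Bergman space (quasi-)norm `(∫ |f|^p ω dV)^(1/p)`. -/
def bergmanNorm (n : ℕ) (ω : ℝ → ℝ) (p : ℝ) (f : Cn n → ℂ) : ℝ≥0∞ :=
  eLpNorm f (ENNReal.ofReal p) (weightMeasure n ω)

/-- `μ` is a `q`-Carleson measure: the identity map from the Bergman space to `L^q(μ)` is
well-defined and bounded. Only the restriction of `μ` to the ball matters. -/
def IsCarleson (n : ℕ) (ω : ℝ → ℝ) (p q : ℝ) (μ : Measure (Cn n)) : Prop :=
  (∀ f ∈ bergmanSpace n ω p, MemLp f (ENNReal.ofReal q) (μ.restrict (unitBall n))) ∧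
  ∃ C : ℝ≥0, ∀ f ∈ bergmanSpace n ω p,
    eLpNorm f (ENNReal.ofReal q) (μ.restrict (unitBall n)) ≤ C * bergmanNorm n ω p f

/-- `μ` is a vanishing `q`-Carleson measure: the identity map from the Bergman space to `L^q(μ)`
is well-defined and compact, i.e. every bounded sequence has a subsequence that converges in
`L^q(μ)`. -/
def IsVanishingCarleson (n : ℕ) (ω : ℝ → ℝ) (p q : ℝ) (μ : Measure (Cn n)) : Prop :=
  (∀ f ∈ bergmanSpace n ω p, MemLp f (ENNReal.ofReal q) (μ.restrict (unitBall n))) ∧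
  ∀ f : ℕ → Cn n → ℂ, (∀ k, f k ∈ bergmanSpace n ω p) →
    (∃ M : ℝ≥0, ∀ k, bergmanNorm n ω p (f k) ≤ M) →
    ∃ φ : ℕ → ℕ, StrictMono φ ∧ ∃ g : Cn n → ℂ,
      MemLp g (ENNReal.ofReal q) (μ.restrict (unitBall n)) ∧
      Tendsto (fun k => eLpNorm (f (φ k) - g) (ENNReal.ofReal q) (μ.restrict (unitBall n)))
        atTop (𝓝 0)

/-- The Möbius involution `φ_a(z) = (a - P_a z - √(1 - |a|²) Q_a z) / (1 - ⟨z, a⟩)`, where `P_a` is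
the orthogonal projection onto the line spanned by `a` (zero if `a = 0`) and `Q_a = id - P_a`. -/
def mobius {n : ℕ} (a z : Cn n) : Cn n :=
  (1 - inner ℂ a z)⁻¹ •
    (a - (Submodule.span ℂ {a}).starProjection z
      - ((Real.sqrt (1 - ‖a‖ ^ 2) : ℝ) : ℂ) • (z - (Submodule.span ℂ {a}).starProjection z))

/-- The pseudohyperbolic distance. -/
def pseudoDist {n : ℕ} (a z : Cn n) : ℝ := ‖mobius a z‖

/-- The hyperbolic ball `D(z, r)` with pseudohyperbolic radius `r ∈ (0, 1)`. Since the Bergman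
metric is `β = (1/2) log ((1 + ρ) / (1 - ρ))`, this is the Bergman metric ball with center `z` and
Bergman radius `(1/2) log ((1 + r) / (1 - r))`. -/
def hypBall {n : ℕ} (z : Cn n) (r : ℝ) : Set (Cn n) := {w ∈ unitBall n | pseudoDist z w < r}

/-- The weighted mean function `μ(D(z, r)) / ω(D(z, r))^s`, with values in `[0, ∞]`. -/
def weightedMean {n : ℕ} (ω : ℝ → ℝ) (μ : Measure (Cn n)) (r s : ℝ) (z : Cn n) : ℝ≥0∞ :=
  μ (hypBall z r) / (weightMeasure n ω (hypBall z r)) ^ s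

/-- The weighted mean function belongs to `L^∞` of the unit ball. -/
def MeanBounded {n : ℕ} (ω : ℝ → ℝ) (μ : Measure (Cn n)) (r s : ℝ) : Prop :=
  essSup (weightedMean ω μ r s) (vol n) < ∞

/-- The weighted mean function tends to `0` as `|z| → 1` from inside the unit ball. -/
def MeanVanishes {n : ℕ} (ω : ℝ → ℝ) (μ : Measure (Cn n)) (r s : ℝ) : Prop :=
  Tendsto (weightedMean ω μ r s) (comap (fun z : Cn n => ‖z‖) (𝓝[<] (1 : ℝ))) (𝓝 0)

end BergmanBall

end

open MeasureTheory Set Filter Topology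
open scoped ENNReal NNReal

noncomputable section

namespace BergmanBall

section

/-! ### Sub-mean value property in one variable -/

/-! Write S(a) = (1-|a|)^n ∫_{|a|}^1 W, which is `size`, for a measurable version W of the profile.
Both characterizations reduce to comparing μ(D(a,r)) with S(a)^{q/p}, because ω(D(a,r)) is
comparable to S(a) once r ≥ r₀ (`exists_weightedMean_comparison`). For the upper bound, D(a,r) lies
in a tent |1-⟨w,a⟩| < c(1-|a|), whose mass is controlled by the δ^n-size of spherical caps and by
upper doubling. For the lower bound, reverse doubling places a fixed share of ∫_{|a|}^1 W at radii
between (1+|a|)/2 and 1-(1-|a|)/(2K), and r₀ is so close to 1 that D(a,r₀) contains this shell over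
a cap of width 1-|a|. Smaller hyperbolic balls may carry no mass at all, which is why r₀ is needed.

Sufficiency. Since W may vanish on hyperbolic balls, |f|^p cannot be controlled locally by W. It is
replaced by the regularized profile (1-t)^{-1}∫_t^1 W, which is essentially constant on hyperbolic
balls. The spherical means of |f|^p increase with the radius, so mass can be pushed outwards and
this replacement costs only a constant (`integral_sphere_le_of_le`, `lintegral_smoothProfile_le`).
Together with the sub-mean value property of |f|^p on hyperbolic balls (from Jensen's formula on
complex slices, for all p > 0) this gives S(z)|f(z)|^p ≲ ‖f‖^p. Now split |f|^q =
(|f|^p)^{q/p-1}|f|^p, use the pointwise bound on the first factor and the local mean on the second,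
integrate against μ and apply Tonelli (`lintegral_rpow_le_of_measure_hypBall_le`).

Necessity. The functions ((1-|a|)/(1-⟨z,a⟩))^N are bounded below on D(a,r), and for large N their
p-th power integrates to at most a multiple of S(a), by a dyadic sum over tents
(`lintegral_kernelRatio_le`).

Compactness. A bounded sequence has a pointwise convergent subsequence. Near the sphere the
embedding constant is small; on the remaining compact ball dominated convergence applies.
Conversely, test functions normalized in A^p_ω tend to 0 pointwise as |a| → 1, so an L^q limit of
theirs must vanish, which contradicts a lower bound for μ(D(a,r))/S(a)^{q/p} along a sequence
tending to the sphere. -/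

theorem log_norm_le_circleAverage {f : ℂ → ℂ} {c : ℂ} {R : ℝ} (hR : 0 < R)
    (hf : AnalyticOnNhd ℂ f (Metric.closedBall c |R|)) (hc : f c ≠ 0) :
    Real.log ‖f c‖ ≤ Real.circleAverage (fun z => Real.log ‖f z‖) c R := by
  -- Jensen's formula: the error is a sum over zeros u in the disc of multiplicity times
  -- log(R/|c-u|), and every term is nonnegative.
  rw [hf.circleAverage_log_norm hR.ne' hc]
  refine le_add_of_nonneg_left (finsum_nonneg fun u => ?_)
  by_cases hu : u ∈ Metric.closedBall c |R|
  · refine mul_nonneg (mod_cast MeromorphicOn.AnalyticOnNhd.divisor_nonneg hf u) ?_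
    rcases eq_or_ne u c with rfl | huc
    · simp
    · apply Real.log_nonneg
      have h0 : 0 < ‖c - u‖ := norm_pos_iff.2 (sub_ne_zero.2 huc.symm)
      have : ‖c - u‖ ≤ R := by
        simpa [dist_eq_norm', abs_of_pos hR] using hu
      rw [← div_eq_mul_inv, le_div_iff₀ h0]
      simpa using this
  · simp [Function.locallyFinsuppWithin.apply_eq_zero_of_notMem _ hu]

/-- Since x^p is a convex function of log x, it lies above its tangent at log|f(c)|; averaging the
tangent line and using the inequality for log|f| gives the claim. This works for p < 1 as well. -/
theorem rpow_norm_le_circleAverage {f : ℂ → ℂ} {c : ℂ} {R p : ℝ} (hR : 0 < R) (hp : 0 < p)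
    (hf : AnalyticOnNhd ℂ f (Metric.closedBall c |R|)) :
    ‖f c‖ ^ p ≤ Real.circleAverage (fun z => ‖f z‖ ^ p) c R := by
  by_cases hc : f c = 0
  · rw [hc, norm_zero, Real.zero_rpow hp.ne']
    exact Real.circleAverage_nonneg_of_nonneg fun z _ => by positivity
  have hc0 : 0 < ‖f c‖ := norm_pos_iff.2 hc
  set A := ‖f c‖ ^ p with hA
  have hA0 : 0 < A := by positivity
  have hlog : CircleIntegrable (fun z => Real.log ‖f z‖) c R :=
    (hf.mono Metric.sphere_subset_closedBall).meromorphicOn.circleIntegrable_log_norm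
  have hpow : CircleIntegrable (fun z => ‖f z‖ ^ p) c R := by
    apply ContinuousOn.circleIntegrable' 
    intro z hz
    have := (hf z (Metric.sphere_subset_closedBall hz)).continuousAt.continuousWithinAt
      (s := Metric.sphere c |R|)
    exact this.norm.rpow_const (Or.inr hp.le)
  -- Zeros on the circle must be discarded: there `Real.log 0 = 0` and the tangent inequality may
  -- fail. They form a null set of angles.
  have hne : ∀ᶠ x in codiscreteWithin (Metric.sphere c |R|), f x ≠ 0 := by
    rcases hf.eqOn_zero_or_eventually_ne_zero_of_preconnected
      (convex_closedBall c |R|).isPreconnected with h | h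
    · exact absurd (h (Metric.mem_closedBall_self (abs_nonneg R))) hc
    · exact codiscreteWithin_mono Metric.sphere_subset_closedBall h
  have hae : ∀ᵐ θ ∂(volume.restrict (Icc 0 (2 * Real.pi))), f (circleMap c R θ) ≠ 0 := by
    apply ae_restrict_le_codiscreteWithin measurableSet_Icc
    exact codiscreteWithin_mono (by tauto) (circleMap_preimage_codiscrete hR.ne' hne)
  have key : ∀ᵐ θ ∂(volume.restrict (Icc 0 (2 * Real.pi))),
      A * (1 - p * Real.log ‖f c‖) + (A * p) * Real.log ‖f (circleMap c R θ)‖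
        ≤ ‖f (circleMap c R θ)‖ ^ p := by
    filter_upwards [hae] with θ hθ
    have h0 : 0 < ‖f (circleMap c R θ)‖ := norm_pos_iff.2 hθ
    have h1 := Real.log_le_sub_one_of_pos
      (div_pos (Real.rpow_pos_of_pos h0 p) hA0)
    rw [Real.log_div (Real.rpow_pos_of_pos h0 p).ne' hA0.ne', hA, Real.log_rpow h0,
      Real.log_rpow hc0, ← hA, le_sub_iff_add_le, le_div_iff₀ hA0] at h1
    linarith
  have hint := intervalIntegral.integral_mono_ae_restrict (μ := volume)
    (a := 0) (b := 2 * Real.pi)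
    (f := fun θ => A * (1 - p * Real.log ‖f c‖) + (A * p) * Real.log ‖f (circleMap c R θ)‖)
    (g := fun θ => ‖f (circleMap c R θ)‖ ^ p) Real.two_pi_pos.le
    (intervalIntegrable_const.add (hlog.const_mul _)) hpow
    key
  rw [intervalIntegral.integral_add intervalIntegrable_const (hlog.const_mul _),
    intervalIntegral.integral_const, intervalIntegral.integral_const_mul] at hint
  have h2 : Real.log ‖f c‖ ≤ Real.circleAverage (fun z => Real.log ‖f z‖) c R :=
    log_norm_le_circleAverage hR hf hc
  rw [Real.circleAverage_def, smul_eq_mul] at h2 ⊢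
  have hpi := Real.two_pi_pos
  rw [le_inv_mul_iff₀ hpi] at h2 ⊢
  refine le_trans ?_ hint
  have := mul_le_mul_of_nonneg_left h2 (mul_pos hA0 hp).le
  rw [smul_eq_mul]
  linarith

theorem two_pi_mul_rpow_enorm_le {f : ℂ → ℂ} {c : ℂ} {R p : ℝ} (hR : 0 < R) (hp : 0 < p)
    (hf : AnalyticOnNhd ℂ f (Metric.closedBall c R)) :
    ENNReal.ofReal (2 * Real.pi) * ‖f c‖ₑ ^ p
      ≤ ∫⁻ θ in Ioc 0 (2 * Real.pi), ‖f (circleMap c R θ)‖ₑ ^ p := by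
  rw [← abs_of_pos hR] at hf
  have h := rpow_norm_le_circleAverage hR hp hf
  have hpi := Real.two_pi_pos
  have hpow : Continuous fun θ => ‖f (circleMap c R θ)‖ ^ p := by
    refine Continuous.rpow_const ?_ fun _ => Or.inr hp.le
    refine (ContinuousOn.comp_continuous (s := Metric.closedBall c |R|) (fun z hz =>
      (hf z hz).continuousAt.continuousWithinAt) (continuous_circleMap c R) fun θ => ?_).norm
    exact Metric.sphere_subset_closedBall (circleMap_mem_sphere' c R θ)
  rw [Real.circleAverage_def, smul_eq_mul, le_inv_mul_iff₀ hpi,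
    intervalIntegral.integral_of_le hpi.le] at h
  have h' := ENNReal.ofReal_le_ofReal h
  rw [ofReal_integral_eq_lintegral_ofReal (hpow.integrableOn_Ioc)
    (Eventually.of_forall fun θ => by positivity), ENNReal.ofReal_mul hpi.le,
    ← ENNReal.ofReal_rpow_of_nonneg (norm_nonneg _) hp.le, ofReal_norm] at h'
  refine h'.trans_eq (lintegral_congr fun θ => ?_)
  rw [← ENNReal.ofReal_rpow_of_nonneg (norm_nonneg _) hp.le, ofReal_norm]

end

section

/-! ### Geometry of hyperbolic balls -/

variable {n : ℕ}

theorem mem_unitBall {z : Cn n} : z ∈ unitBall n ↔ ‖z‖ < 1 := by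
  simp [unitBall]

theorem isOpen_unitBall : IsOpen (unitBall n) := Metric.isOpen_ball

theorem norm_one_sub_inner_ge (z w : Cn n) : 1 - ‖z‖ * ‖w‖ ≤ ‖1 - inner ℂ z w‖ := by
  have h1 := norm_sub_norm_le (1 : ℂ) (inner ℂ z w)
  have h2 := norm_inner_le_norm (𝕜 := ℂ) z w
  rw [norm_one] at h1
  linarith

theorem one_sub_norm_le_norm_one_sub_inner {z w : Cn n} (hw : ‖w‖ ≤ 1) :
    1 - ‖z‖ ≤ ‖1 - inner ℂ z w‖ := by
  have := norm_one_sub_inner_ge z w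
  nlinarith [norm_nonneg z, norm_nonneg w]

theorem norm_one_sub_inner_comm (z w : Cn n) :
    ‖1 - inner ℂ z w‖ = ‖1 - inner ℂ w z‖ := by
  rw [← inner_conj_symm w z, ← RCLike.norm_conj (1 - _)]
  simp

theorem norm_one_sub_inner_pos {z w : Cn n} (hz : ‖z‖ < 1) (hw : ‖w‖ ≤ 1) :
    0 < ‖1 - inner ℂ z w‖ :=
  (sub_pos.2 hz).trans_le (one_sub_norm_le_norm_one_sub_inner hw)

/-- With l = ⟨z,a⟩/|a|², the numerator is (1-l)a - s(z-la), where s = √(1-|a|²), and z is la +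
(z-la). Both are orthogonal sums, so Pythagoras reduces the identity to algebra. -/
theorem norm_sq_mobius_numerator (a z : Cn n) (ha : ‖a‖ < 1) :
    ‖a - (Submodule.span ℂ {a}).starProjection z
      - ((Real.sqrt (1 - ‖a‖ ^ 2) : ℝ) : ℂ) • (z - (Submodule.span ℂ {a}).starProjection z)‖ ^ 2
      = ‖1 - inner ℂ a z‖ ^ 2 - (1 - ‖a‖ ^ 2) * (1 - ‖z‖ ^ 2) := by
  have hs0 : 0 ≤ 1 - ‖a‖ ^ 2 := by nlinarith [norm_nonneg a]
  set s := Real.sqrt (1 - ‖a‖ ^ 2) with hs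
  have hs2 : s ^ 2 = 1 - ‖a‖ ^ 2 := Real.sq_sqrt hs0
  rw [Submodule.starProjection_singleton]
  rcases eq_or_ne a 0 with rfl | ha0
  · simp [hs]
  have hA : 0 < ‖a‖ := norm_pos_iff.2 ha0
  set x : ℂ := inner ℂ a z with hx
  set l : ℂ := x / (‖a‖ : ℂ) ^ 2 with hl
  have hlA : l * (‖a‖ : ℂ) ^ 2 = x := by
    have : (‖a‖ : ℂ) ≠ 0 := by exact_mod_cast hA.ne'
    rw [hl, div_mul_cancel₀ _ (pow_ne_zero 2 this)]
  have horth : inner ℂ a (z - l • a) = 0 := by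
    rw [inner_sub_right, inner_smul_right, inner_self_eq_norm_sq_to_K, ← hx]
    simp only [Complex.coe_algebraMap]
    rw [hlA, sub_self]
  have e1 : ‖z‖ ^ 2 = ‖l‖ ^ 2 * ‖a‖ ^ 2 + ‖z - l • a‖ ^ 2 := by
    have h := norm_add_sq_eq_norm_sq_add_norm_sq_of_inner_eq_zero (l • a) (z - l • a)
      (by rw [inner_smul_left, horth, mul_zero])
    rw [add_sub_cancel, norm_smul] at h
    nlinarith
  have e2 : ‖a - l • a - (s : ℂ) • (z - l • a)‖ ^ 2
      = ‖1 - l‖ ^ 2 * ‖a‖ ^ 2 + s ^ 2 * ‖z - l • a‖ ^ 2 := by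
    have h := norm_add_sq_eq_norm_sq_add_norm_sq_of_inner_eq_zero ((1 - l) • a)
      (-((s : ℂ) • (z - l • a)))
      (by rw [inner_neg_right (𝕜 := ℂ), inner_smul_left, inner_smul_right, horth, mul_zero, mul_zero,
        neg_zero])
    rw [sub_smul, one_smul, ← sub_eq_add_neg, norm_neg] at h
    have h3 : ‖a - l • a‖ = ‖1 - l‖ * ‖a‖ := by
      rw [← norm_smul, sub_smul, one_smul]
    rw [h3, norm_smul, Complex.norm_real, Real.norm_of_nonneg (Real.sqrt_nonneg _)] at h
    nlinarith
  have e0 : x / (RCLike.ofReal (‖a‖ ^ 2) : ℂ) = l := by simp [hl]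
  rw [e0]
  rw [e2, hs2]
  have e3 : ‖z - l • a‖ ^ 2 = ‖z‖ ^ 2 - ‖l‖ ^ 2 * ‖a‖ ^ 2 := by linarith
  have e4 : ‖1 - l‖ ^ 2 = 1 - 2 * l.re + ‖l‖ ^ 2 := by
    rw [← Complex.normSq_eq_norm_sq, ← Complex.normSq_eq_norm_sq, Complex.normSq_apply,
      Complex.normSq_apply]
    simp; ring
  have e5 : ‖1 - x‖ ^ 2 = 1 - 2 * x.re + ‖x‖ ^ 2 := by
    rw [← Complex.normSq_eq_norm_sq, ← Complex.normSq_eq_norm_sq, Complex.normSq_apply,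
      Complex.normSq_apply]
    simp; ring
  have e6 : x.re = l.re * ‖a‖ ^ 2 := by
    rw [← hlA, ← Complex.ofReal_pow, Complex.re_mul_ofReal]
  have e7 : ‖x‖ ^ 2 = ‖l‖ ^ 2 * (‖a‖ ^ 2) ^ 2 := by
    rw [← hlA, norm_mul, mul_pow]; simp
  rw [e3, e4, e5, e6, e7]
  ring

theorem one_sub_pseudoDist_sq {a z : Cn n} (ha : ‖a‖ < 1) (hz : ‖z‖ ≤ 1) :
    (1 - pseudoDist a z ^ 2) * ‖1 - inner ℂ a z‖ ^ 2 = (1 - ‖a‖ ^ 2) * (1 - ‖z‖ ^ 2) := by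
  have h := norm_sq_mobius_numerator a z ha
  have h0 := norm_one_sub_inner_pos ha hz
  rw [pseudoDist, mobius, norm_smul, mul_pow, h, norm_inv]
  field_simp
  ring

/-- This is the working description of D(z,r). It eliminates the projection, and makes symmetry in z
and w and openness visible. -/
theorem mem_hypBall_iff {z w : Cn n} {r : ℝ} (hz : ‖z‖ < 1) (hr : 0 < r) :
    w ∈ hypBall z r ↔
      ‖w‖ < 1 ∧ (1 - r ^ 2) * ‖1 - inner ℂ z w‖ ^ 2 < (1 - ‖z‖ ^ 2) * (1 - ‖w‖ ^ 2) := by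
  rw [hypBall, mem_ofPred_eq, mem_unitBall]
  refine and_congr_right fun hw => ?_
  have h0 := norm_one_sub_inner_pos hz hw.le
  rw [← one_sub_pseudoDist_sq hz hw.le, mul_lt_mul_iff_left₀ (by positivity),
    sub_lt_sub_iff_left, sq_lt_sq₀ (a := pseudoDist z w) (norm_nonneg _) hr.le]

theorem hypBall_subset_unitBall (z : Cn n) (r : ℝ) : hypBall z r ⊆ unitBall n := fun _ h => h.1

theorem mem_hypBall_comm {z w : Cn n} {r : ℝ} (hz : ‖z‖ < 1) (hw : ‖w‖ < 1) (hr : 0 < r) :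
    w ∈ hypBall z r ↔ z ∈ hypBall w r := by
  rw [mem_hypBall_iff hz hr, mem_hypBall_iff hw hr, norm_one_sub_inner_comm z w,
    mul_comm (1 - ‖z‖ ^ 2)]
  simp [hz, hw]

theorem hypBall_mono {z : Cn n} {r s : ℝ} (h : r ≤ s) : hypBall z r ⊆ hypBall z s :=
  fun _ hw => ⟨hw.1, hw.2.trans_le h⟩

theorem isOpen_hypBall {z : Cn n} {r : ℝ} (hz : ‖z‖ < 1) (hr : 0 < r) :
    IsOpen (hypBall z r) := by
  have : hypBall z r = {w | ‖w‖ < 1} ∩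
      {w | (1 - r ^ 2) * ‖1 - inner ℂ z w‖ ^ 2 < (1 - ‖z‖ ^ 2) * (1 - ‖w‖ ^ 2)} := by
    ext w; exact mem_hypBall_iff hz hr
  rw [this]
  exact (isOpen_lt (by fun_prop) (by fun_prop)).inter (isOpen_lt (by fun_prop) (by fun_prop))

theorem measurableSet_hypBall {z : Cn n} {r : ℝ} (hz : ‖z‖ < 1) (hr : 0 < r) :
    MeasurableSet (hypBall z r) := (isOpen_hypBall hz hr).measurableSet

theorem mem_hypBall_self {z : Cn n} {r : ℝ} (hz : ‖z‖ < 1) (hr : 0 < r) : z ∈ hypBall z r := by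
  rw [mem_hypBall_iff hz hr]
  refine ⟨hz, ?_⟩
  have h0 : 0 < 1 - ‖z‖ ^ 2 := by nlinarith [norm_nonneg z]
  have : ‖1 - inner ℂ z z‖ = 1 - ‖z‖ ^ 2 := by
    rw [inner_self_eq_norm_sq_to_K, ← Complex.norm_of_nonneg h0.le]
    simp
  rw [this]
  nlinarith [mul_pos h0 h0, mul_pos (mul_pos h0 h0) (pow_pos hr 2)]

/-- On a hyperbolic ball around `z`, the quantity `|1 - ⟨z, w⟩|` is at most a multiple of
`1 - |z|`. -/
theorem norm_one_sub_inner_le_of_mem_hypBall {z w : Cn n} {r : ℝ} (hz : ‖z‖ < 1) (hr : 0 < r)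
    (hr1 : r < 1) (hw : w ∈ hypBall z r) :
    ‖1 - inner ℂ z w‖ < 4 / (1 - r ^ 2) * (1 - ‖z‖) := by
  obtain ⟨hw1, h⟩ := (mem_hypBall_iff hz hr).1 hw
  have h0 := norm_one_sub_inner_pos hz hw1.le
  have h1 : 1 - ‖w‖ ≤ ‖1 - inner ℂ z w‖ := by
    rw [norm_one_sub_inner_comm]; exact one_sub_norm_le_norm_one_sub_inner hz.le
  have hr2 : 0 < 1 - r ^ 2 := by nlinarith
  rw [div_mul_eq_mul_div, lt_div_iff₀ hr2]
  have h2 : (1 - ‖z‖ ^ 2) * (1 - ‖w‖ ^ 2) ≤ (2 * (1 - ‖z‖)) * (2 * ‖1 - inner ℂ z w‖) := by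
    apply mul_le_mul
    · nlinarith [norm_nonneg z]
    · nlinarith [norm_nonneg w]
    · nlinarith [norm_nonneg w]
    · linarith
  have h3 : ((1 - r ^ 2) * ‖1 - inner ℂ z w‖) * ‖1 - inner ℂ z w‖
      < (4 * (1 - ‖z‖)) * ‖1 - inner ℂ z w‖ := by nlinarith
  have := lt_of_mul_lt_mul_right h3 h0.le
  linarith

/-- Combined with the symmetry of hyperbolic balls, this makes 1-|w| and 1-|z| comparable. -/
theorem one_sub_norm_le_of_mem_hypBall {z w : Cn n} {r : ℝ} (hz : ‖z‖ < 1) (hr : 0 < r)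
    (hr1 : r < 1) (hw : w ∈ hypBall z r) :
    1 - ‖w‖ < 4 / (1 - r ^ 2) * (1 - ‖z‖) := by
  refine lt_of_le_of_lt ?_ (norm_one_sub_inner_le_of_mem_hypBall hz hr hr1 hw)
  rw [norm_one_sub_inner_comm]
  exact one_sub_norm_le_norm_one_sub_inner hz.le

end

section

/-! ### Volume of anisotropic images of the ball, and polar coordinates -/

variable {n : ℕ}

/-- Lebesgue measure on complex `n`-space, without normalization. -/
abbrev haar (n : ℕ) : Measure (Cn n) := Measure.addHaar

/-- The complex linear map that acts as `α` on the line of the unit vector `η` and as `β` on its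
orthogonal complement. -/
def stretch (η : Cn n) (α β : ℝ) : Cn n →ₗ[ℂ] Cn n :=
  (β : ℂ) • LinearMap.transvection (innerSL ℂ η).toLinearMap ((((α - β) / β : ℝ) : ℂ) • η)

theorem stretch_apply {η : Cn n} {α β : ℝ} (hβ : β ≠ 0) (x : Cn n) :
    stretch η α β x = (β : ℂ) • x + (((α - β : ℝ) : ℂ) * inner ℂ η x) • η := by
  have : (β : ℂ) ≠ 0 := by exact_mod_cast hβ
  simp only [stretch, LinearMap.smul_apply, LinearMap.transvection.apply, smul_add, smul_smul]
  congr 2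
  simp only [ContinuousLinearMap.coe_coe, innerSL_apply_apply]
  push_cast
  field_simp

theorem det_real_restrictScalars (f : Cn n →ₗ[ℂ] Cn n) :
    LinearMap.det (f.restrictScalars ℝ) = ‖LinearMap.det f‖ ^ 2 := by
  rw [LinearMap.det_restrictScalars, Algebra.norm_complex_eq]
  exact Complex.normSq_eq_norm_sq _

theorem haar_image_complexLinear (f : Cn n →ₗ[ℂ] Cn n) (s : Set (Cn n)) :
    haar n (f '' s) = ENNReal.ofReal (‖LinearMap.det f‖ ^ 2) * haar n s := by
  have := Measure.addHaar_image_linearMap (haar n) (f.restrictScalars ℝ) s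
  rw [det_real_restrictScalars, abs_of_nonneg (by positivity)] at this
  exact this

theorem inner_self_of_norm_one {η : Cn n} (hη : ‖η‖ = 1) : inner ℂ η η = 1 := by
  rw [inner_self_eq_norm_sq_to_K, hη]; simp

/-- The real determinant is the squared modulus of the complex one. With α of order δ and β of order
√δ the volume is of order δ^{n+1}, the size of tents and of hyperbolic balls. -/
theorem haar_image_stretch (hn : 1 ≤ n) {η : Cn n} (hη : ‖η‖ = 1) {α β : ℝ} (hβ : 0 < β)
    (s : Set (Cn n)) :
    haar n (stretch η α β '' s) = ENNReal.ofReal (α ^ 2 * (β ^ 2) ^ (n - 1)) * haar n s := by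
  rw [haar_image_complexLinear]
  congr 2
  have hβ' : (β : ℂ) ≠ 0 := by exact_mod_cast hβ.ne'
  have h : LinearMap.det (stretch η α β) = (α : ℂ) * (β : ℂ) ^ (n - 1) := by
    -- The transvection form gives the determinant at once: β^n (1 + (α-β)/β) = αβ^{n-1}.
    rw [stretch, LinearMap.det_smul, LinearMap.transvection.det, finrank_euclideanSpace_fin]
    simp only [ContinuousLinearMap.coe_coe, innerSL_apply_apply, inner_smul_right,
      inner_self_of_norm_one hη]
    obtain ⟨m, rfl⟩ := Nat.exists_eq_add_of_le' hn
    rw [pow_succ, Nat.add_sub_cancel]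
    push_cast
    field_simp
    ring
  rw [h, norm_mul, norm_pow, Complex.norm_real, Complex.norm_real, mul_pow, Real.norm_eq_abs,
    sq_abs, ← pow_mul, mul_comm (n - 1) 2, pow_mul, Real.norm_eq_abs, sq_abs]

theorem inner_stretch {η : Cn n} (hη : ‖η‖ = 1) {α β : ℝ} (hβ : β ≠ 0) (x : Cn n) :
    inner ℂ η (stretch η α β x) = α * inner ℂ η x := by
  rw [stretch_apply hβ, inner_add_right, inner_smul_right, inner_smul_right,
    inner_self_of_norm_one hη]
  push_cast; ring

theorem norm_sq_eq_add_of_norm_one {η : Cn n} (hη : ‖η‖ = 1) (x : Cn n) :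
    ‖x‖ ^ 2 = ‖(inner ℂ η x : ℂ)‖ ^ 2 + ‖x - (inner ℂ η x : ℂ) • η‖ ^ 2 := by
  have h := norm_add_sq_eq_norm_sq_add_norm_sq_of_inner_eq_zero (𝕜 := ℂ)
    ((inner ℂ η x : ℂ) • η) (x - (inner ℂ η x : ℂ) • η)
    (by rw [inner_smul_left, inner_sub_right, inner_smul_right, inner_self_of_norm_one hη]; simp)
  rw [add_sub_cancel, norm_smul, hη, mul_one] at h
  nlinarith

theorem norm_sub_inner_smul_le {η : Cn n} (hη : ‖η‖ = 1) (x : Cn n) :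
    ‖x - (inner ℂ η x : ℂ) • η‖ ≤ ‖x‖ := by
  have := norm_sq_eq_add_of_norm_one hη x
  exact le_of_sq_le_sq (by nlinarith [sq_nonneg ‖(inner ℂ η x : ℂ)‖]) (norm_nonneg _)

theorem stretch_ball_bounds {η : Cn n} (hη : ‖η‖ = 1) {α β : ℝ} (hα : 0 < α) (hβ : 0 < β)
    {x : Cn n} (hx : ‖x‖ < 1) :
    ‖(inner ℂ η (stretch η α β x) : ℂ)‖ < α ∧
      ‖stretch η α β x - (inner ℂ η (stretch η α β x) : ℂ) • η‖ < β := by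
  constructor
  · rw [inner_stretch hη hβ.ne', norm_mul, Complex.norm_real, Real.norm_of_nonneg hα.le]
    have := norm_inner_le_norm (𝕜 := ℂ) η x
    rw [hη, one_mul] at this
    nlinarith
  · rw [inner_stretch hη hβ.ne']
    have : stretch η α β x - ((α : ℂ) * inner ℂ η x) • η
        = (β : ℂ) • (x - (inner ℂ η x : ℂ) • η) := by
      rw [stretch_apply hβ.ne', smul_sub, smul_smul, add_sub_assoc, ← sub_smul,
        sub_eq_add_neg ((β : ℂ) • x), ← neg_smul]
      congr 2
      push_cast; ring
    rw [this, norm_smul, Complex.norm_real, Real.norm_of_nonneg hβ.le]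
    have := norm_sub_inner_smul_le hη x
    nlinarith

/-- The radius is 2 because the two rescaled components, each of norm at most 1, are added by the
triangle inequality. -/
theorem mem_stretch_image {η : Cn n} (hη : ‖η‖ = 1) {α β : ℝ} (hα : 0 < α) (hβ : 0 < β)
    {y : Cn n} (h1 : ‖(inner ℂ η y : ℂ)‖ < α) (h2 : ‖y - (inner ℂ η y : ℂ) • η‖ ≤ β) :
    y ∈ stretch η α β '' Metric.ball 0 2 := by
  have hα' : (α : ℂ) ≠ 0 := by exact_mod_cast hα.ne'
  have hβ' : (β : ℂ) ≠ 0 := by exact_mod_cast hβ.ne'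
  set u : ℂ := inner ℂ η y with hu
  have hin : inner ℂ η ((u / α) • η + (β : ℂ)⁻¹ • (y - u • η)) = u / α := by
    rw [inner_add_right, inner_smul_right, inner_smul_right, inner_sub_right, inner_smul_right,
      inner_self_of_norm_one hη, ← hu]
    ring
  refine ⟨(u / α) • η + (β : ℂ)⁻¹ • (y - u • η), ?_, ?_⟩
  · rw [mem_ball_zero_iff]
    refine (norm_add_le _ _).trans_lt ?_
    rw [norm_smul, norm_smul, hη, mul_one, norm_div, norm_inv, Complex.norm_real,
      Complex.norm_real, Real.norm_of_nonneg hα.le, Real.norm_of_nonneg hβ.le]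
    have e1 : ‖u‖ / α < 1 := (div_lt_one hα).2 h1
    have e2 : β⁻¹ * ‖y - u • η‖ ≤ 1 := (inv_mul_le_one₀ hβ).2 h2
    linarith
  · rw [stretch_apply hβ.ne', hin, smul_add, smul_smul, smul_smul, mul_inv_cancel₀ hβ', one_smul,
      add_right_comm, ← add_smul]
    have : (β : ℂ) * (u / α) + ((α - β : ℝ) : ℂ) * (u / α) = u := by
      push_cast; field_simp; ring
    rw [this, add_sub_cancel]

/-- The exponent of the radius in polar coordinates on complex `n`-space. -/
def polarExp (n : ℕ) : ℕ := Module.finrank ℝ (Cn n) - 1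

/-- Surface measure on the unit sphere of complex `n`-space. -/
abbrev sphereMeasure (n : ℕ) : Measure (Metric.sphere (0 : Cn n) 1) := (haar n).toSphere

theorem lintegral_polar (hn : 1 ≤ n) {F : Cn n → ℝ≥0∞} (hF : Measurable F) :
    ∫⁻ z, F z ∂haar n = ∫⁻ t in Ioi (0 : ℝ), ENNReal.ofReal (t ^ polarExp n) *
      ∫⁻ ζ, F (t • (ζ : Cn n)) ∂sphereMeasure n := by
  have : Nonempty (Fin n) := ⟨⟨0, hn⟩⟩
  have : Nontrivial (Cn n) := inferInstance
  have h1 : ∫⁻ z, F z ∂haar n = ∫⁻ z : ({0}ᶜ : Set (Cn n)), F z ∂((haar n).comap (↑)) := by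
    rw [lintegral_subtype_comap (measurableSet_singleton _).compl, restrict_compl_singleton]
  have h2 := (haar n).measurePreserving_homeomorphUnitSphereProd
  have h3 : ∫⁻ z : ({0}ᶜ : Set (Cn n)), F z ∂((haar n).comap (↑))
      = ∫⁻ q, F ((q.2 : ℝ) • (q.1 : Cn n)) ∂((sphereMeasure n).prod
        (Measure.volumeIoiPow (Module.finrank ℝ (Cn n) - 1))) := by
    rw [← h2.lintegral_comp_emb (Homeomorph.measurableEmbedding _)]
    refine lintegral_congr fun z => ?_
    congr 1
    have : ‖(z : Cn n)‖ ≠ 0 := norm_ne_zero_iff.2 z.2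
    simp [homeomorphUnitSphereProd, smul_smul, mul_inv_cancel₀ this]
  have hm : Measurable fun q : Metric.sphere (0 : Cn n) 1 × Ioi (0 : ℝ) =>
      F ((q.2 : ℝ) • (q.1 : Cn n)) := by
    refine hF.comp (Continuous.measurable ?_)
    fun_prop
  have hm2 : Measurable fun q : Ioi (0 : ℝ) × Metric.sphere (0 : Cn n) 1 =>
      F ((q.1 : ℝ) • (q.2 : Cn n)) := by
    refine hF.comp (Continuous.measurable ?_)
    fun_prop
  rw [h1, h3, lintegral_prod_symm _ hm.aemeasurable, Measure.volumeIoiPow,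
    lintegral_withDensity_eq_lintegral_mul _ (by fun_prop) hm2.lintegral_prod_right',
    ← lintegral_subtype_comap measurableSet_Ioi]
  rfl

end

section

/-! ### Non-isotropic caps -/

variable {n : ℕ}

/-- The non-isotropic region `{w ∈ B : |1 - ⟨w, η⟩| < δ}`. -/
def tent (η : Cn n) (δ : ℝ) : Set (Cn n) := {w | ‖w‖ < 1 ∧ ‖1 - inner ℂ η w‖ < δ}

/-- The non-isotropic cap `{ζ : |1 - ⟨ζ, η⟩| < δ}` on the unit sphere. -/
def cap (η : Cn n) (δ : ℝ) : Set (Metric.sphere (0 : Cn n) 1) :=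
  {ζ | ‖1 - inner ℂ η (ζ : Cn n)‖ < δ}

theorem measurableSet_tent (η : Cn n) (δ : ℝ) : MeasurableSet (tent η δ) :=
  ((isOpen_lt (f := fun w : Cn n => ‖w‖) (g := fun _ => 1) (by fun_prop) (by fun_prop)).inter
    (isOpen_lt (f := fun w : Cn n => ‖1 - inner ℂ η w‖) (g := fun _ => δ)
      (by fun_prop) (by fun_prop))).measurableSet

theorem measurableSet_cap (η : Cn n) (δ : ℝ) : MeasurableSet (cap η δ) :=
  (isOpen_lt (f := fun ζ : Metric.sphere (0 : Cn n) 1 => ‖1 - inner ℂ η (ζ : Cn n)‖)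
    (g := fun _ => δ) (by fun_prop) (by fun_prop)).measurableSet

theorem norm_sphere (ζ : Metric.sphere (0 : Cn n) 1) : ‖(ζ : Cn n)‖ = 1 := by
  simp

theorem haar_tent_le (hn : 1 ≤ n) {η : Cn n} (hη : ‖η‖ = 1) {δ : ℝ} (hδ : 0 < δ) :
    haar n (tent η δ) ≤ 2 ^ (n - 1) * haar n (Metric.ball 0 2) * ENNReal.ofReal δ ^ (n + 1) := by
  -- If |w| < 1 and |1-⟨w,η⟩| < δ, the part of w orthogonal to η has squared norm at most 1-|⟨w,η⟩|²
  -- ≤ 2δ.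
  have hβ : 0 < Real.sqrt (2 * δ) := Real.sqrt_pos.2 (by positivity)
  have hsub : tent η δ ⊆ (fun x => η + x) '' (stretch η δ (Real.sqrt (2 * δ)) '' Metric.ball 0 2) := by
    rintro w ⟨hw1, hw2⟩
    refine ⟨w - η, mem_stretch_image hη hδ hβ ?_ ?_, by simp⟩
    · rw [inner_sub_right, inner_self_of_norm_one hη, norm_sub_rev]
      exact hw2
    · have e : w - η - (inner ℂ η (w - η) : ℂ) • η = w - (inner ℂ η w : ℂ) • η := by
        rw [inner_sub_right, inner_self_of_norm_one hη, sub_smul, one_smul]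
        abel
      rw [e]
      apply Real.le_sqrt_of_sq_le
      have h1 := norm_sq_eq_add_of_norm_one hη w
      have h2 := norm_sub_norm_le (1 : ℂ) (inner ℂ η w)
      have h3 := norm_inner_le_norm (𝕜 := ℂ) η w
      rw [hη, one_mul] at h3
      rw [norm_one] at h2
      nlinarith [norm_nonneg (inner ℂ η w : ℂ), norm_nonneg w]
  refine (measure_mono hsub).trans ?_
  rw [image_add_left, measure_preimage_add, haar_image_stretch hn hη hβ,
    Real.sq_sqrt (by positivity)]
  rw [ENNReal.ofReal_mul (by positivity), ENNReal.ofReal_pow hδ.le, ENNReal.ofReal_pow (by positivity),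
    ENNReal.ofReal_mul (by positivity), mul_pow, mul_left_comm, ← pow_add, ENNReal.ofReal_ofNat,
    show 2 + (n - 1) = n + 1 by omega]
  exact le_of_eq (by ring)

/-- The ellipsoid centred at (1-δ/2)η with semi-axes δ/8 and √(δ/8) fits inside: |w|² < (1-3δ/8)² +
δ/8 ≤ 1 and |1-⟨w,η⟩| < δ/2 + δ/8. -/
theorem le_haar_tent (hn : 1 ≤ n) {η : Cn n} (hη : ‖η‖ = 1) {δ : ℝ} (hδ : 0 < δ) (hδ1 : δ ≤ 1) :
    ENNReal.ofReal (δ / 8) ^ (n + 1) * haar n (Metric.ball 0 1) ≤ haar n (tent η δ) := by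
  have hβ : 0 < Real.sqrt (δ / 8) := Real.sqrt_pos.2 (by positivity)
  have hsub : (fun x => (((1 - δ / 2 : ℝ) : ℂ) • η) + x) ''
      (stretch η (δ / 8) (Real.sqrt (δ / 8)) '' Metric.ball 0 1) ⊆ tent η δ := by
    rintro _ ⟨_, ⟨x, hx, rfl⟩, rfl⟩
    obtain ⟨h1, h2⟩ := stretch_ball_bounds hη (by positivity : 0 < δ / 8) hβ
      (mem_ball_zero_iff.1 hx)
    set y := stretch η (δ / 8) (Real.sqrt (δ / 8)) x
    have hin : (inner ℂ η ((((1 - δ / 2 : ℝ) : ℂ) • η) + y) : ℂ)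
        = ((1 - δ / 2 : ℝ) : ℂ) + inner ℂ η y := by
      rw [inner_add_right, inner_smul_right, inner_self_of_norm_one hη, mul_one]
    constructor
    · have h3 := norm_sq_eq_add_of_norm_one hη ((((1 - δ / 2 : ℝ) : ℂ) • η) + y)
      have e : (((1 - δ / 2 : ℝ) : ℂ) • η) + y - (inner ℂ η ((((1 - δ / 2 : ℝ) : ℂ) • η) + y) : ℂ) • η
          = y - (inner ℂ η y : ℂ) • η := by
        rw [hin, add_smul]; abel
      rw [e, hin] at h3
      have h4 : ‖((1 - δ / 2 : ℝ) : ℂ) + inner ℂ η y‖ ≤ 1 - δ / 2 + δ / 8 := by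
        refine (norm_add_le _ _).trans ?_
        rw [Complex.norm_real, Real.norm_of_nonneg (by linarith)]
        linarith
      have h5 : ‖y - (inner ℂ η y : ℂ) • η‖ ^ 2 < δ / 8 := by
        have := pow_lt_pow_left₀ h2 (norm_nonneg _) two_ne_zero
        rwa [Real.sq_sqrt (by positivity)] at this
      have h6 : ‖((1 - δ / 2 : ℝ) : ℂ) + inner ℂ η y‖ ^ 2 ≤ (1 - δ / 2 + δ / 8) ^ 2 := by gcongr
      have h7 : (1 - δ / 2 + δ / 8) ^ 2 ≤ 1 - δ / 2 + δ / 8 := by nlinarith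
      refine lt_of_pow_lt_pow_left₀ 2 zero_le_one ?_
      rw [h3]
      linarith
    · rw [hin]
      have e : (1 : ℂ) - (((1 - δ / 2 : ℝ) : ℂ) + inner ℂ η y)
          = ((δ / 2 : ℝ) : ℂ) - inner ℂ η y := by push_cast; ring
      rw [e]
      refine (norm_sub_le _ _).trans_lt ?_
      rw [Complex.norm_real, Real.norm_of_nonneg (by linarith)]
      linarith
  refine le_trans ?_ (measure_mono hsub)
  rw [image_add_left, measure_preimage_add, haar_image_stretch hn hη hβ,
    Real.sq_sqrt (by positivity), ← pow_add, ENNReal.ofReal_pow (by positivity),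
    show 2 + (n - 1) = n + 1 by omega]

theorem inner_real_smul (η ζ : Cn n) (t : ℝ) : (inner ℂ η (t • ζ) : ℂ) = t * inner ℂ η ζ := by
  rw [← Complex.coe_smul, inner_smul_right]

theorem norm_real_smul_sphere (ζ : Metric.sphere (0 : Cn n) 1) {t : ℝ} (ht : 0 ≤ t) :
    ‖t • (ζ : Cn n)‖ = t := by
  rw [norm_smul, norm_sphere, mul_one, Real.norm_of_nonneg ht]

theorem norm_inner_sphere_le {η : Cn n} (hη : ‖η‖ ≤ 1) (ζ : Metric.sphere (0 : Cn n) 1) :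
    ‖(inner ℂ η (ζ : Cn n) : ℂ)‖ ≤ 1 := by
  refine (norm_inner_le_norm (𝕜 := ℂ) η ζ).trans ?_
  rw [norm_sphere, mul_one]
  exact hη

theorem norm_one_sub_mul_le {x : ℂ} (hx : ‖x‖ ≤ 1) {s : ℝ} (hs : s ≤ 1) :
    ‖1 - s * x‖ ≤ ‖1 - x‖ + (1 - s) := by
  have : 1 - (s : ℂ) * x = (1 - x) + ((1 - s : ℝ) : ℂ) * x := by push_cast; ring
  rw [this]
  refine (norm_add_le _ _).trans ?_
  rw [norm_mul, Complex.norm_real, Real.norm_of_nonneg (by linarith)]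
  nlinarith

theorem norm_one_sub_le_mul {x : ℂ} (hx : ‖x‖ ≤ 1) {s : ℝ} (hs : s ≤ 1) :
    ‖1 - x‖ ≤ ‖1 - s * x‖ + (1 - s) := by
  have : 1 - x = (1 - (s : ℂ) * x) - ((1 - s : ℝ) : ℂ) * x := by push_cast; ring
  rw [this]
  refine (norm_sub_le _ _).trans ?_
  rw [norm_mul, Complex.norm_real, Real.norm_of_nonneg (by linarith)]
  nlinarith

/-- The points tζ with ζ in the cap and 1-δ/2 < t < 1 lie in the tent of width 2δ, whose volume is
O(δ^{n+1}); dividing by the thickness of the shell leaves δ^n. For δ > 1 the total surface measure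
suffices. -/
theorem sphereMeasure_cap_le (hn : 1 ≤ n) : ∃ C : ℝ≥0, ∀ η : Cn n, ‖η‖ = 1 → ∀ δ : ℝ, 0 < δ →
    sphereMeasure n (cap η δ) ≤ C * ENNReal.ofReal δ ^ n := by
  set k := polarExp n
  set A : ℝ≥0∞ := 2 ^ (n - 1) * haar n (Metric.ball 0 2) with hA
  have hAfin : A ≠ ∞ := ENNReal.mul_ne_top (by simp) measure_ball_lt_top.ne
  set C₁ : ℝ≥0∞ := A * 2 ^ (n + 1) * (2 * 2 ^ k) with hC₁
  have hC₁fin : C₁ ≠ ∞ := by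
    refine ENNReal.mul_ne_top (ENNReal.mul_ne_top hAfin (by simp)) (ENNReal.mul_ne_top (by simp) (by simp))
  have hS : sphereMeasure n univ ≠ ∞ := measure_ne_top _ _
  refine ⟨(C₁ + sphereMeasure n univ).toNNReal, fun η hη δ hδ => ?_⟩
  rw [ENNReal.coe_toNNReal (ENNReal.add_ne_top.2 ⟨hC₁fin, hS⟩)]
  rcases le_or_gt δ 1 with hδ1 | hδ1
  · have h1 := haar_tent_le hn hη (δ := 2 * δ) (by positivity)
    have h2 : ENNReal.ofReal (δ / 2) * (ENNReal.ofReal ((1 / 2) ^ k) * sphereMeasure n (cap η δ))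
        ≤ haar n (tent η (2 * δ)) := by
      rw [← lintegral_indicator_one (measurableSet_tent _ _), lintegral_polar hn
        (measurable_one.indicator (measurableSet_tent _ _))]
      calc _ = ∫⁻ t in Ioo (1 - δ / 2) 1, ENNReal.ofReal ((1 / 2) ^ k) * sphereMeasure n (cap η δ) := by
            rw [setLIntegral_const, Real.volume_Ioo, mul_comm]; congr 2; ring
        _ ≤ ∫⁻ t in Ioo (1 - δ / 2) 1, ENNReal.ofReal (t ^ k) *
              ∫⁻ ζ, (tent η (2 * δ)).indicator 1 (t • (ζ : Cn n)) ∂sphereMeasure n := by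
            refine setLIntegral_mono' measurableSet_Ioo fun t ht => ?_
            have ht2 : 1 / 2 ≤ t := by linarith [ht.1]
            gcongr
            rw [← lintegral_indicator_one (measurableSet_cap _ _)]
            refine lintegral_mono fun ζ => ?_
            by_cases hζ : ζ ∈ cap η δ
            · rw [indicator_of_mem hζ, indicator_of_mem]
              · simp
              · refine ⟨?_, ?_⟩
                · rw [norm_real_smul_sphere _ (by linarith)]; exact ht.2
                · rw [inner_real_smul]
                  have := norm_one_sub_mul_le (norm_inner_sphere_le hη.le ζ) ht.2.le
                  have h3 : ‖1 - inner ℂ η (ζ : Cn n)‖ < δ := hζ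
                  linarith [ht.1]
            · simp [indicator_of_notMem hζ]
        _ ≤ _ := lintegral_mono_set fun t ht => by
            have := ht.1
            simp only [mem_Ioi]; linarith
    have h3 := h2.trans h1
    have hδ0 : ENNReal.ofReal δ ≠ 0 := by simpa using hδ
    have e1 : ENNReal.ofReal (δ / 2) = ENNReal.ofReal δ * 2⁻¹ := by
      rw [div_eq_mul_inv, ENNReal.ofReal_mul hδ.le, ENNReal.ofReal_inv_of_pos two_pos,
        ENNReal.ofReal_ofNat]
    have e2 : ENNReal.ofReal ((1 / 2) ^ k) = (2⁻¹) ^ k := by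
      rw [ENNReal.ofReal_pow (by norm_num), one_div, ENNReal.ofReal_inv_of_pos two_pos,
        ENNReal.ofReal_ofNat]
    rw [e1, e2, ENNReal.ofReal_mul zero_le_two, ENNReal.ofReal_ofNat, mul_pow] at h3
    refine le_trans ?_ (mul_le_mul_left (le_add_right le_rfl) _)
    have h5 : ENNReal.ofReal δ * sphereMeasure n (cap η δ)
        ≤ ENNReal.ofReal δ * (C₁ * ENNReal.ofReal δ ^ n) := by
      calc ENNReal.ofReal δ * sphereMeasure n (cap η δ)
          = (2 * 2 ^ k) * (ENNReal.ofReal δ * 2⁻¹ * (2⁻¹ ^ k * sphereMeasure n (cap η δ))) := by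
            have h22 : (2 : ℝ≥0∞) * 2⁻¹ = 1 := ENNReal.mul_inv_cancel (by simp) (by simp)
            have h2k : (2 : ℝ≥0∞) ^ k * 2⁻¹ ^ k = 1 := by rw [← mul_pow, h22, one_pow]
            calc _ = (2 * 2⁻¹) * (2 ^ k * 2⁻¹ ^ k)
                  * (ENNReal.ofReal δ * sphereMeasure n (cap η δ)) := by rw [h22, h2k]; simp
              _ = _ := by ring
        _ ≤ (2 * 2 ^ k) * (A * (2 ^ (n + 1) * ENNReal.ofReal δ ^ (n + 1))) := by gcongr
        _ = _ := by rw [hC₁]; ring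
    exact (ENNReal.mul_le_mul_iff_right hδ0 ENNReal.ofReal_ne_top).1 h5
  · calc sphereMeasure n (cap η δ) ≤ sphereMeasure n univ * 1 := by
          rw [mul_one]; exact measure_mono (subset_univ _)
      _ ≤ _ := by
        gcongr
        · exact le_add_left le_rfl
        · exact one_le_pow₀ (by simpa using hδ1.le)

/-- Conversely, the tent of width δ/2 only meets radii in (1-δ/2, 1), and each of its radial
projections falls into the cap of width δ. -/
theorem le_sphereMeasure_cap (hn : 1 ≤ n) : ∃ c : ℝ≥0, 0 < c ∧ ∀ η : Cn n, ‖η‖ = 1 →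
    ∀ δ : ℝ, 0 < δ → δ ≤ 1 → c * ENNReal.ofReal δ ^ n ≤ sphereMeasure n (cap η δ) := by
  set k := polarExp n
  set b : ℝ≥0∞ := haar n (Metric.ball 0 1) with hb
  have hbfin : b ≠ ∞ := measure_ball_lt_top.ne
  have hb0 : b ≠ 0 := (Metric.measure_ball_pos _ _ one_pos).ne'
  set c₁ : ℝ≥0∞ := 16⁻¹ ^ (n + 1) * b with hc₁
  have hc₁fin : c₁ ≠ ∞ := ENNReal.mul_ne_top (by simp) hbfin
  have hc₁0 : c₁ ≠ 0 := mul_ne_zero (by simp) hb0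
  refine ⟨c₁.toNNReal, ENNReal.toNNReal_pos hc₁0 hc₁fin, fun η hη δ hδ hδ1 => ?_⟩
  rw [ENNReal.coe_toNNReal hc₁fin]
  have h1 := le_haar_tent hn hη (δ := δ / 2) (by positivity) (by linarith)
  have h2 : haar n (tent η (δ / 2)) ≤ ENNReal.ofReal δ * sphereMeasure n (cap η δ) := by
    rw [← lintegral_indicator_one (measurableSet_tent _ _), lintegral_polar hn
      (measurable_one.indicator (measurableSet_tent _ _))]
    calc _ ≤ ∫⁻ t in Ioi (0 : ℝ), (Ioo (1 - δ) 1).indicator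
            (fun _ => sphereMeasure n (cap η δ)) t := by
          refine setLIntegral_mono' measurableSet_Ioi fun t ht => ?_
          have ht0 : 0 < t := ht
          by_cases htI : t ∈ Ioo (1 - δ / 2) 1
          · have htm : t ∈ Ioo (1 - δ) 1 := ⟨by linarith [htI.1], htI.2⟩
            rw [indicator_of_mem htm, ← one_mul (sphereMeasure n (cap η δ))]
            gcongr
            · exact ENNReal.ofReal_le_one.2 (pow_le_one₀ ht0.le htI.2.le)
            rw [← lintegral_indicator_one (measurableSet_cap _ _)]
            refine lintegral_mono fun ζ => ?_
            by_cases hζ : t • (ζ : Cn n) ∈ tent η (δ / 2)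
            · rw [indicator_of_mem hζ, indicator_of_mem]
              · simp
              · have h3 := hζ.2
                rw [inner_real_smul] at h3
                have := norm_one_sub_le_mul (norm_inner_sphere_le hη.le ζ) htI.2.le
                change ‖1 - inner ℂ η (ζ : Cn n)‖ < δ
                linarith [htI.1]
            · simp [indicator_of_notMem hζ]
          · have : ∀ ζ : Metric.sphere (0 : Cn n) 1, t • (ζ : Cn n) ∉ tent η (δ / 2) := by
              intro ζ hζ
              refine htI ⟨?_, ?_⟩
              · have h3 := one_sub_norm_le_norm_one_sub_inner (z := t • (ζ : Cn n)) hη.le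
                rw [norm_one_sub_inner_comm, norm_real_smul_sphere _ ht0.le] at h3
                linarith [hζ.2]
              · have := hζ.1
                rwa [norm_real_smul_sphere _ ht0.le] at this
            simp [indicator_of_notMem (this _)]
      _ ≤ ∫⁻ t, (Ioo (1 - δ) 1).indicator (fun _ => sphereMeasure n (cap η δ)) t :=
          setLIntegral_le_lintegral _ _
      _ = _ := by
          rw [lintegral_indicator measurableSet_Ioo, setLIntegral_const, Real.volume_Ioo, mul_comm]
          congr 2; ring
  have h3 := h1.trans h2
  have hδ0 : ENNReal.ofReal δ ≠ 0 := by simpa using hδ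
  refine (ENNReal.mul_le_mul_iff_right hδ0 ENNReal.ofReal_ne_top).1 (le_trans (le_of_eq ?_) h3)
  have e1 : ENNReal.ofReal (δ / 2 / 8) = ENNReal.ofReal δ * 16⁻¹ := by
    rw [show δ / 2 / 8 = δ * 16⁻¹ by ring, ENNReal.ofReal_mul hδ.le,
      ENNReal.ofReal_inv_of_pos (by norm_num), ENNReal.ofReal_ofNat]
  rw [e1, hc₁]
  ring

end

section

/-! ### Doubling profiles -/

variable {n : ℕ}

/-- The tail integral of a nonnegative profile. -/
def mass (W : ℝ → ℝ≥0∞) (r : ℝ) : ℝ≥0∞ := ∫⁻ s in Ioo r 1, W s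

/-- A measurable profile with doubling tail integrals and a definite amount of mass on the
intervals `((1 + r) / 2, 1 - (1 - r) / (2 * K)]`. -/
structure IsDoublingProfile (W : ℝ → ℝ≥0∞) (A B : ℝ≥0) (K : ℝ) : Prop where
  measurable : Measurable W
  one_lt : 1 < K
  ne_top : ∀ r ∈ Ico (0 : ℝ) 1, mass W r ≠ ∞
  ne_zero : ∀ r ∈ Ico (0 : ℝ) 1, mass W r ≠ 0
  upper : ∀ r ∈ Ico (0 : ℝ) 1, mass W r ≤ A * mass W ((r + 1) / 2)
  reverse : ∀ r ∈ Ico (0 : ℝ) 1,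
    mass W r ≤ B * ∫⁻ s in Ioc ((r + 1) / 2) (1 - (1 - r) / (2 * K)), W s

/-- The measure on the ball with radial density `W`. -/
def radialMeasure (n : ℕ) (W : ℝ → ℝ≥0∞) : Measure (Cn n) :=
  (vol n).withDensity fun z => W ‖z‖

/-- The normalizing constant of the volume measure of the ball. -/
def volConst (n : ℕ) : ℝ≥0∞ := (haar n (unitBall n))⁻¹

theorem volConst_ne_zero : volConst n ≠ 0 :=
  ENNReal.inv_ne_zero.2 (Metric.isBounded_ball.measure_lt_top).ne

theorem volConst_ne_top : volConst n ≠ ∞ :=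
  ENNReal.inv_ne_top.2 (Metric.measure_ball_pos _ _ one_pos).ne'

theorem vol_eq : vol n = volConst n • (haar n).restrict (unitBall n) := rfl

theorem ae_vol_iff {P : Cn n → Prop} :
    (∀ᵐ z ∂vol n, P z) ↔ ∀ᵐ z ∂(haar n).restrict (unitBall n), P z := by
  rw [vol_eq, Measure.ae_ennreal_smul_measure_iff volConst_ne_zero]

theorem mass_anti (W : ℝ → ℝ≥0∞) {r s : ℝ} (h : r ≤ s) : mass W s ≤ mass W r :=
  lintegral_mono_set (Ioo_subset_Ioo_left h)

theorem lintegral_radialMeasure (hn : 1 ≤ n) {W : ℝ → ℝ≥0∞} (hW : Measurable W)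
    {F : Cn n → ℝ≥0∞} (hF : Measurable F) :
    ∫⁻ z, F z ∂radialMeasure n W = volConst n * ∫⁻ t in Ioo (0 : ℝ) 1,
      W t * (ENNReal.ofReal (t ^ polarExp n) * ∫⁻ ζ, F (t • (ζ : Cn n)) ∂sphereMeasure n) := by
  have hWn : Measurable fun z : Cn n => W ‖z‖ := hW.comp measurable_norm
  rw [radialMeasure, lintegral_withDensity_eq_lintegral_mul _ hWn hF, vol_eq,
    lintegral_smul_measure, smul_eq_mul, ← lintegral_indicator isOpen_unitBall.measurableSet,
    lintegral_polar hn ((hWn.mul hF).indicator isOpen_unitBall.measurableSet)]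
  congr 1
  rw [← lintegral_indicator measurableSet_Ioo, ← lintegral_indicator measurableSet_Ioi]
  refine lintegral_congr fun t => ?_
  rcases le_or_gt t 0 with ht0 | ht0
  · have h1 : t ∉ Ioi (0 : ℝ) := not_lt.2 ht0
    have h2 : t ∉ Ioo (0 : ℝ) 1 := fun h => not_lt.2 ht0 h.1
    rw [indicator_of_notMem h1, indicator_of_notMem h2]
  have hmem : t ∈ Ioi (0 : ℝ) := ht0
  rw [indicator_of_mem hmem]
  have hB : ∀ ζ : Metric.sphere (0 : Cn n) 1, t • (ζ : Cn n) ∈ unitBall n ↔ t < 1 := fun ζ => by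
    rw [mem_unitBall, norm_real_smul_sphere _ ht0.le]
  rcases lt_or_ge t 1 with ht1 | ht1
  · have h2 : t ∈ Ioo (0 : ℝ) 1 := ⟨ht0, ht1⟩
    have hFm : Measurable fun ζ : Metric.sphere (0 : Cn n) 1 => F (t • (ζ : Cn n)) :=
      hF.comp (Continuous.measurable (by fun_prop))
    rw [indicator_of_mem h2, mul_left_comm, ← lintegral_const_mul (W t) hFm]
    congr 1
    refine lintegral_congr fun ζ => ?_
    rw [indicator_of_mem ((hB ζ).2 ht1), Pi.mul_apply, norm_real_smul_sphere _ ht0.le]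
  · have h2 : t ∉ Ioo (0 : ℝ) 1 := fun h => not_lt.2 ht1 h.2
    rw [indicator_of_notMem h2]
    have : ∀ ζ : Metric.sphere (0 : Cn n) 1,
        (unitBall n).indicator ((fun z => W ‖z‖) * F) (t • (ζ : Cn n)) = 0 := fun ζ =>
      indicator_of_notMem (fun h => not_lt.2 ht1 ((hB ζ).1 h)) _
    simp [this]

/-- By polar coordinates, a null set of radii sweeps out a null set. This allows the a.e. measurable
profile to be exchanged for a Borel one without changing the measure on the ball. -/
theorem ae_vol_of_ae_radius (hn : 1 ≤ n) {P : ℝ → Prop}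
    (h : ∀ᵐ t ∂(volume.restrict (Ico (0 : ℝ) 1)), P t) : ∀ᵐ z ∂vol n, P ‖z‖ := by
  rw [ae_restrict_iff' measurableSet_Ico, ae_iff] at h
  rw [ae_vol_iff, ae_restrict_iff' isOpen_unitBall.measurableSet, ae_iff]
  set N := toMeasurable volume {t | ¬(t ∈ Ico (0 : ℝ) 1 → P t)} with hN
  have hN0 : volume N = 0 := by rw [hN, measure_toMeasurable, h]
  have hNm : MeasurableSet N := measurableSet_toMeasurable _ _
  have hm : MeasurableSet {z : Cn n | ‖z‖ ∈ N} := measurable_norm hNm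
  refine measure_mono_null (t := {z : Cn n | ‖z‖ ∈ N}) ?_ ?_
  · intro z hz
    refine subset_toMeasurable _ _ ?_
    intro hP
    exact hz fun hzB => hP ⟨norm_nonneg z, mem_unitBall.1 hzB⟩
  · rw [← lintegral_indicator_one hm, lintegral_polar hn (measurable_one.indicator hm)]
    refine lintegral_eq_zero_of_ae_eq_zero ?_
    have h0 : ∀ᵐ t ∂(volume : Measure ℝ), t ∉ N := measure_eq_zero_iff_ae_notMem.1 hN0
    filter_upwards [ae_restrict_of_ae h0, ae_restrict_mem measurableSet_Ioi] with t ht ht0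
    have : ∀ ζ : Metric.sphere (0 : Cn n) 1, t • (ζ : Cn n) ∉ {z : Cn n | ‖z‖ ∈ N} := fun ζ => by
      change ‖t • (ζ : Cn n)‖ ∉ N
      rwa [norm_real_smul_sphere _ (le_of_lt ht0)]
    simp [indicator_of_notMem (this _)]

/-- With u = (1+r)/2 and v = 1-(1-u)/K, reverse doubling at u says that the tail beyond v is at most
1/C' of the tail beyond u, so (u,v] carries the proportion (C'-1)/C' at least. Upper doubling passes
from r to u, hence B = C·C'/(C'-1). Finiteness and positivity of tails come from the strict
inequality. -/
theorem exists_profile (hn : 1 ≤ n) {ω : ℝ → ℝ} (hω : IsTwoSidedDoubling n ω) :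
    ∃ W A B K, IsDoublingProfile W A B K ∧ weightMeasure n ω = radialMeasure n W := by
  have hae : AEMeasurable (fun t => ENNReal.ofReal (ω t)) (volume.restrict (Ico (0 : ℝ) 1)) :=
    hω.radialWeight.aemeasurable.ennreal_ofReal
  set W := hae.mk with hWdef
  have hW : Measurable W := hae.measurable_mk
  have htail : ∀ r ∈ Ico (0 : ℝ) 1, tail ω r = mass W r := by
    intro r hr
    refine lintegral_congr_ae ?_
    exact ae_restrict_of_ae_restrict_of_subset
      (fun s hs => ⟨hr.1.trans hs.1.le, hs.2⟩ : Ioo r 1 ⊆ Ico (0 : ℝ) 1) hae.ae_eq_mk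
  have hhalf : ∀ r ∈ Ico (0 : ℝ) 1, (r + 1) / 2 ∈ Ico (0 : ℝ) 1 := fun r hr =>
    ⟨by linarith [hr.1], by linarith [hr.2]⟩
  obtain ⟨C, hC1, hC⟩ := hω.upper
  obtain ⟨C', K, hC'1, hK1, hC'⟩ := hω.reverse
  have hfin : ∀ r ∈ Ico (0 : ℝ) 1, mass W r ≠ ∞ := fun r hr => by
    rw [← htail r hr]; exact (hC r hr).ne_top
  have hne0 : ∀ r ∈ Ico (0 : ℝ) 1, mass W r ≠ 0 := fun r hr h0 => by
    have h := hC r hr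
    rw [htail r hr, htail _ (hhalf r hr)] at h
    have h1 : mass W ((r + 1) / 2) = 0 :=
      le_antisymm (h0 ▸ mass_anti W (by linarith [hr.2])) zero_le
    rw [h1, mul_zero] at h
    exact not_lt_zero h
  have hup : ∀ r ∈ Ico (0 : ℝ) 1, mass W r ≤ C.toNNReal * mass W ((r + 1) / 2) := fun r hr => by
    have h := hC r hr
    rw [htail r hr, htail _ (hhalf r hr)] at h
    exact h.le
  have hrev : ∀ r ∈ Ico (0 : ℝ) 1, mass W ((r + 1) / 2) ≤ (C' / (C' - 1)).toNNReal *
      ∫⁻ s in Ioc ((r + 1) / 2) (1 - (1 - r) / (2 * K)), W s := fun r hr => by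
    have hr' := hhalf r hr
    set u := (r + 1) / 2 with hu
    set v := 1 - (1 - r) / (2 * K) with hv
    have hv' : v = 1 - (1 - u) / K := by rw [hv, hu]; field_simp; ring
    have huv : u ≤ v := by
      have : (1 - u) / K ≤ 1 - u := div_le_self (by linarith [hr'.2]) hK1.le
      linarith
    have hv1 : v < 1 := by
      have : 0 < (1 - u) / K := div_pos (by linarith [hr'.2]) (by linarith)
      linarith
    have hvm : v ∈ Ico (0 : ℝ) 1 := ⟨hr'.1.trans huv, hv1⟩
    have hsplit : mass W u = (∫⁻ s in Ioc u v, W s) + mass W v := by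
      rw [mass, mass, ← Ioc_union_Ioo_eq_Ioo huv hv1,
        lintegral_union measurableSet_Ioo]
      exact Set.disjoint_left.2 fun x hx hx' => not_lt.2 hx.2 hx'.1
    have h2 := hC' u hr'
    rw [← hv', htail u hr', htail v hvm] at h2
    set I := ∫⁻ s in Ioc u v, W s
    have hIfin : I ≠ ∞ := ne_top_of_le_ne_top (hfin u hr') (by rw [hsplit]; exact le_self_add)
    have hvfin := hfin v hvm
    rw [hsplit] at h2 ⊢
    lift I to ℝ≥0 using hIfin with i
    lift mass W v to ℝ≥0 using hvfin with m
    have hc : 0 ≤ C' / (C' - 1) := div_nonneg (by linarith) (by linarith)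
    rw [ENNReal.ofReal] at h2
    norm_cast at h2 ⊢
    rw [← NNReal.coe_le_coe] at h2 ⊢
    push_cast at h2 ⊢
    rw [Real.coe_toNNReal _ (by linarith)] at h2
    rw [Real.coe_toNNReal _ hc, div_mul_eq_mul_div, le_div_iff₀ (by linarith)]
    nlinarith
  refine ⟨W, C.toNNReal, C.toNNReal * (C' / (C' - 1)).toNNReal, K, ⟨hW, hK1, hfin, hne0, hup, ?_⟩, ?_⟩
  · intro r hr
    refine (hup r hr).trans ?_
    rw [ENNReal.coe_mul, mul_assoc]
    gcongr
    exact hrev r hr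
  · rw [weightMeasure, radialMeasure]
    refine withDensity_congr_ae ?_
    exact ae_vol_of_ae_radius hn hae.ae_eq_mk

end

section

/-! ### Size of hyperbolic balls and non-isotropic regions -/

variable {n : ℕ}

/-- The tail mass on the boundary layer of width `δ`. -/
def tailAt (W : ℝ → ℝ≥0∞) (δ : ℝ) : ℝ≥0∞ := mass W (max 0 (1 - δ))

/-- The size `(1 - |a|)^n ∫_{|a|}^1 W`, comparable to the mass of hyperbolic balls around `a`. -/
def size (W : ℝ → ℝ≥0∞) (a : Cn n) : ℝ≥0∞ := ENNReal.ofReal (1 - ‖a‖) ^ n * mass W ‖a‖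

theorem tailAt_mono (W : ℝ → ℝ≥0∞) {δ ε : ℝ} (h : δ ≤ ε) : tailAt W δ ≤ tailAt W ε :=
  mass_anti W (max_le_max le_rfl (by linarith))

theorem tailAt_one_sub (W : ℝ → ℝ≥0∞) {r : ℝ} (h : 0 ≤ r) : tailAt W (1 - r) = mass W r := by
  rw [tailAt, sub_sub_cancel, max_eq_right h]

variable {W : ℝ → ℝ≥0∞} {A B : ℝ≥0} {K : ℝ}

theorem mem_Ico_norm {a : Cn n} (ha : ‖a‖ < 1) : ‖a‖ ∈ Ico (0 : ℝ) 1 := ⟨norm_nonneg a, ha⟩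

theorem size_ne_zero (hW : IsDoublingProfile W A B K) {a : Cn n} (ha : ‖a‖ < 1) :
    size W a ≠ 0 :=
  mul_ne_zero (pow_ne_zero _ (by simpa using ha)) (hW.ne_zero _ (mem_Ico_norm ha))

theorem size_ne_top (hW : IsDoublingProfile W A B K) {a : Cn n} (ha : ‖a‖ < 1) :
    size W a ≠ ∞ :=
  ENNReal.mul_ne_top (by simp) (hW.ne_top _ (mem_Ico_norm ha))

theorem tailAt_two_mul_le (hW : IsDoublingProfile W A B K) {δ : ℝ} (hδ : 0 < δ) :
    tailAt W (2 * δ) ≤ A * tailAt W δ := by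
  rcases le_or_gt (2 * δ) 1 with h | h
  · have := hW.upper (1 - 2 * δ) ⟨by linarith, by linarith⟩
    rw [tailAt, tailAt, max_eq_right (by linarith), max_eq_right (by linarith)]
    convert this using 3
    ring
  -- The layer of width 2δ is clamped at radius 0; doubling from 0 reaches radius 1/2, which already
  -- exceeds 1-δ.
  · have h0 := hW.upper 0 ⟨le_rfl, one_pos⟩
    rw [tailAt, tailAt, max_eq_left (by linarith)]
    refine h0.trans ?_
    gcongr
    exact mass_anti W (max_le (by norm_num) (by linarith))

theorem tailAt_two_pow_mul_le (hW : IsDoublingProfile W A B K) {δ : ℝ} (hδ : 0 < δ) (j : ℕ) :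
    tailAt W (2 ^ j * δ) ≤ A ^ j * tailAt W δ := by
  induction j with
  | zero => simp
  | succ j ih =>
    rw [pow_succ', mul_assoc, pow_succ', mul_assoc]
    exact (tailAt_two_mul_le hW (by positivity)).trans (by gcongr)

theorem exists_tailAt_mul_le (hW : IsDoublingProfile W A B K) (l : ℝ) :
    ∃ C : ℝ≥0, ∀ δ : ℝ, 0 < δ → tailAt W (l * δ) ≤ C * tailAt W δ := by
  obtain ⟨j, hj⟩ := pow_unbounded_of_one_lt l one_lt_two
  refine ⟨A ^ j, fun δ hδ => ?_⟩
  push_cast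
  exact (tailAt_mono W (by gcongr)).trans (tailAt_two_pow_mul_le hW hδ j)

/-- A point tζ of the tent satisfies 1-t|a| < δ. Hence t > 1-δ, and replacing t|a| by 1 in the inner
product costs at most δ more, so ζ lies in the cap of width 2δ around a/|a|. Slices of measure
O(δ^n) are then integrated against W. -/
theorem radialMeasure_tent_le (hn : 1 ≤ n) (hW : IsDoublingProfile W A B K) :
    ∃ C : ℝ≥0, ∀ a : Cn n, ‖a‖ < 1 → ∀ δ : ℝ, 0 < δ →
      radialMeasure n W (tent a δ) ≤ C * (ENNReal.ofReal δ ^ n * tailAt W δ) := by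
  obtain ⟨C, hC⟩ := sphereMeasure_cap_le hn
  have hS : sphereMeasure n univ ≠ ∞ := measure_ne_top _ _
  have hfin : volConst n * (C * 2 ^ n + sphereMeasure n univ) ≠ ∞ :=
    ENNReal.mul_ne_top volConst_ne_top (ENNReal.add_ne_top.2
      ⟨ENNReal.mul_ne_top (by simp) (by simp), hS⟩)
  refine ⟨(volConst n * (C * 2 ^ n + sphereMeasure n univ)).toNNReal, fun a ha δ hδ => ?_⟩
  rw [ENNReal.coe_toNNReal hfin, ← lintegral_indicator_one (measurableSet_tent _ _),
    lintegral_radialMeasure hn hW.measurable (measurable_one.indicator (measurableSet_tent _ _)),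
    mul_assoc]
  gcongr
  have key : ∀ t ∈ Ioo (0 : ℝ) 1,
      ∫⁻ ζ, (tent a δ).indicator 1 (t • (ζ : Cn n)) ∂sphereMeasure n
        ≤ (Ioo (max 0 (1 - δ)) 1).indicator
          (fun _ => (C * 2 ^ n + sphereMeasure n univ) * ENNReal.ofReal δ ^ n) t := by
    intro t ht
    have hnorm : ∀ ζ : Metric.sphere (0 : Cn n) 1, t • (ζ : Cn n) ∈ tent a δ →
        1 - t * ‖a‖ < δ := fun ζ hζ => by
      have h1 := norm_one_sub_inner_ge a (t • (ζ : Cn n))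
      rw [norm_real_smul_sphere _ ht.1.le] at h1
      linarith [hζ.2]
    by_cases hex : ∃ ζ : Metric.sphere (0 : Cn n) 1, t • (ζ : Cn n) ∈ tent a δ
    · obtain ⟨ζ₀, hζ₀⟩ := hex
      have h1 := hnorm ζ₀ hζ₀
      have htm : t ∈ Ioo (max 0 (1 - δ)) 1 := by
        refine ⟨max_lt ht.1 ?_, ht.2⟩
        nlinarith [norm_nonneg a, ht.1]
      rw [indicator_of_mem htm]
      rcases le_or_gt δ 1 with hδ1 | hδ1
      · have ha0 : 0 < ‖a‖ := by
          by_contra h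
          have : ‖a‖ = 0 := le_antisymm (not_lt.1 h) (norm_nonneg a)
          rw [this] at h1; linarith
        set η : Cn n := ((‖a‖⁻¹ : ℝ) : ℂ) • a with hη
        have hη1 : ‖η‖ = 1 := by
          rw [hη, norm_smul, Complex.norm_real, norm_inv, norm_norm, inv_mul_cancel₀ ha0.ne']
        have haη : ∀ ζ : Cn n, (inner ℂ a ζ : ℂ) = ‖a‖ * inner ℂ η ζ := fun ζ => by
          have : (‖a‖ : ℂ) ≠ 0 := by exact_mod_cast ha0.ne'
          rw [hη, inner_smul_left]
          simp [this]
        calc _ ≤ ∫⁻ ζ, (cap η (2 * δ)).indicator 1 ζ ∂sphereMeasure n := by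
              refine lintegral_mono fun ζ => ?_
              by_cases hζ : t • (ζ : Cn n) ∈ tent a δ
              · rw [indicator_of_mem hζ, indicator_of_mem]
                · simp
                · have h2 := hnorm ζ hζ
                  have h3 := hζ.2
                  have hs : t * ‖a‖ ≤ 1 := by nlinarith [ht.1, ht.2]
                  have := norm_one_sub_le_mul (norm_inner_sphere_le hη1.le ζ) hs
                  rw [inner_real_smul, haη, ← mul_assoc] at h3
                  push_cast at this
                  change ‖1 - inner ℂ η (ζ : Cn n)‖ < 2 * δ
                  linarith
              · simp [indicator_of_notMem hζ]
          _ = sphereMeasure n (cap η (2 * δ)) := lintegral_indicator_one (measurableSet_cap _ _)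
          _ ≤ C * ENNReal.ofReal (2 * δ) ^ n := hC η hη1 _ (by positivity)
          _ = C * 2 ^ n * ENNReal.ofReal δ ^ n := by
              rw [ENNReal.ofReal_mul zero_le_two, ENNReal.ofReal_ofNat, mul_pow, mul_assoc]
          _ ≤ _ := by gcongr; exact le_self_add
      · calc _ ≤ ∫⁻ ζ : Metric.sphere (0 : Cn n) 1, 1 ∂sphereMeasure n := by
              refine lintegral_mono fun ζ => ?_
              by_cases hζ : t • (ζ : Cn n) ∈ tent a δ
              · simp [indicator_of_mem hζ]
              · simp [indicator_of_notMem hζ]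
          _ = sphereMeasure n univ * 1 := by rw [lintegral_one, mul_one]
          _ ≤ _ := by
            gcongr
            · exact le_add_self
            · exact one_le_pow₀ (by simpa using hδ1.le)
    · push Not at hex
      simp [indicator_of_notMem (hex _)]
  calc _ ≤ ∫⁻ t in Ioo (0 : ℝ) 1, (Ioo (max 0 (1 - δ)) 1).indicator
          (fun t => W t * ((C * 2 ^ n + sphereMeasure n univ) * ENNReal.ofReal δ ^ n)) t := by
        refine setLIntegral_mono' measurableSet_Ioo fun t ht => ?_
        have h1 : ENNReal.ofReal (t ^ polarExp n) ≤ 1 :=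
          ENNReal.ofReal_le_one.2 (pow_le_one₀ ht.1.le ht.2.le)
        calc _ ≤ W t * (1 * (Ioo (max 0 (1 - δ)) 1).indicator
              (fun _ => (C * 2 ^ n + sphereMeasure n univ) * ENNReal.ofReal δ ^ n) t) := by
              gcongr
              exact key t ht
          _ = _ := by
            by_cases h : t ∈ Ioo (max 0 (1 - δ)) 1
            · rw [indicator_of_mem h, indicator_of_mem h, one_mul]
            · rw [indicator_of_notMem h, indicator_of_notMem h, mul_zero, mul_zero]
    _ ≤ ∫⁻ t, (Ioo (max 0 (1 - δ)) 1).indicator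
          (fun t => W t * ((C * 2 ^ n + sphereMeasure n univ) * ENNReal.ofReal δ ^ n)) t :=
        setLIntegral_le_lintegral _ _
    _ = _ := by
        rw [lintegral_indicator measurableSet_Ioo, lintegral_mul_const _ hW.measurable, tailAt, mass]
        ring

theorem hypBall_subset_tent {z : Cn n} {r : ℝ} (hz : ‖z‖ < 1) (hr : 0 < r) (hr1 : r < 1) :
    hypBall z r ⊆ tent z (4 / (1 - r ^ 2) * (1 - ‖z‖)) := fun _ hw =>
  ⟨mem_unitBall.1 hw.1, norm_one_sub_inner_le_of_mem_hypBall hz hr hr1 hw⟩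

theorem radialMeasure_hypBall_le (hn : 1 ≤ n) (hW : IsDoublingProfile W A B K) {r : ℝ}
    (hr : 0 < r) (hr1 : r < 1) :
    ∃ C : ℝ≥0, ∀ z : Cn n, ‖z‖ < 1 → radialMeasure n W (hypBall z r) ≤ C * size W z := by
  obtain ⟨C, hC⟩ := radialMeasure_tent_le hn hW
  obtain ⟨C', hC'⟩ := exists_tailAt_mul_le hW (4 / (1 - r ^ 2))
  have hl : 0 < 4 / (1 - r ^ 2) := div_pos (by norm_num) (by nlinarith)
  refine ⟨C * ((4 / (1 - r ^ 2)).toNNReal ^ n * C'), fun z hz => ?_⟩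
  have hd : 0 < 1 - ‖z‖ := sub_pos.2 hz
  refine (measure_mono (hypBall_subset_tent hz hr hr1)).trans ((hC z hz _ (by positivity)).trans ?_)
  rw [ENNReal.ofReal_mul hl.le, mul_pow, size, ← tailAt_one_sub W (norm_nonneg z)]
  calc _ ≤ C * (ENNReal.ofReal (4 / (1 - r ^ 2)) ^ n * ENNReal.ofReal (1 - ‖z‖) ^ n
        * (C' * tailAt W (1 - ‖z‖))) := by
        gcongr
        exact hC' _ hd
    _ = _ := by rw [ENNReal.ofReal]; push_cast; ring

theorem exists_mass_le_of_mem_hypBall (hW : IsDoublingProfile W A B K) {r : ℝ}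
    (hr : 0 < r) (hr1 : r < 1) :
    ∃ C : ℝ≥0, ∀ z w : Cn n, ‖z‖ < 1 → w ∈ hypBall z r → mass W ‖w‖ ≤ C * mass W ‖z‖ := by
  obtain ⟨C', hC'⟩ := exists_tailAt_mul_le hW (4 / (1 - r ^ 2))
  refine ⟨C', fun z w hz hw => ?_⟩
  rw [← tailAt_one_sub W (norm_nonneg w), ← tailAt_one_sub W (norm_nonneg z)]
  exact (tailAt_mono W (one_sub_norm_le_of_mem_hypBall hz hr hr1 hw).le).trans
    (hC' _ (sub_pos.2 hz))

/-- The threshold radius: from here on, hyperbolic balls carry their full share of mass. -/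
def threshold (K : ℝ) : ℝ := 1 - 1 / (36 * K)

theorem threshold_mem (hK : 1 < K) : threshold K ∈ Ioo (0 : ℝ) 1 := by
  have h1 : 0 < 1 / (36 * K) := by positivity
  have h2 : 1 / (36 * K) < 1 := by rw [div_lt_one (by positivity)]; linarith
  exact ⟨by rw [threshold]; linarith, by rw [threshold]; linarith⟩

theorem exists_unit_vector (hn : 1 ≤ n) (a : Cn n) : ∃ η : Cn n, ‖η‖ = 1 ∧ a = (‖a‖ : ℂ) • η := by
  rcases eq_or_ne a 0 with rfl | ha
  · exact ⟨EuclideanSpace.single ⟨0, hn⟩ 1, by simp, by simp⟩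
  · have ha0 : ‖a‖ ≠ 0 := norm_ne_zero_iff.2 ha
    have : (‖a‖ : ℂ) ≠ 0 := by exact_mod_cast ha0
    refine ⟨((‖a‖⁻¹ : ℝ) : ℂ) • a, ?_, ?_⟩
    · rw [norm_smul, Complex.norm_real, norm_inv, norm_norm, inv_mul_cancel₀ ha0]
    · rw [smul_smul]; push_cast; rw [mul_inv_cancel₀ this, one_smul]

/-- The ball D(z,r₀) contains the shell that carries a fixed share of the tail, over a cap of width
1-|z| and thus of surface measure ≳ (1-|z|)^n. -/
theorem size_le_radialMeasure_hypBall (hn : 1 ≤ n) (hW : IsDoublingProfile W A B K) :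
    ∃ C : ℝ≥0, ∀ z : Cn n, ‖z‖ < 1 →
      size W z ≤ C * radialMeasure n W (hypBall z (threshold K)) := by
  obtain ⟨c, hc0, hc⟩ := le_sphereMeasure_cap hn
  have hK := hW.one_lt
  obtain ⟨hr0, hr1⟩ := threshold_mem hK
  set r := threshold K with hr
  set k := polarExp n
  set c₁ : ℝ≥0∞ := volConst n * ((2⁻¹) ^ k * c) with hc₁
  have hc₁0 : c₁ ≠ 0 := mul_ne_zero volConst_ne_zero
    (mul_ne_zero (by simp) (by exact_mod_cast hc0.ne'))
  have hc₁t : c₁ ≠ ∞ := ENNReal.mul_ne_top volConst_ne_top (ENNReal.mul_ne_top (by simp) (by simp))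
  refine ⟨B * c₁⁻¹.toNNReal, fun a ha => ?_⟩
  set I := Ioc ((‖a‖ + 1) / 2) (1 - (1 - ‖a‖) / (2 * K)) with hI
  have hd : 0 < 1 - ‖a‖ := sub_pos.2 ha
  have hdK : 0 < (1 - ‖a‖) / (2 * K) := by positivity
  obtain ⟨η, hη, haη⟩ := exists_unit_vector hn a
  have hin : ∀ t : ℝ, ∀ ζ : Cn n, (inner ℂ a (t • ζ) : ℂ) = ((t * ‖a‖ : ℝ) : ℂ) * inner ℂ η ζ := by
    intro t ζ
    rw [inner_real_smul]
    nth_rewrite 1 [haη]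
    rw [inner_smul_left]
    simp [mul_assoc]
  have hmem : ∀ t ∈ I, ∀ ζ ∈ cap η (1 - ‖a‖), t • (ζ : Cn n) ∈ hypBall a r := by
    intro t ht ζ hζ
    have ht0 : 0 < t := by linarith [ht.1, norm_nonneg a]
    have ht1 : t < 1 := by linarith [ht.2]
    rw [mem_hypBall_iff ha hr0, norm_real_smul_sphere _ ht0.le, hin]
    refine ⟨ht1, ?_⟩
    have hs : t * ‖a‖ ≤ 1 := by nlinarith [norm_nonneg a]
    have h1 := norm_one_sub_mul_le (norm_inner_sphere_le hη.le ζ) hs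
    have h2 : ‖1 - inner ℂ η (ζ : Cn n)‖ < 1 - ‖a‖ := hζ
    have h3 : 1 - t * ‖a‖ ≤ 2 * (1 - ‖a‖) := by nlinarith [ht.1, norm_nonneg a]
    have h4 : ‖1 - ((t * ‖a‖ : ℝ) : ℂ) * inner ℂ η (ζ : Cn n)‖ ≤ 3 * (1 - ‖a‖) := by linarith
    have h5 : ‖1 - ((t * ‖a‖ : ℝ) : ℂ) * inner ℂ η (ζ : Cn n)‖ ^ 2 ≤ (3 * (1 - ‖a‖)) ^ 2 := by
      gcongr
    -- Origin of the 36: |1-⟨a,tζ⟩|² ≤ 9(1-|a|)², while 1-t² ≥ (1-|a|)/(2K) on the shell, so 1-r² <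
    -- 1/(18K) is just what is needed.
    have h6 : 1 - r ^ 2 < 1 / (18 * K) := by
      have : 1 - r = 1 / (36 * K) := by rw [hr, threshold]; ring
      have h7 : 1 / (18 * K) = 2 * (1 / (36 * K)) := by field_simp; norm_num
      rw [h7, ← this]
      nlinarith
    have h7 : (1 - ‖a‖) / (2 * K) ≤ 1 - t ^ 2 := by nlinarith [ht.2]
    have h8 : 1 - ‖a‖ ≤ 1 - ‖a‖ ^ 2 := by nlinarith [norm_nonneg a]
    have h9 : 0 ≤ 1 - ‖a‖ ^ 2 := hd.le.trans h8
    calc (1 - r ^ 2) * ‖1 - ((t * ‖a‖ : ℝ) : ℂ) * inner ℂ η (ζ : Cn n)‖ ^ 2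
        ≤ (1 - r ^ 2) * (3 * (1 - ‖a‖)) ^ 2 := by
          gcongr
          nlinarith
      _ < 1 / (18 * K) * (3 * (1 - ‖a‖)) ^ 2 := by gcongr
      _ = (1 - ‖a‖) * ((1 - ‖a‖) / (2 * K)) := by field_simp; norm_num
      _ ≤ (1 - ‖a‖ ^ 2) * (1 - t ^ 2) := by gcongr
  have hlow : c₁ * (ENNReal.ofReal (1 - ‖a‖) ^ n * ∫⁻ t in I, W t)
      ≤ radialMeasure n W (hypBall a r) := by
    have hm := measurableSet_hypBall (n := n) ha hr0
    rw [← lintegral_indicator_one hm,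
      lintegral_radialMeasure hn hW.measurable (measurable_one.indicator hm), hc₁, mul_assoc]
    gcongr
    calc _ = ∫⁻ t in I, W t * ((2⁻¹) ^ k * (c * ENNReal.ofReal (1 - ‖a‖) ^ n)) := by
          rw [lintegral_mul_const _ hW.measurable]; ring
      _ ≤ ∫⁻ t in I, W t * (ENNReal.ofReal (t ^ k) *
          ∫⁻ ζ, (hypBall a r).indicator 1 (t • (ζ : Cn n)) ∂sphereMeasure n) := by
          refine setLIntegral_mono' measurableSet_Ioc fun t ht => ?_
          have ht2 : 1 / 2 ≤ t := by linarith [ht.1, norm_nonneg a]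
          have e2 : (2⁻¹ : ℝ≥0∞) ^ k = ENNReal.ofReal ((1 / 2) ^ k) := by
            rw [ENNReal.ofReal_pow (by norm_num), one_div, ENNReal.ofReal_inv_of_pos two_pos,
              ENNReal.ofReal_ofNat]
          rw [e2]
          gcongr
          refine (hc η hη _ hd (by linarith [norm_nonneg a])).trans ?_
          rw [← lintegral_indicator_one (measurableSet_cap _ _)]
          refine lintegral_mono fun ζ => ?_
          by_cases hζ : ζ ∈ cap η (1 - ‖a‖)
          · rw [indicator_of_mem hζ, indicator_of_mem (hmem t ht ζ hζ)]; simp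
          · simp [indicator_of_notMem hζ]
      _ ≤ _ := lintegral_mono_set (show I ⊆ Ioo (0 : ℝ) 1 from fun t ht =>
          ⟨by linarith [ht.1, norm_nonneg a], by linarith [ht.2]⟩)
  calc size W a ≤ ENNReal.ofReal (1 - ‖a‖) ^ n * (B * ∫⁻ t in I, W t) := by
        rw [size]
        gcongr
        exact hW.reverse _ (mem_Ico_norm ha)
    _ = B * (c₁⁻¹ * (c₁ * (ENNReal.ofReal (1 - ‖a‖) ^ n * ∫⁻ t in I, W t))) := by
        rw [← mul_assoc c₁⁻¹, ENNReal.inv_mul_cancel hc₁0 hc₁t]; ring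
    _ ≤ B * (c₁⁻¹ * radialMeasure n W (hypBall a r)) := by gcongr
    _ = _ := by
        rw [ENNReal.coe_mul, ENNReal.coe_toNNReal (ENNReal.inv_ne_top.2 hc₁0), mul_assoc]

end

section

/-! ### Integrals of powers of the kernel `(1 - |a|) / |1 - ⟨z, a⟩|` -/

variable {n : ℕ} {W : ℝ → ℝ≥0∞} {A B : ℝ≥0} {K : ℝ}

/-- The normalized kernel `(1 - |a|) / |1 - ⟨z, a⟩|`. -/
def kernelRatio (a z : Cn n) : ℝ := (1 - ‖a‖) / ‖1 - inner ℂ a z‖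

theorem kernelRatio_nonneg {a : Cn n} (ha : ‖a‖ < 1) (z : Cn n) : 0 ≤ kernelRatio a z :=
  div_nonneg (sub_pos.2 ha).le (norm_nonneg _)

/-- One term is enough: for the least j with z in the tent of width 2^j(1-|a|), minimality gives a
ratio of at most 2·2^{-j}. -/
theorem kernelRatio_rpow_le_tsum {a z : Cn n} (ha : ‖a‖ < 1) (hz : ‖z‖ < 1) {m : ℝ} (hm : 0 ≤ m) :
    ENNReal.ofReal (kernelRatio a z ^ m) ≤ ∑' j : ℕ, 2 ^ m * (2 ^ (-m)) ^ j *
      (tent a (2 ^ j * (1 - ‖a‖))).indicator 1 z := by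
  have hd : 0 < 1 - ‖a‖ := sub_pos.2 ha
  set x := ‖1 - inner ℂ a z‖ with hx
  have hx0 : 0 < x := norm_one_sub_inner_pos ha hz.le
  have hex : ∃ j : ℕ, x < 2 ^ j * (1 - ‖a‖) := by
    obtain ⟨j, hj⟩ := pow_unbounded_of_one_lt (x / (1 - ‖a‖)) one_lt_two
    exact ⟨j, (div_lt_iff₀ hd).1 hj⟩
  classical
  set j := Nat.find hex with hj
  have hj1 : x < 2 ^ j * (1 - ‖a‖) := Nat.find_spec hex
  have hj2 : 2 ^ j * (1 - ‖a‖) ≤ 2 * x := by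
    rcases Nat.eq_zero_or_pos j with h0 | h0
    · rw [h0]
      have := one_sub_norm_le_norm_one_sub_inner (z := a) hz.le
      rw [← hx] at this
      linarith
    · have h1 : 2 ^ (j - 1) * (1 - ‖a‖) ≤ x := not_lt.1 (Nat.find_min hex (Nat.sub_lt h0 one_pos))
      obtain ⟨i, hi⟩ := Nat.exists_eq_add_of_le' h0
      rw [hi] at h1 ⊢
      rw [Nat.add_sub_cancel] at h1
      rw [pow_succ]
      linarith
  refine le_trans ?_ (ENNReal.le_tsum j)
  have hmem : z ∈ tent a (2 ^ j * (1 - ‖a‖)) := ⟨hz, hj1⟩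
  rw [indicator_of_mem hmem, Pi.one_apply, mul_one]
  have h1 : kernelRatio a z ≤ 2 * (1 / 2) ^ j := by
    rw [kernelRatio, ← hx, div_le_iff₀ hx0, one_div, inv_pow, mul_assoc, mul_comm (_⁻¹),
      ← mul_assoc, ← div_eq_mul_inv, le_div_iff₀ (by positivity)]
    linarith
  calc ENNReal.ofReal (kernelRatio a z ^ m) ≤ ENNReal.ofReal ((2 * (1 / 2) ^ j) ^ m) := by
        gcongr
        exact kernelRatio_nonneg ha z
    _ = 2 ^ m * (2 ^ (-m)) ^ j := by
        rw [← ENNReal.ofReal_rpow_of_nonneg (by positivity) hm, ENNReal.ofReal_mul zero_le_two,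
          ENNReal.mul_rpow_of_nonneg _ _ hm, ENNReal.ofReal_ofNat, ENNReal.ofReal_pow (by norm_num),
          one_div, ENNReal.ofReal_inv_of_pos two_pos, ENNReal.ofReal_ofNat, ENNReal.rpow_neg,
          ← ENNReal.inv_rpow, ← ENNReal.rpow_natCast, ← ENNReal.rpow_mul, mul_comm (j : ℝ),
          ENNReal.rpow_mul, ENNReal.rpow_natCast]

theorem lintegral_kernelRatio_le (hn : 1 ≤ n) (hW : IsDoublingProfile W A B K) :
    ∃ m₀ : ℝ, 0 ≤ m₀ ∧ ∀ m : ℝ, m₀ ≤ m → ∃ C : ℝ≥0, ∀ a : Cn n, ‖a‖ < 1 →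
      ∫⁻ z, ENNReal.ofReal (kernelRatio a z ^ m) ∂radialMeasure n W ≤ C * size W a := by
  obtain ⟨C, hC⟩ := radialMeasure_tent_le hn hW
  -- The tent of width 2^j(1-|a|) has mass O((2^n A)^j S(a)), so from this exponent on the dyadic
  -- series has ratio at most 1/2.
  obtain ⟨N, hN⟩ := pow_unbounded_of_one_lt (2 * 2 ^ n * (A : ℝ)) one_lt_two
  refine ⟨N, by positivity, fun m hm => ?_⟩
  have hm0 : 0 ≤ m := le_trans (by positivity) hm
  have hx : (2 : ℝ≥0∞) ^ (-m) * (2 ^ n * A) ≤ 2⁻¹ := by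
    have h1 : (2 : ℝ≥0∞) * (2 ^ n * A) ≤ 2 ^ m := by
      calc (2 : ℝ≥0∞) * (2 ^ n * A) ≤ 2 ^ N := by
            have : (2 : ℝ≥0) * (2 ^ n * A) ≤ 2 ^ N := by
              rw [← NNReal.coe_le_coe]; push_cast; linarith
            exact_mod_cast this
        _ = 2 ^ (N : ℝ) := (ENNReal.rpow_natCast _ _).symm
        _ ≤ 2 ^ m := ENNReal.rpow_le_rpow_of_exponent_le (by norm_num) hm
    have h2 : (2 : ℝ≥0∞) ^ m ≠ 0 := by simp
    have h3 : (2 : ℝ≥0∞) ^ m ≠ ∞ := by simp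
    rw [ENNReal.rpow_neg, ← ENNReal.div_eq_inv_mul, ENNReal.div_le_iff h2 h3]
    calc (2 : ℝ≥0∞) ^ n * A = 2⁻¹ * (2 * (2 ^ n * A)) := by
          rw [← mul_assoc, ENNReal.inv_mul_cancel (by simp) (by simp), one_mul]
      _ ≤ _ := by gcongr
  refine ⟨((2 : ℝ≥0∞) ^ m).toNNReal * (C * 2), fun a ha => ?_⟩
  have hd : 0 < 1 - ‖a‖ := sub_pos.2 ha
  have hae : ∀ᵐ z ∂radialMeasure n W, ‖z‖ < 1 := by
    refine (withDensity_absolutelyContinuous _ _).ae_le ?_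
    rw [vol_eq]
    exact Measure.ae_smul_measure (by
      filter_upwards [ae_restrict_mem isOpen_unitBall.measurableSet] with z hz
      exact mem_unitBall.1 hz) _
  calc _ ≤ ∫⁻ z, ∑' j : ℕ, 2 ^ m * (2 ^ (-m)) ^ j *
        (tent a (2 ^ j * (1 - ‖a‖))).indicator 1 z ∂radialMeasure n W := by
        refine lintegral_mono_ae ?_
        filter_upwards [hae] with z hz
        exact kernelRatio_rpow_le_tsum ha hz hm0
    _ = ∑' j : ℕ, 2 ^ m * (2 ^ (-m)) ^ j * radialMeasure n W (tent a (2 ^ j * (1 - ‖a‖))) := by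
        rw [lintegral_tsum fun j =>
          ((measurable_one.indicator (measurableSet_tent _ _)).const_mul _).aemeasurable]
        refine tsum_congr fun j => ?_
        rw [lintegral_const_mul _ (measurable_one.indicator (measurableSet_tent _ _)),
          lintegral_indicator_one (measurableSet_tent _ _)]
    _ ≤ ∑' j : ℕ, (2 ^ m * C * size W a) * 2⁻¹ ^ j := by
        refine ENNReal.tsum_le_tsum fun j => ?_
        calc _ ≤ 2 ^ m * (2 ^ (-m)) ^ j * (C * ((2 ^ j) ^ n * ENNReal.ofReal (1 - ‖a‖) ^ n
              * (A ^ j * mass W ‖a‖))) := by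
              gcongr
              refine (hC a ha _ (by positivity)).trans ?_
              have h1 := tailAt_two_pow_mul_le hW hd j
              rw [tailAt_one_sub W (norm_nonneg a)] at h1
              rw [ENNReal.ofReal_mul (by positivity), mul_pow, ENNReal.ofReal_pow zero_le_two,
                ENNReal.ofReal_ofNat]
              gcongr
          _ = (2 ^ m * C * size W a) * (2 ^ (-m) * (2 ^ n * A)) ^ j := by
              rw [size, mul_pow, mul_pow, ← pow_mul, ← pow_mul, mul_comm n j]; ring
          _ ≤ _ := by gcongr
    _ = _ := by
        have h3 : (2 : ℝ≥0∞) ^ m ≠ ∞ := by simp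
        rw [ENNReal.tsum_mul_left, ENNReal.tsum_geometric, ENNReal.one_sub_inv_two, inv_inv]
        push_cast
        rw [ENNReal.coe_toNNReal h3]
        ring

end

section

/-! ### Sub-mean value property in several variables -/

variable {n : ℕ}

theorem lintegral_comp_complexLinear {L : Cn n →ₗ[ℂ] Cn n} (hL : LinearMap.det L ≠ 0)
    {F : Cn n → ℝ≥0∞} (hF : Measurable F) :
    ENNReal.ofReal (‖LinearMap.det L‖ ^ 2) * ∫⁻ x, F (L x) ∂haar n = ∫⁻ x, F x ∂haar n := by
  have hd : LinearMap.det (L.restrictScalars ℝ) ≠ 0 := by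
    rw [det_real_restrictScalars]
    exact pow_ne_zero _ (norm_ne_zero_iff.2 hL)
  have hpos : 0 < ‖LinearMap.det L‖ ^ 2 := by have := norm_pos_iff.2 hL; positivity
  have h := Measure.map_linearMap_addHaar_eq_smul_addHaar (haar n) hd
  have hc : Continuous (L.restrictScalars ℝ) := LinearMap.continuous_of_finiteDimensional _
  have h2 : ∫⁻ x, F (L x) ∂haar n = ∫⁻ x, F x ∂((haar n).map (L.restrictScalars ℝ)) :=
    (lintegral_map hF hc.measurable).symm
  rw [h2, h, lintegral_smul_measure, smul_eq_mul, ← mul_assoc, ← ENNReal.ofReal_mul hpos.le,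
    det_real_restrictScalars, abs_of_nonneg (inv_nonneg.2 hpos.le), mul_inv_cancel₀ hpos.ne',
    ENNReal.ofReal_one, one_mul]

theorem lintegral_comp_rotation {c : ℂ} (hc : ‖c‖ = 1) {F : Cn n → ℝ≥0∞} (hF : Measurable F) :
    ∫⁻ x, F (c • x) ∂haar n = ∫⁻ x, F x ∂haar n := by
  have hd : LinearMap.det (c • (LinearMap.id : Cn n →ₗ[ℂ] Cn n)) = c ^ n := by
    rw [LinearMap.det_smul, LinearMap.det_id, mul_one, finrank_euclideanSpace_fin]
  have hc0 : c ≠ 0 := norm_ne_zero_iff.1 (by rw [hc]; exact one_ne_zero)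
  have h := lintegral_comp_complexLinear (L := c • (LinearMap.id : Cn n →ₗ[ℂ] Cn n))
    (by rw [hd]; exact pow_ne_zero _ hc0) hF
  rw [hd, norm_pow, hc] at h
  simpa using h

/-- The invariance is inherited from Lebesgue measure: F is extended radially to the shell 1 < |w| <
2, where polar coordinates contribute a finite nonzero factor κ that cancels. -/
theorem lintegral_sphere_rotation (hn : 1 ≤ n) {c : ℂ} (hc : ‖c‖ = 1) {F : Cn n → ℝ≥0∞}
    (hF : Measurable F) :
    ∫⁻ ζ, F (c • (ζ : Cn n)) ∂sphereMeasure n = ∫⁻ ζ, F (ζ : Cn n) ∂sphereMeasure n := by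
  set S : Set (Cn n) := {w | ‖w‖ ∈ Ioo (1 : ℝ) 2} with hS
  have hSm : MeasurableSet S := measurable_norm measurableSet_Ioo
  set κ : ℝ≥0∞ := ∫⁻ t in Ioi (0 : ℝ), ENNReal.ofReal (t ^ polarExp n) * (Ioo (1 : ℝ) 2).indicator 1 t
    with hκ
  have key : ∀ G : Cn n → ℝ≥0∞, Measurable G →
      ∫⁻ w, S.indicator (fun w => G ((‖w‖⁻¹ : ℝ) • w)) w ∂haar n
        = κ * ∫⁻ ζ, G (ζ : Cn n) ∂sphereMeasure n := by
    intro G hG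
    have hm : Measurable fun w : Cn n => G ((‖w‖⁻¹ : ℝ) • w) :=
      hG.comp (measurable_norm.inv.smul measurable_id)
    rw [lintegral_polar hn (hm.indicator hSm), hκ, ← lintegral_mul_const]
    · refine setLIntegral_congr_fun measurableSet_Ioi fun t ht => ?_
      have ht0 : 0 < t := ht
      rw [mul_assoc]
      congr 1
      have hiff : ∀ ζ : Metric.sphere (0 : Cn n) 1, t • (ζ : Cn n) ∈ S ↔ t ∈ Ioo (1 : ℝ) 2 := by
        intro ζ
        change ‖t • (ζ : Cn n)‖ ∈ Ioo (1 : ℝ) 2 ↔ _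
        rw [norm_real_smul_sphere _ ht0.le]
      by_cases h : t ∈ Ioo (1 : ℝ) 2
      · rw [indicator_of_mem h, Pi.one_apply, one_mul]
        refine lintegral_congr fun ζ => ?_
        rw [indicator_of_mem ((hiff ζ).2 h), norm_real_smul_sphere _ ht0.le, smul_smul,
          inv_mul_cancel₀ ht0.ne', one_smul]
      · rw [indicator_of_notMem h, zero_mul]
        have : ∀ ζ : Metric.sphere (0 : Cn n) 1, t • (ζ : Cn n) ∉ S := fun ζ =>
          fun hζ => h ((hiff ζ).1 hζ)
        simp [indicator_of_notMem (this _)]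
    · exact (by fun_prop : Measurable fun t : ℝ => ENNReal.ofReal (t ^ polarExp n)).mul
        (measurable_one.indicator measurableSet_Ioo)
  have hκ0 : κ ≠ 0 := by
    have : ∫⁻ t in Ioo (1 : ℝ) 2, 1 ≤ κ := by
      rw [hκ]
      calc _ ≤ ∫⁻ t in Ioo (1 : ℝ) 2, ENNReal.ofReal (t ^ polarExp n) * (Ioo (1 : ℝ) 2).indicator 1 t := by
            refine setLIntegral_mono' measurableSet_Ioo fun t ht => ?_
            rw [indicator_of_mem ht, Pi.one_apply, mul_one]
            exact ENNReal.one_le_ofReal.2 (one_le_pow₀ ht.1.le)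
        _ ≤ _ := lintegral_mono_set (show Ioo (1 : ℝ) 2 ⊆ Ioi 0 from fun t ht => by
            have := ht.1; simp only [mem_Ioi]; linarith)
    intro h0
    rw [h0] at this
    norm_num at this
  have hκt : κ ≠ ∞ := by
    have : κ ≤ ∫⁻ t in Ioo (1 : ℝ) 2, ENNReal.ofReal (2 ^ polarExp n) := by
      rw [hκ, ← lintegral_indicator measurableSet_Ioo]
      refine (setLIntegral_le_lintegral _ _).trans (lintegral_mono fun t => ?_)
      by_cases h : t ∈ Ioo (1 : ℝ) 2
      · rw [indicator_of_mem h, indicator_of_mem h, Pi.one_apply, mul_one]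
        have := h.1; have := h.2
        gcongr
      · simp [indicator_of_notMem h]
    refine ne_top_of_le_ne_top ?_ this
    rw [setLIntegral_const]
    exact ENNReal.mul_ne_top (by simp) (by simp)
  have hcF : Measurable fun w : Cn n => F (c • w) := hF.comp (measurable_const_smul c)
  have h1 := key F hF
  have h2 := key _ hcF
  have hmF : Measurable (S.indicator (fun w : Cn n => F ((‖w‖⁻¹ : ℝ) • w))) :=
    (hF.comp (measurable_norm.inv.smul measurable_id)).indicator hSm
  have h3 := lintegral_comp_rotation hc hmF
  have h4 : ∀ w : Cn n, S.indicator (fun w : Cn n => F ((‖w‖⁻¹ : ℝ) • w)) (c • w)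
      = S.indicator (fun w => F (c • (‖w‖⁻¹ : ℝ) • w)) w := by
    intro w
    have hn : ‖c • w‖ = ‖w‖ := by rw [norm_smul, hc, one_mul]
    have hmem : c • w ∈ S ↔ w ∈ S := by
      change ‖c • w‖ ∈ Ioo (1 : ℝ) 2 ↔ ‖w‖ ∈ Ioo (1 : ℝ) 2
      rw [hn]
    by_cases h : w ∈ S
    · rw [indicator_of_mem h, indicator_of_mem (hmem.2 h), hn, smul_comm]
    · rw [indicator_of_notMem h, indicator_of_notMem (fun h' => h (hmem.1 h'))]
  simp_rw [h4] at h3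
  rw [h1, h2] at h3
  exact (ENNReal.mul_right_inj hκ0 hκt).1 h3

theorem measurable_indicator_of_differentiableOn {f : Cn n → ℂ} {U : Set (Cn n)} (hU : IsOpen U)
    (hf : DifferentiableOn ℂ f U) : Measurable (U.indicator f) := by
  classical
  rw [← piecewise_eq_indicator]
  exact measurable_of_restrict_of_restrict_compl hU.measurableSet
    (by
      rw [domRestrict_piecewise]
      exact (continuousOn_iff_continuous_domRestrict.1 hf.continuousOn).measurable)
    (by
      rw [domRestrict_piecewise_compl]
      exact measurable_const)

theorem analyticOnNhd_slice {f : Cn n → ℂ} {U : Set (Cn n)} (hU : IsOpen U)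
    (hf : DifferentiableOn ℂ f U) (x y : Cn n) {S : Set ℂ} (hS : ∀ l ∈ S, y + l • x ∈ U) :
    AnalyticOnNhd ℂ (fun l : ℂ => f (y + l • x)) S := by
  have hc : Continuous fun l : ℂ => y + l • x := by fun_prop
  have hd : DifferentiableOn ℂ (fun l : ℂ => f (y + l • x)) ((fun l : ℂ => y + l • x) ⁻¹' U) :=
    hf.comp (by fun_prop) (mapsTo_preimage _ _)
  exact (hd.analyticOnNhd (hU.preimage hc)).mono hS

/-- The one-variable inequality is applied to l ↦ f(lx) on the unit circle and integrated over x;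
after Tonelli, each rotation x ↦ e^{iθ}x preserves the integral. -/
theorem rpow_enorm_zero_mul_haar_le {f : Cn n → ℂ} (hf : DifferentiableOn ℂ f (unitBall n)) {p : ℝ}
    (hp : 0 < p) :
    ‖f 0‖ₑ ^ p * haar n (unitBall n) ≤ ∫⁻ x in unitBall n, ‖f x‖ₑ ^ p ∂haar n := by
  set G : Cn n → ℝ≥0∞ := (unitBall n).indicator (fun x => ‖f x‖ₑ ^ p) with hG
  have hGeq : G = fun x => ‖(unitBall n).indicator f x‖ₑ ^ p := by
    ext x
    by_cases hx : x ∈ unitBall n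
    · simp [hG, indicator_of_mem hx]
    · simp [hG, indicator_of_notMem hx, hp]
  have hGm : Measurable G := by
    rw [hGeq]
    exact ((measurable_indicator_of_differentiableOn isOpen_unitBall hf).enorm).pow_const p
  rw [← lintegral_indicator isOpen_unitBall.measurableSet]
  have hpi : ENNReal.ofReal (2 * Real.pi) ≠ 0 := by
    simpa using Real.pi_pos
  have h0 : (0 : Cn n) ∈ unitBall n := by simp [mem_unitBall]
  have hcm : ∀ θ : ℝ, ‖circleMap 0 1 θ‖ = 1 := fun θ => by simp
  have hmem : ∀ (x : Cn n) (θ : ℝ), circleMap 0 1 θ • x ∈ unitBall n ↔ x ∈ unitBall n := by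
    intro x θ
    rw [mem_unitBall, mem_unitBall, norm_smul, hcm, one_mul]
  have hslice : ∀ x ∈ unitBall n, ENNReal.ofReal (2 * Real.pi) * ‖f 0‖ₑ ^ p ≤
      ∫⁻ θ in Ioc 0 (2 * Real.pi), G (circleMap 0 1 θ • x) := by
    intro x hx
    have han := analyticOnNhd_slice isOpen_unitBall hf x 0 (S := Metric.closedBall (0 : ℂ) 1)
      (fun l hl => by
        rw [zero_add, mem_unitBall, norm_smul]
        have h1 : ‖l‖ ≤ 1 := by simpa using hl
        have := mem_unitBall.1 hx
        nlinarith [norm_nonneg x])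
    have := two_pi_mul_rpow_enorm_le (c := 0) one_pos hp han
    simp only [zero_add, zero_smul] at this
    refine this.trans_eq (lintegral_congr fun θ => ?_)
    rw [hG, indicator_of_mem ((hmem x θ).2 hx)]
  have hjoint : Measurable fun q : Cn n × ℝ => G (circleMap 0 1 q.2 • q.1) :=
    hGm.comp (Continuous.measurable (by fun_prop))
  refine (ENNReal.mul_le_mul_iff_right hpi ENNReal.ofReal_ne_top).1 ?_
  calc ENNReal.ofReal (2 * Real.pi) * (‖f 0‖ₑ ^ p * haar n (unitBall n))
      = ∫⁻ x in unitBall n, ENNReal.ofReal (2 * Real.pi) * ‖f 0‖ₑ ^ p ∂haar n := by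
        rw [setLIntegral_const, mul_assoc]
    _ ≤ ∫⁻ x in unitBall n, (∫⁻ θ in Ioc 0 (2 * Real.pi), G (circleMap 0 1 θ • x)) ∂haar n :=
        setLIntegral_mono' isOpen_unitBall.measurableSet hslice
    _ ≤ ∫⁻ x, (∫⁻ θ in Ioc 0 (2 * Real.pi), G (circleMap 0 1 θ • x)) ∂haar n :=
        setLIntegral_le_lintegral _ _
    _ = ∫⁻ θ in Ioc 0 (2 * Real.pi), ∫⁻ x, G (circleMap 0 1 θ • x) ∂haar n :=
        lintegral_lintegral_swap hjoint.aemeasurable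
    _ = ∫⁻ θ in Ioc 0 (2 * Real.pi), ∫⁻ x, G x ∂haar n :=
        lintegral_congr fun θ => lintegral_comp_rotation (hcm θ) hGm
    _ = _ := by
        rw [setLIntegral_const, Real.volume_Ioc, sub_zero, mul_comm]

/-- With c = r²/16, points w of the ellipsoid satisfy 1-|w|² ≥ (1-4c)(1-|z|²) and |1-⟨z,w⟩| ≤
(1+c)(1-|z|²). As 1-r² = 1-16c, the claim follows from (1-16c)(1+c)² < 1-4c. -/
theorem stretch_ball_subset_hypBall {z η : Cn n} (hz : ‖z‖ < 1) (hη : ‖η‖ = 1)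
    (hzη : z = (‖z‖ : ℂ) • η) {r : ℝ} (hr : 0 < r) (hr1 : r < 1) {x : Cn n} (hx : ‖x‖ < 1) :
    z + stretch η (r ^ 2 / 16 * (1 - ‖z‖)) (Real.sqrt (r ^ 2 / 16 * (1 - ‖z‖))) x
      ∈ hypBall z r := by
  have hd : 0 < 1 - ‖z‖ := sub_pos.2 hz
  set c := r ^ 2 / 16 with hc
  have hc0 : 0 < c := by positivity
  have hc1 : c < 1 / 16 := by rw [hc]; nlinarith
  set ε := c * (1 - ‖z‖) with hε
  have hε0 : 0 < ε := by positivity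
  obtain ⟨h1, h2⟩ := stretch_ball_bounds hη hε0 (Real.sqrt_pos.2 hε0) hx
  set y := stretch η ε (Real.sqrt ε) x
  set u : ℂ := inner ℂ η y with hu
  have hz0 := norm_nonneg z
  have hin : (inner ℂ η (z + y) : ℂ) = (‖z‖ : ℂ) + u := by
    rw [inner_add_right, ← hu]
    congr 1
    nth_rewrite 1 [hzη]
    rw [inner_smul_right, inner_self_of_norm_one hη, mul_one]
  have hz2 : (inner ℂ z (z + y) : ℂ) = ‖z‖ * ((‖z‖ : ℂ) + u) := by
    rw [← hin]
    nth_rewrite 1 [hzη]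
    rw [inner_smul_left, Complex.conj_ofReal]
  have hw : ‖z + y‖ ^ 2 ≤ ‖z‖ ^ 2 + 4 * c * (1 - ‖z‖ ^ 2) := by
    have h3 := norm_sq_eq_add_of_norm_one hη (z + y)
    have e : z + y - (inner ℂ η (z + y) : ℂ) • η = y - u • η := by
      rw [hin, add_smul, ← hzη]; abel
    rw [e, hin] at h3
    have h4 : ‖(‖z‖ : ℂ) + u‖ ≤ ‖z‖ + ε := by
      refine (norm_add_le _ _).trans ?_
      rw [Complex.norm_real, norm_norm]
      linarith
    have h5 : ‖y - u • η‖ ^ 2 < ε := by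
      have := pow_lt_pow_left₀ h2 (norm_nonneg _) two_ne_zero
      rwa [Real.sq_sqrt hε0.le] at this
    have h6 : ‖(‖z‖ : ℂ) + u‖ ^ 2 ≤ (‖z‖ + ε) ^ 2 := by gcongr
    have h7 : ε ≤ 1 := by rw [hε]; nlinarith
    have h8 : 1 - ‖z‖ ≤ 1 - ‖z‖ ^ 2 := by nlinarith
    have h9 : ε ≤ c * (1 - ‖z‖ ^ 2) := by rw [hε]; gcongr
    nlinarith
  have hq : 0 < 1 - ‖z‖ ^ 2 := by nlinarith
  have h1z : ‖1 - (inner ℂ z (z + y) : ℂ)‖ ≤ (1 - ‖z‖ ^ 2) * (1 + c) := by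
    have e : 1 - (inner ℂ z (z + y) : ℂ) = ((1 - ‖z‖ ^ 2 : ℝ) : ℂ) - ‖z‖ * u := by
      rw [hz2]; push_cast; ring
    rw [e]
    refine (norm_sub_le _ _).trans ?_
    rw [norm_mul, Complex.norm_real, Complex.norm_real, norm_norm, Real.norm_of_nonneg hq.le]
    have h8 : 1 - ‖z‖ ≤ 1 - ‖z‖ ^ 2 := by nlinarith
    have h9 : ε ≤ c * (1 - ‖z‖ ^ 2) := by rw [hε]; gcongr
    nlinarith [norm_nonneg u]
  rw [mem_hypBall_iff hz hr]
  constructor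
  · refine lt_of_pow_lt_pow_left₀ 2 zero_le_one ?_
    nlinarith
  · have hr2 : 0 < 1 - r ^ 2 := by nlinarith
    calc (1 - r ^ 2) * ‖1 - (inner ℂ z (z + y) : ℂ)‖ ^ 2
        ≤ (1 - r ^ 2) * ((1 - ‖z‖ ^ 2) * (1 + c)) ^ 2 := by gcongr
      _ = (1 - ‖z‖ ^ 2) ^ 2 * ((1 - 16 * c) * (1 + c) ^ 2) := by rw [hc]; ring
      _ < (1 - ‖z‖ ^ 2) ^ 2 * (1 - 4 * c) := by
          gcongr
          nlinarith [mul_pos hc0 hc0, mul_pos (mul_pos hc0 hc0) hc0]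
      _ = (1 - ‖z‖ ^ 2) * ((1 - ‖z‖ ^ 2) * (1 - 4 * c)) := by ring
      _ ≤ (1 - ‖z‖ ^ 2) * (1 - ‖z + y‖ ^ 2) := by
          gcongr
          nlinarith

/-- The sub-mean value property of `|f|^p` on hyperbolic balls. -/
theorem rpow_enorm_le_lintegral_hypBall (hn : 1 ≤ n) {r : ℝ} (hr : 0 < r) (hr1 : r < 1) :
    ∃ C : ℝ≥0, ∀ f : Cn n → ℂ, DifferentiableOn ℂ f (unitBall n) → ∀ p : ℝ, 0 < p →
      ∀ z : Cn n, ‖z‖ < 1 → ENNReal.ofReal (1 - ‖z‖) ^ (n + 1) * ‖f z‖ₑ ^ p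
        ≤ C * ∫⁻ w in hypBall z r, ‖f w‖ₑ ^ p ∂haar n := by
  set b := haar n (unitBall n) with hb
  have hb0 : b ≠ 0 := (Metric.measure_ball_pos _ _ one_pos).ne'
  have hbt : b ≠ ∞ := (Metric.isBounded_ball.measure_lt_top).ne
  set κ := ENNReal.ofReal (r ^ 2 / 16) ^ (n + 1) * b with hκ
  have hκ0 : κ ≠ 0 := mul_ne_zero (pow_ne_zero _ (by
    rw [ENNReal.ofReal_ne_zero_iff]; positivity)) hb0
  have hκt : κ ≠ ∞ := ENNReal.mul_ne_top (by simp) hbt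
  refine ⟨κ⁻¹.toNNReal, fun f hf p hp z hz => ?_⟩
  rw [ENNReal.coe_toNNReal (ENNReal.inv_ne_top.2 hκ0), ← ENNReal.div_eq_inv_mul,
    ENNReal.le_div_iff_mul_le (Or.inl hκ0) (Or.inl hκt)]
  obtain ⟨η, hη, hzη⟩ := exists_unit_vector hn z
  have hd : 0 < 1 - ‖z‖ := sub_pos.2 hz
  set ε := r ^ 2 / 16 * (1 - ‖z‖) with hε
  have hε0 : 0 < ε := by positivity
  have hβ := Real.sqrt_pos.2 hε0
  set L := stretch η ε (Real.sqrt ε) with hL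
  have hLc : Continuous L := LinearMap.continuous_of_finiteDimensional L
  have hsub : ∀ x ∈ unitBall n, z + L x ∈ hypBall z r := fun x hx =>
    stretch_ball_subset_hypBall hz hη hzη hr hr1 (mem_unitBall.1 hx)
  have hg : DifferentiableOn ℂ (fun x => f (z + L x)) (unitBall n) := by
    have hLd : Differentiable ℂ L := (LinearMap.toContinuousLinearMap L).differentiable
    exact hf.comp ((differentiable_const z).add hLd).differentiableOn
      (fun x hx => (hsub x hx).1)
  have h1 := rpow_enorm_zero_mul_haar_le hg hp
  simp only [map_zero, add_zero] at h1
  have hm := measurableSet_hypBall hz hr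
  set Φ : Cn n → ℝ≥0∞ := (hypBall z r).indicator (fun x => ‖f x‖ₑ ^ p) with hΦ
  have hΦeq : Φ = fun x => ‖(hypBall z r).indicator f x‖ₑ ^ p := by
    ext x
    by_cases hx : x ∈ hypBall z r
    · simp [hΦ, indicator_of_mem hx]
    · simp [hΦ, indicator_of_notMem hx, hp]
  have hΦm : Measurable Φ := by
    rw [hΦeq]
    exact ((measurable_indicator_of_differentiableOn (isOpen_hypBall hz hr)
      (hf.mono (hypBall_subset_unitBall z r))).enorm).pow_const p
  have h2 : ∫⁻ x in unitBall n, ‖f (z + L x)‖ₑ ^ p ∂haar n ≤ ∫⁻ x, Φ (z + L x) ∂haar n := by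
    rw [← lintegral_indicator isOpen_unitBall.measurableSet]
    refine lintegral_mono fun x => ?_
    by_cases hx : x ∈ unitBall n
    · rw [indicator_of_mem hx, hΦ, indicator_of_mem (hsub x hx)]
    · simp [indicator_of_notMem hx]
  -- The Jacobian is read off by comparing the two volume formulas on the unit ball.
  have hdet : ENNReal.ofReal (‖LinearMap.det L‖ ^ 2) = ENNReal.ofReal ε ^ (n + 1) := by
    have e1 := haar_image_complexLinear L (unitBall n)
    have e2 := haar_image_stretch hn hη (α := ε) hβ (unitBall n)
    rw [← hL, e1, ENNReal.mul_left_inj hb0 hbt, Real.sq_sqrt hε0.le, ← pow_add,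
      ENNReal.ofReal_pow hε0.le, show 2 + (n - 1) = n + 1 by omega] at e2
    exact e2
  have hdet0 : LinearMap.det L ≠ 0 := by
    intro h0
    have h4 : ENNReal.ofReal ε ^ (n + 1) ≠ 0 := pow_ne_zero _ (by simpa using hε0)
    apply h4
    rw [← hdet, h0]
    simp
  have h3 := lintegral_comp_complexLinear hdet0 (F := fun x => Φ (z + x))
    (hΦm.comp (measurable_const_add z))
  rw [lintegral_add_left_eq_self, hdet, hΦ, lintegral_indicator hm] at h3
  rw [← h3]
  calc ENNReal.ofReal (1 - ‖z‖) ^ (n + 1) * ‖f z‖ₑ ^ p * κ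
      = ENNReal.ofReal ε ^ (n + 1) * (‖f z‖ₑ ^ p * b) := by
        rw [hκ, hε, ENNReal.ofReal_mul (by positivity), mul_pow]; ring
    _ ≤ _ := by
        gcongr
        exact h1.trans h2

end

section

/-! ### Monotonicity of spherical means and the radial comparison -/

variable {n : ℕ}

theorem exists_bound_closedBall {f : Cn n → ℂ} (hf : DifferentiableOn ℂ f (unitBall n)) {u : ℝ}
    (hu : u < 1) : ∃ M : ℝ, ∀ z : Cn n, ‖z‖ ≤ u → ‖f z‖ ≤ M := by
  have hsub : Metric.closedBall (0 : Cn n) u ⊆ unitBall n := Metric.closedBall_subset_ball hu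
  obtain ⟨M, hM⟩ := (isCompact_closedBall (0 : Cn n) u).exists_bound_of_continuousOn
    (hf.continuousOn.mono hsub)
  exact ⟨M, fun z hz => hM z (by simpa using hz)⟩

/-- A maximum principle for the radial continuous function G(l) = ∫|f(lζ)|^p. Its maximum over |l| ≤
u may be taken at some s in [0,u]. If s < u, the circle centred at s of radius u-s touches |l| = u
at the point u; the sub-mean inequality there, with G ≤ G(s), forces G(u) = G(s). -/
theorem integral_sphere_le_of_le (hn : 1 ≤ n) {f : Cn n → ℂ}
    (hf : DifferentiableOn ℂ f (unitBall n)) {p : ℝ} (hp : 0 < p) {t u : ℝ} (ht : 0 ≤ t)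
    (htu : t ≤ u) (hu : u < 1) :
    ∫⁻ ζ, ‖f (t • (ζ : Cn n))‖ₑ ^ p ∂sphereMeasure n
      ≤ ∫⁻ ζ, ‖f (u • (ζ : Cn n))‖ₑ ^ p ∂sphereMeasure n := by
  set fB := (unitBall n).indicator f with hfB
  have hfBm : Measurable fB := measurable_indicator_of_differentiableOn isOpen_unitBall hf
  have hball : ∀ l : ℂ, ‖l‖ ≤ u → ∀ ζ : Metric.sphere (0 : Cn n) 1, l • (ζ : Cn n) ∈ unitBall n := by
    intro l hl ζ
    rw [mem_unitBall, norm_smul, norm_sphere, mul_one]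
    exact hl.trans_lt hu
  obtain ⟨M, hM⟩ := exists_bound_closedBall hf hu
  set G : ℂ → ℝ := fun l => ∫ ζ, ‖f (l • (ζ : Cn n))‖ ^ p ∂sphereMeasure n with hG
  have hcontζ : ∀ l : ℂ, ‖l‖ ≤ u → Continuous fun ζ : Metric.sphere (0 : Cn n) 1 =>
      ‖f (l • (ζ : Cn n))‖ ^ p := by
    intro l hl
    refine Continuous.rpow_const (Continuous.norm ?_) fun _ => Or.inr hp.le
    exact hf.continuousOn.comp_continuous (by fun_prop) (hball l hl)
  have hGcont : ContinuousOn G (Metric.closedBall 0 u) := by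
    refine continuousOn_of_dominated (bound := fun _ => M ^ p) ?_ ?_ (integrable_const _) ?_
    · intro l hl
      exact (hcontζ l (by simpa using hl)).aestronglyMeasurable
    · intro l hl
      refine Eventually.of_forall fun ζ => ?_
      rw [Real.norm_of_nonneg (by positivity)]
      have hl' : ‖l‖ ≤ u := by simpa using hl
      gcongr
      exact hM _ (by rw [norm_smul, norm_sphere, mul_one]; exact hl')
    · refine Eventually.of_forall fun ζ => ?_
      refine ContinuousOn.rpow_const (ContinuousOn.norm ?_) fun _ _ => Or.inr hp.le
      exact hf.continuousOn.comp (by fun_prop) fun l hl => hball l (by simpa using hl) ζ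
  have hGof : ∀ l : ℂ, ‖l‖ ≤ u →
      ENNReal.ofReal (G l) = ∫⁻ ζ, ‖f (l • (ζ : Cn n))‖ₑ ^ p ∂sphereMeasure n := by
    intro l hl
    rw [hG, ofReal_integral_eq_lintegral_ofReal]
    · refine lintegral_congr fun ζ => ?_
      rw [← ENNReal.ofReal_rpow_of_nonneg (norm_nonneg _) hp.le, ofReal_norm]
    · exact (hcontζ l hl).integrable_of_hasCompactSupport (HasCompactSupport.of_compactSpace _)
    · exact Eventually.of_forall fun ζ => by positivity
  have hG0 : ∀ l : ℂ, 0 ≤ G l := fun l => integral_nonneg fun ζ => by positivity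
  have hrad : ∀ l : ℂ, ‖l‖ ≤ u → G l = G (‖l‖ : ℂ) := by
    intro l hl
    have hl2 : ‖(‖l‖ : ℂ)‖ ≤ u := by rwa [Complex.norm_real, norm_norm]
    have key : ∫⁻ ζ, ‖f (l • (ζ : Cn n))‖ₑ ^ p ∂sphereMeasure n
        = ∫⁻ ζ, ‖f ((‖l‖ : ℂ) • (ζ : Cn n))‖ₑ ^ p ∂sphereMeasure n := by
      rcases eq_or_ne l 0 with rfl | hl0
      · simp
      have hn0 : ‖l‖ ≠ 0 := norm_ne_zero_iff.2 hl0
      have hn0' : (‖l‖ : ℂ) ≠ 0 := by exact_mod_cast hn0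
      have hc : ‖l / (‖l‖ : ℂ)‖ = 1 := by
        rw [norm_div, Complex.norm_real, norm_norm, div_self hn0]
      have h := lintegral_sphere_rotation hn hc
        (F := fun w => ‖fB ((‖l‖ : ℂ) • w)‖ₑ ^ p)
        (((hfBm.comp (measurable_const_smul _)).enorm).pow_const p)
      calc _ = ∫⁻ ζ, ‖fB ((‖l‖ : ℂ) • (l / (‖l‖ : ℂ)) • (ζ : Cn n))‖ₑ ^ p ∂sphereMeasure n := by
            refine lintegral_congr fun ζ => ?_
            rw [smul_smul, mul_div_cancel₀ _ hn0', hfB, indicator_of_mem (hball l hl ζ)]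
        _ = ∫⁻ ζ, ‖fB ((‖l‖ : ℂ) • (ζ : Cn n))‖ₑ ^ p ∂sphereMeasure n := h
        _ = _ := by
            refine lintegral_congr fun ζ => ?_
            rw [hfB, indicator_of_mem (hball _ hl2 ζ)]
    rw [← hGof l hl, ← hGof _ hl2] at key
    exact (ENNReal.ofReal_eq_ofReal_iff (hG0 _) (hG0 _)).1 key
  have hu0 : 0 ≤ u := ht.trans htu
  obtain ⟨l₀, hl₀, hmax⟩ := (isCompact_closedBall (0 : ℂ) u).exists_isMaxOn
    ⟨0, Metric.mem_closedBall_self hu0⟩ hGcont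
  have hl₀' : ‖l₀‖ ≤ u := by simpa using hl₀
  have hle : ∀ l : ℂ, ‖l‖ ≤ u → G l ≤ G l₀ := fun l hl => hmax (by simpa using hl)
  have hGu : G l₀ ≤ G (u : ℂ) := by
    rcases hl₀'.eq_or_lt with h | h
    · rw [hrad l₀ hl₀', h]
    set s := ‖l₀‖ with hs
    have hs0 : 0 ≤ s := norm_nonneg _
    have hR : 0 < u - s := sub_pos.2 h
    have hcm : ∀ θ : ℝ, ‖circleMap (s : ℂ) (u - s) θ‖ ≤ u := by
      intro θ
      rw [circleMap]
      refine (norm_add_le _ _).trans ?_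
      rw [norm_mul, Complex.norm_real, Complex.norm_real, Complex.norm_exp_ofReal_mul_I,
        Real.norm_of_nonneg hs0, Real.norm_of_nonneg hR.le]
      linarith
    have hsub : ENNReal.ofReal (2 * Real.pi) * ENNReal.ofReal (G (s : ℂ)) ≤
        ∫⁻ θ in Ioc 0 (2 * Real.pi), ENNReal.ofReal (G (circleMap (s : ℂ) (u - s) θ)) := by
      have hsu : ‖(s : ℂ)‖ ≤ u := by rw [Complex.norm_real, Real.norm_of_nonneg hs0]; exact h.le
      have hjoint : Measurable fun q : Metric.sphere (0 : Cn n) 1 × ℝ =>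
          ‖fB (circleMap (s : ℂ) (u - s) q.2 • (q.1 : Cn n))‖ₑ ^ p :=
        ((hfBm.comp (Continuous.measurable (by fun_prop))).enorm).pow_const p
      calc _ = ∫⁻ ζ, ENNReal.ofReal (2 * Real.pi) * ‖f ((s : ℂ) • (ζ : Cn n))‖ₑ ^ p
              ∂sphereMeasure n := by
            rw [hGof _ hsu, lintegral_const_mul' _ _ ENNReal.ofReal_ne_top]
        _ ≤ ∫⁻ ζ, (∫⁻ θ in Ioc 0 (2 * Real.pi),
              ‖fB (circleMap (s : ℂ) (u - s) θ • (ζ : Cn n))‖ₑ ^ p) ∂sphereMeasure n := by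
            refine lintegral_mono fun ζ => ?_
            have han := analyticOnNhd_slice isOpen_unitBall hf (ζ : Cn n) 0
              (S := Metric.closedBall (s : ℂ) (u - s)) (fun l hl => by
                rw [zero_add]
                refine hball l ?_ ζ
                have h1 : ‖l - s‖ ≤ u - s := by simpa [dist_eq_norm] using hl
                have h2 : ‖l‖ ≤ ‖l - s‖ + ‖(s : ℂ)‖ := by
                  simpa using norm_add_le (l - s) (s : ℂ)
                rw [Complex.norm_real, Real.norm_of_nonneg hs0] at h2
                linarith)
            have := two_pi_mul_rpow_enorm_le hR hp han
            simp only [zero_add] at this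
            refine this.trans_eq (lintegral_congr fun θ => ?_)
            rw [hfB, indicator_of_mem (hball _ (hcm θ) ζ)]
        _ = ∫⁻ θ in Ioc 0 (2 * Real.pi), (∫⁻ ζ,
              ‖fB (circleMap (s : ℂ) (u - s) θ • (ζ : Cn n))‖ₑ ^ p ∂sphereMeasure n) :=
            lintegral_lintegral_swap hjoint.aemeasurable
        _ = _ := by
            refine lintegral_congr fun θ => ?_
            rw [hGof _ (hcm θ)]
            refine lintegral_congr fun ζ => ?_
            rw [hfB, indicator_of_mem (hball _ (hcm θ) ζ)]
    have hcirc : Continuous fun θ => G (circleMap (s : ℂ) (u - s) θ) :=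
      hGcont.comp_continuous (continuous_circleMap _ _) fun θ => by simpa using hcm θ
    have hpi := Real.two_pi_pos
    rw [← ofReal_integral_eq_lintegral_ofReal hcirc.integrableOn_Ioc
      (Eventually.of_forall fun θ => hG0 _), ← ENNReal.ofReal_mul hpi.le,
      ENNReal.ofReal_le_ofReal_iff (integral_nonneg fun θ => hG0 _),
      ← intervalIntegral.integral_of_le hpi.le, ← hrad l₀ hl₀'] at hsub
    by_contra hcon
    rw [not_le] at hcon
    have hpos := intervalIntegral.integral_pos (a := 0) (b := 2 * Real.pi)
      (f := fun θ => G l₀ - G (circleMap (s : ℂ) (u - s) θ)) hpi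
      (continuous_const.sub hcirc).continuousOn
      (fun θ _ => sub_nonneg.2 (hle _ (hcm θ)))
      ⟨0, ⟨le_rfl, hpi.le⟩, by
        have : circleMap (s : ℂ) (u - s) 0 = u := by simp [circleMap]
        rw [this]; exact sub_pos.2 hcon⟩
    rw [intervalIntegral.integral_sub (by simp) (hcirc.intervalIntegrable _ _),
      intervalIntegral.integral_const, smul_eq_mul] at hpos
    linarith
  have e : ∀ v : ℝ, 0 ≤ v → v ≤ u → ENNReal.ofReal (G (v : ℂ))
      = ∫⁻ ζ, ‖f (v • (ζ : Cn n))‖ₑ ^ p ∂sphereMeasure n := by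
    intro v hv hvu
    rw [hGof _ (by rwa [Complex.norm_real, Real.norm_of_nonneg hv])]
    simp_rw [Complex.coe_smul]
  rw [← e t ht htu, ← e u hu0 le_rfl]
  refine ENNReal.ofReal_le_ofReal ((hle _ ?_).trans hGu)
  rwa [Complex.norm_real, Real.norm_of_nonneg ht]

/-- The regularized profile `t ↦ (1 - t)⁻¹ ∫_t^1 W`. -/
def smoothProfile (W : ℝ → ℝ≥0∞) (t : ℝ) : ℝ≥0∞ := (ENNReal.ofReal (1 - t))⁻¹ * mass W t

theorem measurable_mass (W : ℝ → ℝ≥0∞) : Measurable (mass W) :=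
  Antitone.measurable fun _ _ h => mass_anti W h

theorem measurable_smoothProfile (W : ℝ → ℝ≥0∞) : Measurable (smoothProfile W) :=
  (Measurable.inv (by fun_prop)).mul (measurable_mass W)

variable {W : ℝ → ℝ≥0∞} {A B : ℝ≥0} {K : ℝ}

/-- The tail at t is at most B times the mass of W on an interval I_t to the right of t, where H(t)
≤ H(u). After Tonelli, u ∈ I_t forces t ≥ 1-2K(1-u) and 1-t > 2(1-u), so the t-integral of 1/(1-t)
is at most 2K(1-u)/(2(1-u)) = K. -/
theorem lintegral_smoothProfile_le (hW : IsDoublingProfile W A B K) {H : ℝ → ℝ≥0∞}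
    (hH : Measurable H) (hmono : MonotoneOn H (Ioo 0 1)) :
    ∫⁻ t in Ioo (0 : ℝ) 1, smoothProfile W t * H t
      ≤ B * ENNReal.ofReal K * ∫⁻ u in Ioo (0 : ℝ) 1, W u * H u := by
  have hK : 0 < K := one_pos.trans hW.one_lt
  set S : Set (ℝ × ℝ) := {q | (q.1 + 1) / 2 < q.2 ∧ q.2 ≤ 1 - (1 - q.1) / (2 * K)} with hS
  have hSm : MeasurableSet S :=
    (measurableSet_lt (f := fun q : ℝ × ℝ => (q.1 + 1) / 2) (g := fun q => q.2)
      (by fun_prop) (by fun_prop)).inter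
    (measurableSet_le (f := fun q : ℝ × ℝ => q.2) (g := fun q => 1 - (1 - q.1) / (2 * K))
      (by fun_prop) (by fun_prop))
  have hWH : Measurable fun u => W u * H u := hW.measurable.mul hH
  set Φ : ℝ × ℝ → ℝ≥0∞ := fun q =>
    S.indicator (fun q => (ENNReal.ofReal (1 - q.1))⁻¹ * (W q.2 * H q.2)) q with hΦ
  have hΦm : Measurable Φ := by
    refine Measurable.indicator ?_ hSm
    refine Measurable.mul (Measurable.inv (by fun_prop)) ?_
    exact (hW.measurable.comp measurable_snd).mul (hH.comp measurable_snd)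
  have h1 : ∀ t ∈ Ioo (0 : ℝ) 1, smoothProfile W t * H t
      ≤ B * ∫⁻ u in Ioo (0 : ℝ) 1, Φ (t, u) := by
    intro t ht
    have hd : 0 < 1 - t := by linarith [ht.2]
    have hdK : 0 < (1 - t) / (2 * K) := by positivity
    have hI : Ioc ((t + 1) / 2) (1 - (1 - t) / (2 * K)) ⊆ Ioo (0 : ℝ) 1 := fun u hu =>
      ⟨by linarith [hu.1, ht.1], by linarith [hu.2]⟩
    calc smoothProfile W t * H t
        ≤ (ENNReal.ofReal (1 - t))⁻¹ *
            (B * ∫⁻ u in Ioc ((t + 1) / 2) (1 - (1 - t) / (2 * K)), W u) * H t := by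
          rw [smoothProfile]
          gcongr
          exact hW.reverse t ⟨ht.1.le, ht.2⟩
      _ = B * ((ENNReal.ofReal (1 - t))⁻¹ *
            ∫⁻ u in Ioc ((t + 1) / 2) (1 - (1 - t) / (2 * K)), W u * H t) := by
          rw [lintegral_mul_const _ hW.measurable]; ring
      _ ≤ B * ((ENNReal.ofReal (1 - t))⁻¹ *
            ∫⁻ u in Ioc ((t + 1) / 2) (1 - (1 - t) / (2 * K)), W u * H u) := by
          refine mul_le_mul' le_rfl (mul_le_mul' le_rfl ?_)
          refine setLIntegral_mono' measurableSet_Ioc fun u hu => ?_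
          gcongr
          exact hmono ht (hI hu) (by linarith [hu.1, ht.2])
      _ = B * ∫⁻ u in Ioc ((t + 1) / 2) (1 - (1 - t) / (2 * K)), Φ (t, u) := by
          rw [← lintegral_const_mul _ hWH]
          congr 1
          refine setLIntegral_congr_fun measurableSet_Ioc fun u hu => ?_
          have hmem : (t, u) ∈ S := hu
          simp only [hΦ, indicator_of_mem hmem]
      _ ≤ _ := by
          gcongr
  have h2 : ∀ u ∈ Ioo (0 : ℝ) 1, ∫⁻ t in Ioo (0 : ℝ) 1, Φ (t, u)
      ≤ ENNReal.ofReal K * (W u * H u) := by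
    intro u hu
    have hd : 0 < 1 - u := by linarith [hu.2]
    have hne0 : ENNReal.ofReal (2 * (1 - u)) ≠ 0 := by
      rw [ENNReal.ofReal_ne_zero_iff]; positivity
    calc ∫⁻ t in Ioo (0 : ℝ) 1, Φ (t, u)
        ≤ ∫⁻ t, (Ico (1 - 2 * K * (1 - u)) 1).indicator
            (fun _ => (ENNReal.ofReal (2 * (1 - u)))⁻¹ * (W u * H u)) t := by
          refine (lintegral_mono_ae ?_).trans (setLIntegral_le_lintegral (Ioo (0 : ℝ) 1) _)
          filter_upwards [ae_restrict_mem measurableSet_Ioo] with t ht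
          by_cases hmem : (t, u) ∈ S
          · have hm1 : (t + 1) / 2 < u := hmem.1
            have hm2 : u ≤ 1 - (1 - t) / (2 * K) := hmem.2
            have h3 : (1 - t) / (2 * K) ≤ 1 - u := by linarith
            rw [div_le_iff₀ (by positivity)] at h3
            have htm : t ∈ Ico (1 - 2 * K * (1 - u)) 1 := ⟨by linarith, ht.2⟩
            simp only [hΦ, indicator_of_mem hmem, indicator_of_mem htm]
            gcongr
            linarith
          · simp [hΦ, indicator_of_notMem hmem]
      _ = _ := by
          rw [lintegral_indicator measurableSet_Ico, setLIntegral_const, Real.volume_Ico]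
          have e : ENNReal.ofReal (1 - (1 - 2 * K * (1 - u)))
              = ENNReal.ofReal K * ENNReal.ofReal (2 * (1 - u)) := by
            rw [← ENNReal.ofReal_mul hK.le]; congr 1; ring
          rw [e]
          calc _ = ENNReal.ofReal K * ((ENNReal.ofReal (2 * (1 - u)))⁻¹ *
                ENNReal.ofReal (2 * (1 - u))) * (W u * H u) := by ring
            _ = _ := by rw [ENNReal.inv_mul_cancel hne0 ENNReal.ofReal_ne_top, mul_one]
  calc _ ≤ ∫⁻ t in Ioo (0 : ℝ) 1, B * ∫⁻ u in Ioo (0 : ℝ) 1, Φ (t, u) :=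
        setLIntegral_mono' measurableSet_Ioo h1
    _ = B * ∫⁻ u in Ioo (0 : ℝ) 1, ∫⁻ t in Ioo (0 : ℝ) 1, Φ (t, u) := by
        rw [lintegral_const_mul' _ _ ENNReal.coe_ne_top,
          lintegral_lintegral_swap (f := fun t u => Φ (t, u)) hΦm.aemeasurable]
    _ ≤ B * ∫⁻ u in Ioo (0 : ℝ) 1, ENNReal.ofReal K * (W u * H u) := by
        refine mul_le_mul' le_rfl ?_
        exact setLIntegral_mono' measurableSet_Ioo h2
    _ = _ := by
        rw [lintegral_const_mul' _ _ ENNReal.ofReal_ne_top, mul_assoc]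

/-- Replacing the weight by its regularization does not increase the integral of `|f|^p` by more
than a constant factor. -/
theorem lintegral_radialMeasure_smoothProfile_le (hn : 1 ≤ n) (hW : IsDoublingProfile W A B K)
    {f : Cn n → ℂ} (hf : DifferentiableOn ℂ f (unitBall n)) {p : ℝ} (hp : 0 < p) :
    ∫⁻ z, ‖(unitBall n).indicator f z‖ₑ ^ p ∂radialMeasure n (smoothProfile W)
      ≤ B * ENNReal.ofReal K *
        ∫⁻ z, ‖(unitBall n).indicator f z‖ₑ ^ p ∂radialMeasure n W := by
  set fB := (unitBall n).indicator f with hfB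
  have hfBm : Measurable fB := measurable_indicator_of_differentiableOn isOpen_unitBall hf
  have hFm : Measurable fun z => ‖fB z‖ₑ ^ p := hfBm.enorm.pow_const p
  rw [lintegral_radialMeasure hn (measurable_smoothProfile W) hFm,
    lintegral_radialMeasure hn hW.measurable hFm, mul_left_comm]
  refine mul_le_mul' le_rfl ?_
  refine lintegral_smoothProfile_le hW (H := fun t => ENNReal.ofReal (t ^ polarExp n) *
    ∫⁻ ζ, ‖fB (t • (ζ : Cn n))‖ₑ ^ p ∂sphereMeasure n) ?_ ?_
  · refine Measurable.mul (by fun_prop) ?_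
    have hjoint : Measurable fun q : ℝ × Metric.sphere (0 : Cn n) 1 =>
        ‖fB (q.1 • (q.2 : Cn n))‖ₑ ^ p :=
      hFm.comp (Continuous.measurable (by fun_prop))
    exact hjoint.lintegral_prod_right'
  · intro t ht u hu htu
    have hin : ∀ v ∈ Ioo (0 : ℝ) 1, ∀ ζ : Metric.sphere (0 : Cn n) 1,
        fB (v • (ζ : Cn n)) = f (v • (ζ : Cn n)) := fun v hv ζ => by
      rw [hfB, indicator_of_mem]
      rw [mem_unitBall, norm_real_smul_sphere _ hv.1.le]
      exact hv.2
    simp only [hin t ht, hin u hu]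
    have := ht.1.le
    gcongr ENNReal.ofReal (?_ ^ _) * ?_
    exact integral_sphere_le_of_le hn hf hp ht.1.le htu hu.2

end

section

/-! ### Pointwise bounds and the Carleson embedding -/

variable {n : ℕ} {W : ℝ → ℝ≥0∞} {A B : ℝ≥0} {K : ℝ}

theorem lintegral_radialMeasure_eq (hW : Measurable W) {F : Cn n → ℝ≥0∞} (hF : Measurable F) :
    ∫⁻ z, F z ∂radialMeasure n W = volConst n * ∫⁻ z in unitBall n, W ‖z‖ * F z ∂haar n := by
  have hWn : Measurable fun z : Cn n => W ‖z‖ := hW.comp measurable_norm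
  rw [radialMeasure, lintegral_withDensity_eq_lintegral_mul _ hWn hF, vol_eq,
    lintegral_smul_measure, smul_eq_mul]
  rfl

theorem ae_radialMeasure_mem_unitBall : ∀ᵐ z ∂radialMeasure n W, z ∈ unitBall n := by
  refine (withDensity_absolutelyContinuous _ _).ae_le ?_
  rw [vol_eq]
  exact Measure.ae_smul_measure (ae_restrict_mem isOpen_unitBall.measurableSet) _

theorem lintegral_indicator_unitBall (f : Cn n → ℂ) (p : ℝ) :
    ∫⁻ z, ‖(unitBall n).indicator f z‖ₑ ^ p ∂radialMeasure n W
      = ∫⁻ z, ‖f z‖ₑ ^ p ∂radialMeasure n W := by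
  refine lintegral_congr_ae ?_
  filter_upwards [ae_radialMeasure_mem_unitBall] with z hz
  rw [indicator_of_mem hz]

theorem lintegral_mul_smoothProfile_le (hn : 1 ≤ n) (hW : IsDoublingProfile W A B K) :
    ∃ C : ℝ≥0, ∀ f : Cn n → ℂ, DifferentiableOn ℂ f (unitBall n) → ∀ p : ℝ, 0 < p →
      ∫⁻ z in unitBall n, ‖f z‖ₑ ^ p * smoothProfile W ‖z‖ ∂haar n
        ≤ C * ∫⁻ z, ‖f z‖ₑ ^ p ∂radialMeasure n W := by
  have hc := volConst_ne_zero (n := n)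
  have hct := volConst_ne_top (n := n)
  refine ⟨(volConst n)⁻¹.toNNReal * (B * K.toNNReal), fun f hf p hp => ?_⟩
  have h := lintegral_radialMeasure_smoothProfile_le hn hW hf hp
  have hfBm := measurable_indicator_of_differentiableOn isOpen_unitBall hf
  rw [lintegral_indicator_unitBall f p (W := W),
    lintegral_radialMeasure_eq (measurable_smoothProfile W) (hfBm.enorm.pow_const p)] at h
  have e : ∫⁻ z in unitBall n, smoothProfile W ‖z‖ * ‖(unitBall n).indicator f z‖ₑ ^ p ∂haar n
      = ∫⁻ z in unitBall n, ‖f z‖ₑ ^ p * smoothProfile W ‖z‖ ∂haar n := by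
    refine setLIntegral_congr_fun isOpen_unitBall.measurableSet fun z hz => ?_
    rw [indicator_of_mem hz, mul_comm]
  rw [e] at h
  push_cast
  rw [ENNReal.coe_toNNReal (ENNReal.inv_ne_top.2 hc), mul_assoc, ← ENNReal.div_eq_inv_mul,
    ENNReal.le_div_iff_mul_le (Or.inl hc) (Or.inl hct), mul_comm]
  exact h

theorem inv_le_mul_inv_of_le_mul {a b : ℝ≥0∞} {C : ℝ≥0} (hC : C ≠ 0) (h : a ≤ C * b) :
    b⁻¹ ≤ C * a⁻¹ := by
  have hC' : (C : ℝ≥0∞) ≠ 0 := by exact_mod_cast hC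
  have h1 : ((C : ℝ≥0∞) * b)⁻¹ ≤ a⁻¹ := ENNReal.inv_le_inv.2 h
  rw [ENNReal.mul_inv (Or.inl hC') (Or.inl ENNReal.coe_ne_top)] at h1
  calc b⁻¹ = C * ((C : ℝ≥0∞)⁻¹ * b⁻¹) := by
        rw [← mul_assoc, ENNReal.mul_inv_cancel hC' ENNReal.coe_ne_top, one_mul]
    _ ≤ _ := by gcongr

theorem ofReal_one_sub_norm_le_of_mem_hypBall {r : ℝ} (hr : 0 < r) (hr1 : r < 1) {z w : Cn n}
    (hz : ‖z‖ < 1) (hw : w ∈ hypBall z r) :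
    ENNReal.ofReal (1 - ‖w‖) ≤ (4 / (1 - r ^ 2)).toNNReal * ENNReal.ofReal (1 - ‖z‖) := by
  have hl : 0 < 4 / (1 - r ^ 2) := div_pos (by norm_num) (by nlinarith)
  rw [← ENNReal.ofReal, ← ENNReal.ofReal_mul hl.le]
  exact ENNReal.ofReal_le_ofReal (one_sub_norm_le_of_mem_hypBall hz hr hr1 hw).le

theorem distortion_ne_zero {r : ℝ} (hr : 0 < r) (hr1 : r < 1) : (4 / (1 - r ^ 2)).toNNReal ≠ 0 := by
  have hl : 0 < 4 / (1 - r ^ 2) := div_pos (by norm_num) (by nlinarith)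
  exact (Real.toNNReal_pos.2 hl).ne'

theorem exists_size_le_of_mem_hypBall (hW : IsDoublingProfile W A B K) {r : ℝ} (hr : 0 < r)
    (hr1 : r < 1) : ∃ C : ℝ≥0, C ≠ 0 ∧ ∀ z w : Cn n, ‖z‖ < 1 → w ∈ hypBall z r →
      size W w ≤ C * size W z := by
  obtain ⟨C, hC⟩ := exists_mass_le_of_mem_hypBall (n := n) hW hr hr1
  refine ⟨(4 / (1 - r ^ 2)).toNNReal ^ n * (C + 1),
    mul_ne_zero (pow_ne_zero _ (distortion_ne_zero hr hr1)) (by positivity), fun z w hz hw => ?_⟩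
  calc size W w ≤ ((4 / (1 - r ^ 2)).toNNReal * ENNReal.ofReal (1 - ‖z‖)) ^ n
        * ((C + 1) * mass W ‖z‖) := by
        rw [size]
        gcongr
        · exact ofReal_one_sub_norm_le_of_mem_hypBall hr hr1 hz hw
        · exact (hC z w hz hw).trans (by gcongr; exact le_self_add)
    _ = _ := by rw [size]; push_cast; ring

/-- This local regularity, valid for every radius r, is what the regularized profile offers and W
itself need not have. -/
theorem exists_smoothProfile_le_of_mem_hypBall (hW : IsDoublingProfile W A B K) {r : ℝ}
    (hr : 0 < r) (hr1 : r < 1) : ∃ C : ℝ≥0, ∀ z w : Cn n, ‖z‖ < 1 → w ∈ hypBall z r →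
      smoothProfile W ‖z‖ ≤ C * smoothProfile W ‖w‖ := by
  obtain ⟨C, hC⟩ := exists_mass_le_of_mem_hypBall (n := n) hW hr hr1
  refine ⟨(4 / (1 - r ^ 2)).toNNReal * C, fun z w hz hw => ?_⟩
  have hw1 : ‖w‖ < 1 := mem_unitBall.1 hw.1
  have h1 := inv_le_mul_inv_of_le_mul (distortion_ne_zero hr hr1)
    (ofReal_one_sub_norm_le_of_mem_hypBall hr hr1 hz hw)
  have h2 := hC w z hw1 ((mem_hypBall_comm hz hw1 hr).1 hw)
  calc smoothProfile W ‖z‖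
      ≤ ((4 / (1 - r ^ 2)).toNNReal * (ENNReal.ofReal (1 - ‖w‖))⁻¹) * (C * mass W ‖w‖) := by
        rw [smoothProfile]; gcongr
    _ = _ := by rw [smoothProfile]; push_cast; ring

theorem smoothProfile_mul_pow {z : Cn n} (hz : ‖z‖ < 1) :
    smoothProfile W ‖z‖ * ENNReal.ofReal (1 - ‖z‖) ^ (n + 1) = size W z := by
  have h0 : ENNReal.ofReal (1 - ‖z‖) ≠ 0 := by simpa using hz
  rw [smoothProfile, size, pow_succ]
  calc _ = ((ENNReal.ofReal (1 - ‖z‖))⁻¹ * ENNReal.ofReal (1 - ‖z‖))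
        * (ENNReal.ofReal (1 - ‖z‖) ^ n * mass W ‖z‖) := by ring
    _ = _ := by rw [ENNReal.inv_mul_cancel h0 ENNReal.ofReal_ne_top, one_mul]

/-- Pointwise growth of functions in the weighted Bergman space. -/
theorem size_mul_rpow_enorm_le (hn : 1 ≤ n) (hW : IsDoublingProfile W A B K) :
    ∃ C : ℝ≥0, ∀ f : Cn n → ℂ, DifferentiableOn ℂ f (unitBall n) → ∀ p : ℝ, 0 < p →
      ∀ z : Cn n, ‖z‖ < 1 → size W z * ‖f z‖ₑ ^ p ≤ C * ∫⁻ w, ‖f w‖ₑ ^ p ∂radialMeasure n W := by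
  have hr : (0 : ℝ) < 1 / 2 := by norm_num
  have hr1 : (1 / 2 : ℝ) < 1 := by norm_num
  obtain ⟨C₁, hC₁⟩ := rpow_enorm_le_lintegral_hypBall hn hr hr1
  obtain ⟨C₂, hC₂⟩ := exists_smoothProfile_le_of_mem_hypBall (n := n) hW hr hr1
  obtain ⟨C₃, hC₃⟩ := lintegral_mul_smoothProfile_le hn hW
  refine ⟨C₁ * (C₂ * C₃), fun f hf p hp z hz => ?_⟩
  have hm := measurableSet_hypBall (n := n) hz hr
  have hsub := hypBall_subset_unitBall z (1 / 2)
  have hst : smoothProfile W ‖z‖ ≠ ∞ := by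
    rw [smoothProfile]
    exact ENNReal.mul_ne_top (ENNReal.inv_ne_top.2 (by simpa using hz))
      (hW.ne_top _ (mem_Ico_norm hz))
  calc size W z * ‖f z‖ₑ ^ p
      = smoothProfile W ‖z‖ * (ENNReal.ofReal (1 - ‖z‖) ^ (n + 1) * ‖f z‖ₑ ^ p) := by
        rw [← smoothProfile_mul_pow hz, mul_assoc]
    _ ≤ smoothProfile W ‖z‖ * (C₁ * ∫⁻ w in hypBall z (1 / 2), ‖f w‖ₑ ^ p ∂haar n) := by
        exact mul_le_mul' le_rfl (hC₁ f hf p hp z hz)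
    _ = C₁ * ∫⁻ w in hypBall z (1 / 2), smoothProfile W ‖z‖ * ‖f w‖ₑ ^ p ∂haar n := by
        rw [lintegral_const_mul' _ _ hst]; ring
    _ ≤ C₁ * ∫⁻ w in hypBall z (1 / 2), C₂ * (‖f w‖ₑ ^ p * smoothProfile W ‖w‖) ∂haar n := by
        refine mul_le_mul' le_rfl (setLIntegral_mono' hm fun w hw => ?_)
        calc _ ≤ (C₂ * smoothProfile W ‖w‖) * ‖f w‖ₑ ^ p := by gcongr; exact hC₂ z w hz hw
          _ = _ := by ring
    _ ≤ C₁ * (C₂ * ∫⁻ w in unitBall n, ‖f w‖ₑ ^ p * smoothProfile W ‖w‖ ∂haar n) := by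
        rw [lintegral_const_mul' _ _ ENNReal.coe_ne_top]
        gcongr
    _ ≤ C₁ * (C₂ * (C₃ * ∫⁻ w, ‖f w‖ₑ ^ p ∂radialMeasure n W)) := by
        gcongr
        exact hC₃ f hf p hp
    _ = _ := by push_cast; ring

/-- A measure that is finite on almost all hyperbolic balls is sigma-finite on the unit ball. -/
theorem sigmaFinite_restrict_unitBall {r : ℝ} (hr : 0 < r) {μ : Measure (Cn n)}
    (h : ∀ᵐ w ∂(haar n).restrict (unitBall n), μ (hypBall w r) < ∞) :
    SigmaFinite (μ.restrict (unitBall n)) := by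
  have hex : ∀ z ∈ unitBall n, ∃ w ∈ unitBall n, z ∈ hypBall w r ∧ μ (hypBall w r) < ∞ := by
    intro z hz
    have hz' := mem_unitBall.1 hz
    rw [ae_restrict_iff' isOpen_unitBall.measurableSet] at h
    by_contra hcon
    push Not at hcon
    -- If no good ball contained z, then by symmetry every centre in the nonempty open set D(z,r)
    -- would be exceptional, although exceptional centres form a null set.
    have hsub : hypBall z r ⊆ {w | ¬(w ∈ unitBall n → μ (hypBall w r) < ∞)} := by
      intro w hw hPw
      have hw1 := mem_unitBall.1 hw.1
      exact absurd (hPw hw.1) (not_lt.2 (hcon w hw.1 ((mem_hypBall_comm hz' hw1 hr).1 hw)))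
    have h0 : haar n (hypBall z r) = 0 := measure_mono_null hsub (ae_iff.1 h)
    exact ((isOpen_hypBall hz' hr).measure_pos (haar n) ⟨z, mem_hypBall_self hz' hr⟩).ne' h0
  choose! g hg1 hg2 hg3 using hex
  obtain ⟨t, hts, htc, hcov⟩ := TopologicalSpace.countable_cover_nhdsWithin
    (s := unitBall n) (f := fun z => hypBall (g z) r) (fun z hz =>
      mem_nhdsWithin_of_mem_nhds
        ((isOpen_hypBall (mem_unitBall.1 (hg1 z hz)) hr).mem_nhds (hg2 z hz)))
  refine Measure.sigmaFinite_of_countable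
    (S := insert (unitBall n)ᶜ ((fun z => hypBall (g z) r) '' t)) ((htc.image _).insert _) ?_ ?_
  · rintro s (rfl | ⟨z, hz, rfl⟩)
    · rw [Measure.restrict_apply isOpen_unitBall.measurableSet.compl, compl_inter_self]
      simp
    · exact (Measure.restrict_apply_le _ _).trans_lt (hg3 z (hts hz))
  · rw [sUnion_insert, sUnion_image]
    refine eq_univ_of_forall fun z => ?_
    by_cases hz : z ∈ unitBall n
    · exact Or.inr (hcov hz)
    · exact Or.inl hz

/-- The Carleson embedding: a measure whose hyperbolic balls are dominated by a power of their
size integrates `|f|^q`. -/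
theorem lintegral_rpow_le_of_measure_hypBall_le (hn : 1 ≤ n) (hW : IsDoublingProfile W A B K)
    {r : ℝ} (hr : 0 < r) (hr1 : r < 1) {p q : ℝ} (hp : 0 < p) (hpq : p ≤ q) :
    ∃ C : ℝ≥0, ∀ μ : Measure (Cn n), ∀ M : ℝ≥0,
      (∀ᵐ w ∂(haar n).restrict (unitBall n), μ (hypBall w r) ≤ M * size W w ^ (q / p)) →
      ∀ f : Cn n → ℂ, DifferentiableOn ℂ f (unitBall n) →
        ∫⁻ z in unitBall n, ‖f z‖ₑ ^ q ∂μ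
          ≤ C * M * (∫⁻ z, ‖f z‖ₑ ^ p ∂radialMeasure n W) ^ (q / p) := by
  obtain ⟨C₁, hC₁⟩ := rpow_enorm_le_lintegral_hypBall hn hr hr1
  obtain ⟨C₂, hC₂0, hC₂⟩ := exists_size_le_of_mem_hypBall (n := n) hW hr hr1
  obtain ⟨C₃, hC₃⟩ := lintegral_mul_smoothProfile_le hn hW
  obtain ⟨C₄, hC₄⟩ := size_mul_rpow_enorm_le hn hW
  set l : ℝ≥0 := (4 / (1 - r ^ 2)).toNNReal with hl
  have hl0 : l ≠ 0 := distortion_ne_zero hr hr1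
  -- The hypothesis p ≤ q enters here: the surplus exponent e is nonnegative, so (|f|^p)^e can be
  -- bounded above by the pointwise growth estimate.
  set e : ℝ := q / p - 1 with he
  have he0 : 0 ≤ e := by rw [he, sub_nonneg, one_le_div hp]; exact hpq
  have hqe : q = p * e + p := by rw [he]; field_simp; ring
  have hcoe : ∀ (x : ℝ≥0), ((x ^ e : ℝ≥0) : ℝ≥0∞) = (x : ℝ≥0∞) ^ e := fun x =>
    ENNReal.coe_rpow_of_nonneg x he0
  -- The constant involves neither μ nor M; compactness will use it for restrictions of μ near the
  -- sphere with M small.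
  refine ⟨C₄ ^ e * C₁ * C₂ ^ e * l ^ (n + 1) * C₃, fun μ M hM f hf => ?_⟩
  set P := ∫⁻ z, ‖f z‖ₑ ^ p ∂radialMeasure n W with hP
  -- Tonelli requires σ-finiteness, which the hypothesis on hyperbolic balls supplies.
  have hsig : SigmaFinite (μ.restrict (unitBall n)) := by
    refine sigmaFinite_restrict_unitBall hr ?_
    filter_upwards [hM, ae_restrict_mem isOpen_unitBall.measurableSet] with w hw hwB
    refine hw.trans_lt (ENNReal.mul_lt_top ENNReal.coe_lt_top ?_)
    exact ENNReal.rpow_lt_top_of_nonneg (by linarith [he]) (size_ne_top hW (mem_unitBall.1 hwB))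
  set fB := (unitBall n).indicator f with hfB
  have hfBm : Measurable fB := measurable_indicator_of_differentiableOn isOpen_unitBall hf
  have hsize : Measurable fun w : Cn n => size W w :=
    Measurable.mul (by fun_prop) ((measurable_mass W).comp measurable_norm)
  -- S(z) and 1-|z| are traded for their values at w ∈ D(z,r), so that z survives only in the
  -- relation w ∈ D(z,r), encoded by the jointly measurable set R.
  set k : Cn n → ℝ≥0∞ := fun w =>
    ‖fB w‖ₑ ^ p * ((size W w)⁻¹ ^ e * (ENNReal.ofReal (1 - ‖w‖))⁻¹ ^ (n + 1)) with hk
  have hkm : Measurable k := by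
    refine (hfBm.enorm.pow_const p).mul ((hsize.inv.pow_const e).mul ?_)
    exact Measurable.pow_const (Measurable.inv (by fun_prop)) _
  set R : Set (Cn n × Cn n) := {x | (‖x.1‖ < 1 ∧ ‖x.2‖ < 1) ∧
    (1 - r ^ 2) * ‖1 - inner ℂ x.1 x.2‖ ^ 2 < (1 - ‖x.1‖ ^ 2) * (1 - ‖x.2‖ ^ 2)} with hR
  have hRm : MeasurableSet R := by
    have h1 : IsOpen {x : Cn n × Cn n | ‖x.1‖ < 1 ∧ ‖x.2‖ < 1} :=
      (isOpen_lt (f := fun x : Cn n × Cn n => ‖x.1‖) (g := fun _ => 1) (by fun_prop)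
        (by fun_prop)).inter (isOpen_lt (f := fun x : Cn n × Cn n => ‖x.2‖) (g := fun _ => 1)
        (by fun_prop) (by fun_prop))
    have h2 : IsOpen {x : Cn n × Cn n |
        (1 - r ^ 2) * ‖1 - inner ℂ x.1 x.2‖ ^ 2 < (1 - ‖x.1‖ ^ 2) * (1 - ‖x.2‖ ^ 2)} :=
      isOpen_lt (by fun_prop) (by fun_prop)
    exact (h1.inter h2).measurableSet
  have hRiff : ∀ z w : Cn n, ‖z‖ < 1 → ((z, w) ∈ R ↔ w ∈ hypBall z r) := by
    intro z w hz
    rw [mem_hypBall_iff hz hr]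
    change ((‖z‖ < 1 ∧ ‖w‖ < 1) ∧ _) ↔ _
    simp [hz]
  have hpt : ∀ z ∈ unitBall n, ‖f z‖ₑ ^ q ≤ (C₄ * P) ^ e *
      (C₁ * C₂ ^ e * l ^ (n + 1) * ∫⁻ w, R.indicator (fun x => k x.2) (z, w) ∂haar n) := by
    intro z hzB
    have hz := mem_unitBall.1 hzB
    have hs0 := size_ne_zero hW hz
    have hst := size_ne_top hW hz
    have hd0 : ENNReal.ofReal (1 - ‖z‖) ≠ 0 := by simpa using hz
    have hm := measurableSet_hypBall (n := n) hz hr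
    have h1 : ‖f z‖ₑ ^ p ≤ (C₄ * P) * (size W z)⁻¹ := by
      rw [← div_eq_mul_inv, ENNReal.le_div_iff_mul_le (Or.inl hs0) (Or.inl hst), mul_comm]
      exact hC₄ f hf p hp z hz
    have h2 : ‖f z‖ₑ ^ p ≤ (ENNReal.ofReal (1 - ‖z‖))⁻¹ ^ (n + 1) *
        (C₁ * ∫⁻ w in hypBall z r, ‖f w‖ₑ ^ p ∂haar n) := by
      rw [← ENNReal.inv_pow, ← ENNReal.div_eq_inv_mul, ENNReal.le_div_iff_mul_le
        (Or.inl (pow_ne_zero _ hd0)) (Or.inl (by simp)), mul_comm]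
      exact hC₁ f hf p hp z hz
    have h3 : (size W z)⁻¹ ^ e * (ENNReal.ofReal (1 - ‖z‖))⁻¹ ^ (n + 1) ≠ ∞ :=
      ENNReal.mul_ne_top (ENNReal.rpow_ne_top_of_nonneg he0 (ENNReal.inv_ne_top.2 hs0))
        (ENNReal.pow_ne_top (ENNReal.inv_ne_top.2 hd0))
    calc ‖f z‖ₑ ^ q = (‖f z‖ₑ ^ p) ^ e * ‖f z‖ₑ ^ p := by
          rw [hqe, ENNReal.rpow_add_of_nonneg _ _ (mul_nonneg hp.le he0) hp.le, ENNReal.rpow_mul]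
      _ ≤ ((C₄ * P) * (size W z)⁻¹) ^ e * ((ENNReal.ofReal (1 - ‖z‖))⁻¹ ^ (n + 1) *
            (C₁ * ∫⁻ w in hypBall z r, ‖f w‖ₑ ^ p ∂haar n)) := by gcongr
      _ = (C₄ * P) ^ e * (C₁ * ∫⁻ w in hypBall z r, ((size W z)⁻¹ ^ e *
            (ENNReal.ofReal (1 - ‖z‖))⁻¹ ^ (n + 1)) * ‖f w‖ₑ ^ p ∂haar n) := by
          rw [ENNReal.mul_rpow_of_nonneg _ _ he0, lintegral_const_mul' _ _ h3]; ring
      _ ≤ (C₄ * P) ^ e * (C₁ * ∫⁻ w in hypBall z r, (C₂ ^ e * l ^ (n + 1)) * k w ∂haar n) := by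
          refine mul_le_mul' le_rfl (mul_le_mul' le_rfl (setLIntegral_mono' hm fun w hw => ?_))
          have h4 := inv_le_mul_inv_of_le_mul hC₂0 (hC₂ z w hz hw)
          have h5 := inv_le_mul_inv_of_le_mul hl0
            (ofReal_one_sub_norm_le_of_mem_hypBall hr hr1 hz hw)
          calc _ ≤ ((C₂ * (size W w)⁻¹) ^ e * (l * (ENNReal.ofReal (1 - ‖w‖))⁻¹) ^ (n + 1))
                * ‖f w‖ₑ ^ p := by gcongr
            _ = _ := by
              rw [ENNReal.mul_rpow_of_nonneg _ _ he0, mul_pow, hk]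
              simp only [hfB, indicator_of_mem hw.1]
              ring
      _ = (C₄ * P) ^ e * (C₁ * ((C₂ ^ e * l ^ (n + 1)) * ∫⁻ w in hypBall z r, k w ∂haar n)) := by
          rw [lintegral_const_mul _ hkm]
      _ = _ := by
          have : ∫⁻ w in hypBall z r, k w ∂haar n
              = ∫⁻ w, R.indicator (fun x => k x.2) (z, w) ∂haar n := by
            rw [← lintegral_indicator hm]
            refine lintegral_congr fun w => ?_
            by_cases hw : w ∈ hypBall z r
            · rw [indicator_of_mem hw, indicator_of_mem ((hRiff z w hz).2 hw)]
            · rw [indicator_of_notMem hw, indicator_of_notMem (fun h => hw ((hRiff z w hz).1 h))]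
          rw [this]; ring
  have hjoint : Measurable fun x : Cn n × Cn n => R.indicator (fun x => k x.2) x :=
    (hkm.comp measurable_snd).indicator hRm
  -- By symmetry the z-section of R at w is D(w,r), which is how μ(D(w,r)) appears.
  have hinner : ∀ w : Cn n, ∫⁻ z in unitBall n, R.indicator (fun x => k x.2) (z, w) ∂μ
      ≤ (unitBall n).indicator (fun w => k w * μ (hypBall w r)) w := by
    intro w
    by_cases hw : w ∈ unitBall n
    · have hw' := mem_unitBall.1 hw
      have hm := measurableSet_hypBall (n := n) hw' hr
      rw [indicator_of_mem hw, ← setLIntegral_const]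
      calc _ ≤ ∫⁻ z in unitBall n, (hypBall w r).indicator (fun _ => k w) z ∂μ := by
            refine setLIntegral_mono' isOpen_unitBall.measurableSet fun z hz => ?_
            have hz' := mem_unitBall.1 hz
            by_cases h : w ∈ hypBall z r
            · rw [indicator_of_mem ((hRiff z w hz').2 h),
                indicator_of_mem ((mem_hypBall_comm hz' hw' hr).1 h)]
            · rw [indicator_of_notMem (fun h' => h ((hRiff z w hz').1 h'))]
              exact zero_le
        _ ≤ ∫⁻ z, (hypBall w r).indicator (fun _ => k w) z ∂μ := setLIntegral_le_lintegral _ _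
        _ = _ := lintegral_indicator hm _
    · rw [indicator_of_notMem hw, nonpos_iff_eq_zero]
      have : ∀ z : Cn n, (z, w) ∉ R := fun z hz => hw (mem_unitBall.2 hz.1.2)
      simp [indicator_of_notMem (this _)]
  -- The powers balance: S^{-e}·S^{q/p} = S, and S(w)/(1-|w|)^{n+1} is the regularized profile.
  have hfinal : ∀ᵐ w ∂(haar n).restrict (unitBall n), k w * μ (hypBall w r)
      ≤ M * (‖f w‖ₑ ^ p * smoothProfile W ‖w‖) := by
    filter_upwards [hM, ae_restrict_mem isOpen_unitBall.measurableSet] with w hw hwB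
    have hw' := mem_unitBall.1 hwB
    have hs0 := size_ne_zero hW hw'
    have hst := size_ne_top hW hw'
    have hd0 : ENNReal.ofReal (1 - ‖w‖) ≠ 0 := by simpa using hw'
    have h1 : (size W w)⁻¹ ^ e * size W w ^ (q / p) = size W w := by
      rw [ENNReal.inv_rpow, ← ENNReal.rpow_neg, ← ENNReal.rpow_add _ _ hs0 hst, he]
      ring_nf
      exact ENNReal.rpow_one _
    have h2 : (ENNReal.ofReal (1 - ‖w‖))⁻¹ ^ (n + 1) * size W w = smoothProfile W ‖w‖ := by
      rw [← smoothProfile_mul_pow hw', mul_left_comm, ← mul_pow,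
        ENNReal.inv_mul_cancel hd0 ENNReal.ofReal_ne_top, one_pow, mul_one]
    calc k w * μ (hypBall w r) ≤ k w * (M * size W w ^ (q / p)) := by gcongr
      _ = M * (‖f w‖ₑ ^ p * ((ENNReal.ofReal (1 - ‖w‖))⁻¹ ^ (n + 1) *
            ((size W w)⁻¹ ^ e * size W w ^ (q / p)))) := by
          simp only [hk, hfB, indicator_of_mem hwB]; ring
      _ = _ := by rw [h1, h2]
  calc ∫⁻ z in unitBall n, ‖f z‖ₑ ^ q ∂μ
      ≤ ∫⁻ z in unitBall n, (C₄ * P) ^ e * (C₁ * C₂ ^ e * l ^ (n + 1) *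
          ∫⁻ w, R.indicator (fun x => k x.2) (z, w) ∂haar n) ∂μ :=
        setLIntegral_mono' isOpen_unitBall.measurableSet hpt
    _ = (C₄ * P) ^ e * (C₁ * C₂ ^ e * l ^ (n + 1) * ∫⁻ z in unitBall n,
          (∫⁻ w, R.indicator (fun x => k x.2) (z, w) ∂haar n) ∂μ) := by
        have hm1 : Measurable fun z : Cn n => ∫⁻ w, R.indicator (fun x => k x.2) (z, w) ∂haar n :=
          hjoint.lintegral_prod_right'
        rw [lintegral_const_mul _ (hm1.const_mul _), lintegral_const_mul _ hm1]
    _ = (C₄ * P) ^ e * (C₁ * C₂ ^ e * l ^ (n + 1) * ∫⁻ w,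
          (∫⁻ z in unitBall n, R.indicator (fun x => k x.2) (z, w) ∂μ) ∂haar n) := by
        rw [lintegral_lintegral_swap (μ := μ.restrict (unitBall n)) (ν := haar n)
          (f := fun z w => R.indicator (fun x => k x.2) (z, w)) hjoint.aemeasurable]
    _ ≤ (C₄ * P) ^ e * (C₁ * C₂ ^ e * l ^ (n + 1) *
          ∫⁻ w in unitBall n, k w * μ (hypBall w r) ∂haar n) := by
        rw [← lintegral_indicator isOpen_unitBall.measurableSet]
        exact mul_le_mul' le_rfl (mul_le_mul' le_rfl (lintegral_mono hinner))
    _ ≤ (C₄ * P) ^ e * (C₁ * C₂ ^ e * l ^ (n + 1) *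
          ∫⁻ w in unitBall n, M * (‖f w‖ₑ ^ p * smoothProfile W ‖w‖) ∂haar n) :=
        mul_le_mul' le_rfl (mul_le_mul' le_rfl (lintegral_mono_ae hfinal))
    _ ≤ (C₄ * P) ^ e * (C₁ * C₂ ^ e * l ^ (n + 1) * (M * (C₃ * P))) := by
        rw [lintegral_const_mul' _ _ ENNReal.coe_ne_top]
        gcongr
        exact hC₃ f hf p hp
    _ = _ := by
        rw [ENNReal.mul_rpow_of_nonneg _ _ he0, show q / p = e + 1 by rw [he]; ring,
          ENNReal.rpow_add_of_nonneg _ _ he0 zero_le_one, ENNReal.rpow_one]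
        push_cast
        rw [hcoe, hcoe]
        ring

end

section

/-! ### Test functions -/

variable {n : ℕ} {W : ℝ → ℝ≥0∞} {A B : ℝ≥0} {K : ℝ}

/-- The test function `((1 - |a|) / (1 - ⟨z, a⟩))^N`. -/
def testFun (a : Cn n) (N : ℕ) (z : Cn n) : ℂ := (((1 - ‖a‖ : ℝ) : ℂ) / (1 - inner ℂ a z)) ^ N

theorem norm_testFun {a : Cn n} (ha : ‖a‖ < 1) (N : ℕ) (z : Cn n) :
    ‖testFun a N z‖ = kernelRatio a z ^ N := by
  rw [testFun, norm_pow, norm_div, Complex.norm_real, Real.norm_of_nonneg (sub_pos.2 ha).le,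
    kernelRatio]

theorem enorm_testFun_rpow {a : Cn n} (ha : ‖a‖ < 1) (N : ℕ) (z : Cn n) {p : ℝ} (hp : 0 ≤ p) :
    ‖testFun a N z‖ₑ ^ p = ENNReal.ofReal (kernelRatio a z ^ (N * p)) := by
  have h0 := kernelRatio_nonneg ha z
  rw [← ofReal_norm, norm_testFun ha, ENNReal.ofReal_rpow_of_nonneg (by positivity) hp,
    Real.rpow_mul h0, Real.rpow_natCast]

theorem differentiableOn_testFun {a : Cn n} (ha : ‖a‖ < 1) (N : ℕ) :
    DifferentiableOn ℂ (testFun a N) (unitBall n) := by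
  have hin : Differentiable ℂ fun z : Cn n => (inner ℂ a z : ℂ) := (innerSL ℂ a).differentiable
  have hinv : DifferentiableOn ℂ (fun z : Cn n => (1 - inner ℂ a z : ℂ)⁻¹) (unitBall n) :=
    DifferentiableOn.inv ((differentiable_const _).sub hin).differentiableOn fun z hz =>
      norm_pos_iff.1 (norm_one_sub_inner_pos ha (mem_unitBall.1 hz).le)
  have hdiv : DifferentiableOn ℂ (fun z : Cn n => ((1 - ‖a‖ : ℝ) : ℂ) / (1 - inner ℂ a z))
      (unitBall n) := by
    simp_rw [div_eq_mul_inv]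
    exact (differentiableOn_const _).mul hinv
  exact hdiv.pow N

theorem kernelRatio_ge_of_mem_hypBall {a z : Cn n} {r : ℝ} (ha : ‖a‖ < 1) (hr : 0 < r)
    (hr1 : r < 1) (hz : z ∈ hypBall a r) : (1 - r ^ 2) / 4 ≤ kernelRatio a z := by
  have h1 := norm_one_sub_inner_le_of_mem_hypBall ha hr hr1 hz
  have h2 := norm_one_sub_inner_pos ha (mem_unitBall.1 hz.1).le
  have hr2 : 0 < 1 - r ^ 2 := by nlinarith
  rw [kernelRatio, le_div_iff₀ h2]
  rw [div_mul_eq_mul_div, lt_div_iff₀ hr2] at h1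
  linarith

theorem measure_hypBall_le_lintegral_testFun {a : Cn n} {r : ℝ} (ha : ‖a‖ < 1) (hr : 0 < r)
    (hr1 : r < 1) (N : ℕ) {q : ℝ} (hq : 0 ≤ q) (μ : Measure (Cn n)) :
    ENNReal.ofReal (((1 - r ^ 2) / 4) ^ (N * q)) * μ (hypBall a r)
      ≤ ∫⁻ z in unitBall n, ‖testFun a N z‖ₑ ^ q ∂μ := by
  have hr2 : 0 < (1 - r ^ 2) / 4 := by nlinarith
  have hm := measurableSet_hypBall (n := n) ha hr
  rw [← setLIntegral_const]
  refine (setLIntegral_mono' hm fun z hz => ?_).trans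
    (lintegral_mono_set (hypBall_subset_unitBall a r))
  rw [enorm_testFun_rpow ha N z hq]
  gcongr
  exact kernelRatio_ge_of_mem_hypBall ha hr hr1 hz

/-- The last bound follows from |1-⟨z,a⟩| ≤ 2: the kernel is at least (1-|a|)/2 on the whole ball,
so its integral dominates a multiple of (1-|a|)^{m₀}. It serves to show that normalized test
functions tend to 0 pointwise. -/
theorem exists_exponent (hn : 1 ≤ n) (hW : IsDoublingProfile W A B K) :
    ∃ m₀ : ℝ, 0 ≤ m₀ ∧
      (∀ m : ℝ, m₀ ≤ m → ∃ C : ℝ≥0, ∀ a : Cn n, ‖a‖ < 1 →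
        ∫⁻ z, ENNReal.ofReal (kernelRatio a z ^ m) ∂radialMeasure n W ≤ C * size W a) ∧
      ∃ C : ℝ≥0, ∀ a : Cn n, ‖a‖ < 1 → ENNReal.ofReal (1 - ‖a‖) ^ m₀ ≤ C * size W a := by
  obtain ⟨m₀, hm₀, h⟩ := lintegral_kernelRatio_le hn hW
  refine ⟨m₀, hm₀, h, ?_⟩
  obtain ⟨C, hC⟩ := h m₀ le_rfl
  obtain ⟨C', hC'⟩ := size_le_radialMeasure_hypBall hn hW
  set b := radialMeasure n W (unitBall n) with hb
  have h0 : ‖(0 : Cn n)‖ < 1 := by simp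
  have hb0 : b ≠ 0 := by
    intro hb0
    have h1 := hC' 0 h0
    rw [measure_mono_null (hypBall_subset_unitBall _ _) hb0, mul_zero, nonpos_iff_eq_zero] at h1
    exact size_ne_zero hW h0 h1
  have hbt : (2 : ℝ≥0∞)⁻¹ ^ m₀ * b ≠ 0 := by
    refine mul_ne_zero ?_ hb0
    rw [ENNReal.inv_rpow]
    simp
  refine ⟨C * ((2 : ℝ≥0∞)⁻¹ ^ m₀ * b)⁻¹.toNNReal, fun a ha => ?_⟩
  have hd : 0 < 1 - ‖a‖ := sub_pos.2 ha
  have key : ENNReal.ofReal (1 - ‖a‖) ^ m₀ * ((2 : ℝ≥0∞)⁻¹ ^ m₀ * b) ≤ C * size W a := by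
    refine le_trans ?_ (hC a ha)
    rw [← mul_assoc, ← ENNReal.mul_rpow_of_nonneg _ _ hm₀, hb, ← setLIntegral_const]
    refine (setLIntegral_mono' isOpen_unitBall.measurableSet fun z hz => ?_).trans
      (setLIntegral_le_lintegral _ _)
    have hz' := mem_unitBall.1 hz
    have h2 : (1 - ‖a‖) * 2⁻¹ ≤ kernelRatio a z := by
      have h3 := norm_one_sub_inner_pos ha hz'.le
      rw [kernelRatio, le_div_iff₀ h3]
      have h4 : ‖1 - inner ℂ a z‖ ≤ 2 := by
        refine (norm_sub_le _ _).trans ?_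
        have := norm_inner_le_norm (𝕜 := ℂ) a z
        rw [norm_one]
        nlinarith [norm_nonneg a, norm_nonneg z]
      nlinarith
    rw [← ENNReal.ofReal_rpow_of_nonneg (kernelRatio_nonneg ha z) hm₀]
    gcongr
    refine le_trans (le_of_eq ?_) (ENNReal.ofReal_le_ofReal h2)
    rw [ENNReal.ofReal_mul hd.le, ENNReal.ofReal_inv_of_pos two_pos, ENNReal.ofReal_ofNat]
  rcases eq_or_ne b ∞ with hbtop | hbtop
  -- Infinite total mass is excluded by the bound `key` itself, whose right side is finite.
  · exfalso
    rw [hbtop, ENNReal.mul_top (by rw [ENNReal.inv_rpow]; simp), ENNReal.mul_top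
      (by rw [Ne, ENNReal.rpow_eq_zero_iff]; simp [ha, hm₀.not_gt]), top_le_iff] at key
    exact ENNReal.mul_ne_top ENNReal.coe_ne_top (size_ne_top hW ha) key
  · have htop : (2 : ℝ≥0∞)⁻¹ ^ m₀ * b ≠ ∞ :=
      ENNReal.mul_ne_top (ENNReal.rpow_ne_top_of_nonneg hm₀ (by simp)) hbtop
    rw [ENNReal.coe_mul, ENNReal.coe_toNNReal (ENNReal.inv_ne_top.2 hbt), mul_right_comm,
      ← div_eq_mul_inv, ENNReal.le_div_iff_mul_le (Or.inl hbt) (Or.inl htop)]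
    exact key

/-! ### Extraction of pointwise convergent subsequences -/

/-- Schwarz's lemma for l ↦ f(z+l(w-z)) on |l| < ρ/|w-z|, evaluated at l = 1. It provides
equicontinuity of bounded families. The +1 makes the image lie in an open ball. -/
theorem norm_sub_le_of_bounded {f : Cn n → ℂ} (hf : DifferentiableOn ℂ f (unitBall n)) {z w : Cn n}
    {ρ M : ℝ} (hρ : 0 < ρ) (hzρ : ‖z‖ + ρ < 1) (hM : ∀ x : Cn n, ‖x‖ ≤ ‖z‖ + ρ → ‖f x‖ ≤ M)
    (hw : ‖w - z‖ < ρ) : ‖f w - f z‖ ≤ (2 * M + 1) / ρ * ‖w - z‖ := by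
  rcases eq_or_ne w z with rfl | hne
  · simp
  have hpos : 0 < ‖w - z‖ := norm_pos_iff.2 (sub_ne_zero.2 hne)
  set R := ρ / ‖w - z‖ with hR
  have hR0 : 0 < R := by positivity
  have hin : ∀ l ∈ Metric.ball (0 : ℂ) R, ‖z + l • (w - z)‖ ≤ ‖z‖ + ρ := by
    intro l hl
    have hl' : ‖l‖ < R := by simpa using hl
    refine (norm_add_le _ _).trans ?_
    rw [norm_smul]
    rw [hR, lt_div_iff₀ hpos] at hl'
    linarith
  have han := analyticOnNhd_slice isOpen_unitBall hf (w - z) z (S := Metric.ball (0 : ℂ) R)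
    (fun l hl => mem_unitBall.2 ((hin l hl).trans_lt hzρ))
  have hd := han.differentiableOn
  have h0 : (fun l : ℂ => f (z + l • (w - z))) 0 = f z := by simp
  have hmaps : MapsTo (fun l : ℂ => f (z + l • (w - z))) (Metric.ball 0 R)
      (Metric.ball ((fun l : ℂ => f (z + l • (w - z))) 0) (2 * M + 1)) := by
    intro l hl
    rw [h0, Metric.mem_ball, dist_eq_norm]
    have h1 := hM _ (hin l hl)
    have h2 := hM z (by linarith)
    have := norm_sub_le (f (z + l • (w - z))) (f z)
    linarith
  have h1 : (1 : ℂ) ∈ Metric.ball (0 : ℂ) R := by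
    rw [mem_ball_zero_iff, norm_one, hR, one_lt_div hpos]
    exact hw
  have := Complex.dist_le_div_mul_dist_of_mapsTo_ball hd
    (hmaps.mono_right Metric.ball_subset_closedBall) h1
  simp only [zero_smul, add_zero, one_smul, add_sub_cancel, dist_eq_norm, sub_zero, norm_one, mul_one] at this
  refine this.trans (le_of_eq ?_)
  rw [hR]
  field_simp

/-- Montel's argument: compactness of a countable product of discs gives convergence along a dense
sequence, and equicontinuity spreads it to the whole ball. Holomorphy of the limit is not needed
later. -/
theorem exists_subseq_tendsto_pointwise {f : ℕ → Cn n → ℂ}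
    (hf : ∀ k, DifferentiableOn ℂ (f k) (unitBall n))
    (hb : ∀ u : ℝ, u < 1 → ∃ M : ℝ, ∀ k, ∀ z : Cn n, ‖z‖ ≤ u → ‖f k z‖ ≤ M) :
    ∃ φ : ℕ → ℕ, StrictMono φ ∧ ∃ g : Cn n → ℂ, ∀ z ∈ unitBall n,
      Tendsto (fun k => f (φ k) z) atTop (𝓝 (g z)) := by
  classical
  set x := TopologicalSpace.denseSeq (Cn n)
  have hx : DenseRange x := TopologicalSpace.denseRange_denseSeq _
  have hbj : ∀ j : ℕ, ∃ M : ℝ, ∀ k, ‖(unitBall n).indicator (f k) (x j)‖ ≤ M := by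
    intro j
    by_cases hj : x j ∈ unitBall n
    · obtain ⟨M, hM⟩ := hb ‖x j‖ (mem_unitBall.1 hj)
      exact ⟨M, fun k => by rw [indicator_of_mem hj]; exact hM k _ le_rfl⟩
    · exact ⟨0, fun k => by rw [indicator_of_notMem hj, norm_zero]⟩
  choose M hM using hbj
  have hcomp : IsCompact (Set.pi univ fun j : ℕ => Metric.closedBall (0 : ℂ) (M j)) :=
    isCompact_univ_pi fun j => isCompact_closedBall _ _
  obtain ⟨a, -, φ, hφ, hlim⟩ := hcomp.tendsto_subseq
    (x := fun k => fun j => (unitBall n).indicator (f k) (x j))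
    (fun k => fun j _ => by simpa using hM j k)
  rw [tendsto_pi_nhds] at hlim
  have hcauchy : ∀ z ∈ unitBall n, ∃ c : ℂ, Tendsto (fun k => f (φ k) z) atTop (𝓝 c) := by
    intro z hz
    have hz' := mem_unitBall.1 hz
    apply cauchySeq_tendsto_of_complete
    set ρ := (1 - ‖z‖) / 2 with hρ
    have hρ0 : 0 < ρ := by rw [hρ]; linarith
    have hzρ : ‖z‖ + ρ < 1 := by rw [hρ]; linarith
    obtain ⟨M', hM'⟩ := hb (‖z‖ + ρ) hzρ
    have hM'0 : 0 ≤ M' := (norm_nonneg _).trans (hM' 0 z (by linarith))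
    rw [Metric.cauchySeq_iff']
    intro ε hε
    set δ := min ρ (ε / 4 / ((2 * M' + 1) / ρ)) with hδ
    have hδ0 : 0 < δ := lt_min hρ0 (by positivity)
    obtain ⟨j, hj⟩ := hx.exists_dist_lt z hδ0
    rw [dist_comm, dist_eq_norm] at hj
    have hjB : x j ∈ unitBall n := by
      rw [mem_unitBall]
      have h1 : ‖x j‖ ≤ ‖z‖ + ‖x j - z‖ := by simpa using norm_add_le z (x j - z)
      have h2 : δ ≤ ρ := min_le_left _ _
      linarith
    have hclose : ∀ k, ‖f k (x j) - f k z‖ < ε / 4 + ε / 100 := by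
      intro k
      have h1 := norm_sub_le_of_bounded (hf k) hρ0 hzρ (hM' k) (hj.trans_le (min_le_left _ _))
      have h2 : (2 * M' + 1) / ρ * ‖x j - z‖ ≤ (2 * M' + 1) / ρ * (ε / 4 / ((2 * M' + 1) / ρ)) := by
        gcongr
        exact hj.le.trans (min_le_right _ _)
      rw [mul_div_cancel₀ _ (by positivity)] at h2
      linarith
    have hcj := (hlim j).cauchySeq
    simp only [Function.comp_apply, indicator_of_mem hjB] at hcj
    rw [Metric.cauchySeq_iff'] at hcj
    obtain ⟨N, hN⟩ := hcj (ε / 4) (by positivity)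
    refine ⟨N, fun k hk => ?_⟩
    have h1 := hN k hk
    rw [dist_eq_norm] at h1 ⊢
    have e : f (φ k) z - f (φ N) z = -(f (φ k) (x j) - f (φ k) z)
        + (f (φ k) (x j) - f (φ N) (x j)) + (f (φ N) (x j) - f (φ N) z) := by ring
    rw [e]
    have h2 := hclose (φ k)
    have h3 := hclose (φ N)
    have h4 := norm_add₃_le (a := -(f (φ k) (x j) - f (φ k) z))
      (b := f (φ k) (x j) - f (φ N) (x j)) (c := f (φ N) (x j) - f (φ N) z)
    rw [norm_neg] at h4
    linarith
  choose! g hg using hcauchy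
  exact ⟨φ, hφ, g, hg⟩

end

section

/-! ### Carleson measures -/

variable {n : ℕ} {W : ℝ → ℝ≥0∞} {A B : ℝ≥0} {K : ℝ}

theorem lintegral_rpow_eq_eLpNorm_rpow {f : Cn n → ℂ} {p : ℝ} (hp : 0 < p) (μ : Measure (Cn n)) :
    ∫⁻ z, ‖f z‖ₑ ^ p ∂μ = eLpNorm f (ENNReal.ofReal p) μ ^ p := by
  rw [eLpNorm_eq_lintegral_rpow_enorm_toReal (by simpa using hp) ENNReal.ofReal_ne_top,
    ENNReal.toReal_ofReal hp.le, ← ENNReal.rpow_mul, one_div, inv_mul_cancel₀ hp.ne',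
    ENNReal.rpow_one]

theorem aestronglyMeasurable_of_differentiableOn {f : Cn n → ℂ}
    (hf : DifferentiableOn ℂ f (unitBall n)) (μ : Measure (Cn n)) :
    AEStronglyMeasurable f (μ.restrict (unitBall n)) :=
  hf.continuousOn.aestronglyMeasurable isOpen_unitBall.measurableSet

theorem exists_eLpNorm_le_of_measure_hypBall_le (hn : 1 ≤ n) (hW : IsDoublingProfile W A B K)
    {r : ℝ} (hr : 0 < r) (hr1 : r < 1) {p q : ℝ} (hp : 0 < p) (hpq : p ≤ q) :
    ∃ C : ℝ≥0, ∀ μ : Measure (Cn n), ∀ M : ℝ≥0,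
      (∀ᵐ w ∂(haar n).restrict (unitBall n), μ (hypBall w r) ≤ M * size W w ^ (q / p)) →
      ∀ f : Cn n → ℂ, DifferentiableOn ℂ f (unitBall n) →
        eLpNorm f (ENNReal.ofReal q) (μ.restrict (unitBall n))
          ≤ ((C * M) ^ (1 / q) : ℝ≥0) * eLpNorm f (ENNReal.ofReal p) (radialMeasure n W) := by
  obtain ⟨C, hC⟩ := lintegral_rpow_le_of_measure_hypBall_le hn hW hr hr1 hp hpq
  have hq : 0 < q := hp.trans_le hpq
  refine ⟨C, fun μ M hM f hf => ?_⟩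
  have h := hC μ M hM f hf
  rw [lintegral_rpow_eq_eLpNorm_rpow hp, lintegral_rpow_eq_eLpNorm_rpow hq, ← ENNReal.rpow_mul,
    mul_div_cancel₀ _ hp.ne'] at h
  rw [← ENNReal.rpow_le_rpow_iff hq, ENNReal.mul_rpow_of_nonneg _ _ hq.le,
    ENNReal.coe_rpow_of_nonneg _ (by positivity), ← ENNReal.rpow_mul, one_div,
    inv_mul_cancel₀ hq.ne', ENNReal.rpow_one, ENNReal.coe_mul]
  exact h

/-- The hyperbolic mean is comparable to the mean taken with respect to `size`. -/
theorem exists_weightedMean_comparison (hn : 1 ≤ n) (hW : IsDoublingProfile W A B K) {ω : ℝ → ℝ}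
    (hω : weightMeasure n ω = radialMeasure n W) {r : ℝ} (hr : threshold K ≤ r) (hr1 : r < 1)
    {s : ℝ} (hs : 0 ≤ s) :
    ∃ C : ℝ≥0, C ≠ 0 ∧ ∀ (μ : Measure (Cn n)) (z : Cn n), ‖z‖ < 1 →
      μ (hypBall z r) ≤ C * weightedMean ω μ r s z * size W z ^ s ∧
      ∀ M : ℝ≥0∞, μ (hypBall z r) ≤ M * size W z ^ s → weightedMean ω μ r s z ≤ C * M := by
  have hr0 : 0 < r := (threshold_mem hW.one_lt).1.trans_le hr
  obtain ⟨C₁, hC₁⟩ := radialMeasure_hypBall_le hn hW hr0 hr1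
  obtain ⟨C₂, hC₂⟩ := size_le_radialMeasure_hypBall hn hW
  refine ⟨C₁ ^ s + C₂ ^ s + 1, by positivity, fun μ z hz => ?_⟩
  have hs0 := size_ne_zero hW hz
  have hst := size_ne_top hW hz
  set m := radialMeasure n W (hypBall z r) with hm
  have h1 : m ≤ C₁ * size W z := hC₁ z hz
  have h2 : size W z ≤ C₂ * m := (hC₂ z hz).trans (by gcongr; exact measure_mono (hypBall_mono hr))
  have hm0 : m ≠ 0 := fun h => hs0 (by rw [h, mul_zero] at h2; exact nonpos_iff_eq_zero.1 h2)
  have hmt : m ≠ ∞ := ne_top_of_le_ne_top (ENNReal.mul_ne_top ENNReal.coe_ne_top hst) h1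
  have hms0 : m ^ s ≠ 0 := by
    rw [Ne, ENNReal.rpow_eq_zero_iff]
    simp [hm0, hmt]
  have hmst : m ^ s ≠ ∞ := ENNReal.rpow_ne_top_of_nonneg hs hmt
  have h1s : m ^ s ≤ C₁ ^ s * size W z ^ s := by
    rw [← ENNReal.mul_rpow_of_nonneg _ _ hs]; gcongr
  have h2s : size W z ^ s ≤ C₂ ^ s * m ^ s := by
    rw [← ENNReal.mul_rpow_of_nonneg _ _ hs]; gcongr
  have hwm : weightedMean ω μ r s z = μ (hypBall z r) / m ^ s := by rw [weightedMean, hω]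
  rw [hwm]
  push_cast
  rw [ENNReal.coe_rpow_of_nonneg _ hs, ENNReal.coe_rpow_of_nonneg _ hs]
  constructor
  · calc μ (hypBall z r) = μ (hypBall z r) / m ^ s * m ^ s :=
          (ENNReal.div_mul_cancel hms0 hmst).symm
      _ ≤ μ (hypBall z r) / m ^ s * (C₁ ^ s * size W z ^ s) := by gcongr
      _ = C₁ ^ s * (μ (hypBall z r) / m ^ s) * size W z ^ s := by ring
      _ ≤ _ := by
        gcongr
        rw [add_assoc]
        exact le_self_add
  · intro M hM
    rw [ENNReal.div_le_iff hms0 hmst]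
    calc μ (hypBall z r) ≤ M * (C₂ ^ s * m ^ s) := hM.trans (by gcongr)
      _ = C₂ ^ s * M * m ^ s := by ring
      _ ≤ _ := by
        gcongr
        exact le_add_right le_add_self

/-- An essential supremum controls only almost every centre. That is enough, since the embedding
integrates over centres with respect to Lebesgue measure. -/
theorem measure_hypBall_le_of_meanBounded (hn : 1 ≤ n) (hW : IsDoublingProfile W A B K) {ω : ℝ → ℝ}
    (hω : weightMeasure n ω = radialMeasure n W) {r : ℝ} (hr : threshold K ≤ r) (hr1 : r < 1)
    {s : ℝ} (hs : 0 ≤ s) {μ : Measure (Cn n)} (h : MeanBounded ω μ r s) :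
    ∃ M : ℝ≥0, ∀ᵐ w ∂(haar n).restrict (unitBall n), μ (hypBall w r) ≤ M * size W w ^ s := by
  obtain ⟨C, -, hC⟩ := exists_weightedMean_comparison hn hW hω hr hr1 hs
  refine ⟨C * (essSup (weightedMean ω μ r s) (vol n)).toNNReal, ?_⟩
  have h1 : ∀ᵐ w ∂vol n, weightedMean ω μ r s w ≤ essSup (weightedMean ω μ r s) (vol n) :=
    ENNReal.ae_le_essSup _
  rw [ae_vol_iff] at h1
  filter_upwards [h1, ae_restrict_mem isOpen_unitBall.measurableSet] with w hw hwB
  refine ((hC μ w (mem_unitBall.1 hwB)).1).trans ?_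
  rw [ENNReal.coe_mul, ENNReal.coe_toNNReal (ne_of_lt h)]
  gcongr

theorem meanBounded_of_measure_hypBall_le (hn : 1 ≤ n) (hW : IsDoublingProfile W A B K) {ω : ℝ → ℝ}
    (hω : weightMeasure n ω = radialMeasure n W) {r : ℝ} (hr : threshold K ≤ r) (hr1 : r < 1)
    {s : ℝ} (hs : 0 ≤ s) {μ : Measure (Cn n)} {M : ℝ≥0}
    (h : ∀ w : Cn n, ‖w‖ < 1 → μ (hypBall w r) ≤ M * size W w ^ s) : MeanBounded ω μ r s := by
  obtain ⟨C, -, hC⟩ := exists_weightedMean_comparison hn hW hω hr hr1 hs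
  refine lt_of_le_of_lt (essSup_le_of_ae_le ((C * M : ℝ≥0) : ℝ≥0∞) ?_) ENNReal.coe_lt_top
  refine ae_vol_iff.2 ?_
  filter_upwards [ae_restrict_mem isOpen_unitBall.measurableSet] with w hwB
  have hw := mem_unitBall.1 hwB
  push_cast
  exact (hC μ w hw).2 M (h w hw)

theorem isCarleson_of_measure_hypBall_le (hn : 1 ≤ n) (hW : IsDoublingProfile W A B K) {ω : ℝ → ℝ}
    (hω : weightMeasure n ω = radialMeasure n W) {r : ℝ} (hr : 0 < r) (hr1 : r < 1) {p q : ℝ}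
    (hp : 0 < p) (hpq : p ≤ q) {μ : Measure (Cn n)} {M : ℝ≥0}
    (h : ∀ᵐ w ∂(haar n).restrict (unitBall n), μ (hypBall w r) ≤ M * size W w ^ (q / p)) :
    IsCarleson n ω p q μ := by
  obtain ⟨C, hC⟩ := exists_eLpNorm_le_of_measure_hypBall_le hn hW hr hr1 hp hpq
  constructor
  · rintro f ⟨hf, hfp⟩
    refine ⟨aestronglyMeasurable_of_differentiableOn hf μ, (hC μ M h f hf).trans_lt ?_⟩
    rw [hω] at hfp
    exact ENNReal.mul_lt_top ENNReal.coe_lt_top hfp.2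
  · refine ⟨(C * M) ^ (1 / q), fun f hf => ?_⟩
    rw [bergmanNorm, hω]
    exact hC μ M h f hf.1

theorem testFun_mem_bergmanSpace (hW : IsDoublingProfile W A B K) {ω : ℝ → ℝ}
    (hω : weightMeasure n ω = radialMeasure n W) {p : ℝ} (hp : 0 < p) {N : ℕ} {C : ℝ≥0}
    (hC : ∀ a : Cn n, ‖a‖ < 1 →
      ∫⁻ z, ENNReal.ofReal (kernelRatio a z ^ (N * p)) ∂radialMeasure n W ≤ C * size W a)
    {a : Cn n} (ha : ‖a‖ < 1) :
    testFun a N ∈ bergmanSpace n ω p ∧ bergmanNorm n ω p (testFun a N) ^ p ≤ C * size W a := by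
  have hd := differentiableOn_testFun ha N
  have hnorm : bergmanNorm n ω p (testFun a N) ^ p ≤ C * size W a := by
    rw [bergmanNorm, hω, ← lintegral_rpow_eq_eLpNorm_rpow hp]
    simp_rw [enorm_testFun_rpow ha N _ hp.le]
    exact hC a ha
  refine ⟨⟨hd, ?_, ?_⟩, hnorm⟩
  · rw [hω, radialMeasure]
    refine AEStronglyMeasurable.mono_ac (withDensity_absolutelyContinuous _ _) ?_
    rw [vol_eq]
    exact (aestronglyMeasurable_of_differentiableOn hd _).smul_measure _
  · have h1 : bergmanNorm n ω p (testFun a N) ^ p < ∞ :=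
      hnorm.trans_lt (ENNReal.mul_lt_top ENNReal.coe_lt_top (size_ne_top hW ha).lt_top)
    exact (ENNReal.rpow_lt_top_iff_of_pos hp).1 h1

theorem measure_hypBall_le_of_isCarleson (hn : 1 ≤ n) (hW : IsDoublingProfile W A B K) {ω : ℝ → ℝ}
    (hω : weightMeasure n ω = radialMeasure n W) {r : ℝ} (hr : 0 < r) (hr1 : r < 1) {p q : ℝ}
    (hp : 0 < p) (hpq : p ≤ q) {μ : Measure (Cn n)} (h : IsCarleson n ω p q μ) :
    ∃ M : ℝ≥0, ∀ w : Cn n, ‖w‖ < 1 → μ (hypBall w r) ≤ M * size W w ^ (q / p) := by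
  have hq : 0 < q := hp.trans_le hpq
  obtain ⟨m₀, -, hm, -⟩ := exists_exponent hn hW
  -- N is chosen with Np ≥ m₀, so that the p-th power of the test function falls under the kernel
  -- estimate.
  obtain ⟨N, hN⟩ := exists_nat_ge (m₀ / p)
  rw [div_le_iff₀ hp] at hN
  obtain ⟨C, hC⟩ := hm _ hN
  obtain ⟨-, D, hD⟩ := h
  set c := ENNReal.ofReal (((1 - r ^ 2) / 4) ^ (N * q)) with hc
  have hr2 : 0 < (1 - r ^ 2) / 4 := by nlinarith
  have hc0 : c ≠ 0 := by
    rw [hc, ENNReal.ofReal_ne_zero_iff]; exact Real.rpow_pos_of_pos hr2 _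
  refine ⟨c⁻¹.toNNReal * (D ^ q * C ^ (q / p)), fun a ha => ?_⟩
  obtain ⟨hmem, hnorm⟩ := testFun_mem_bergmanSpace hW hω hp hC ha
  have h1 := measure_hypBall_le_lintegral_testFun ha hr hr1 N hq.le μ
  rw [lintegral_rpow_eq_eLpNorm_rpow hq] at h1
  have h2 : bergmanNorm n ω p (testFun a N) ^ q ≤ (C * size W a) ^ (q / p) := by
    calc _ = (bergmanNorm n ω p (testFun a N) ^ p) ^ (q / p) := by
          rw [← ENNReal.rpow_mul, mul_div_cancel₀ _ hp.ne']
      _ ≤ _ := by gcongr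
  have h3 : c * μ (hypBall a r) ≤ D ^ q * (C * size W a) ^ (q / p) := by
    calc _ ≤ eLpNorm (testFun a N) (ENNReal.ofReal q) (μ.restrict (unitBall n)) ^ q := h1
      _ ≤ (D * bergmanNorm n ω p (testFun a N)) ^ q := by gcongr; exact hD _ hmem
      _ = D ^ q * bergmanNorm n ω p (testFun a N) ^ q := ENNReal.mul_rpow_of_nonneg _ _ hq.le
      _ ≤ _ := by gcongr
  have hqp : 0 ≤ q / p := by positivity
  push_cast
  rw [ENNReal.coe_toNNReal (ENNReal.inv_ne_top.2 hc0), ENNReal.coe_rpow_of_nonneg _ hq.le,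
    ENNReal.coe_rpow_of_nonneg _ hqp]
  calc μ (hypBall a r) = c⁻¹ * (c * μ (hypBall a r)) := by
        rw [← mul_assoc, ENNReal.inv_mul_cancel hc0 ENNReal.ofReal_ne_top, one_mul]
    _ ≤ c⁻¹ * (D ^ q * (C * size W a) ^ (q / p)) := by gcongr
    _ = _ := by rw [ENNReal.mul_rpow_of_nonneg _ _ hqp]; ring

end

section

/-! ### Vanishing Carleson measures -/

variable {n : ℕ} {W : ℝ → ℝ≥0∞} {A B : ℝ≥0} {K : ℝ}

theorem meanVanishes_iff (hn : 1 ≤ n) (hW : IsDoublingProfile W A B K) {ω : ℝ → ℝ}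
    (hω : weightMeasure n ω = radialMeasure n W) {r : ℝ} (hr : threshold K ≤ r) (hr1 : r < 1)
    {s : ℝ} (hs : 0 ≤ s) {μ : Measure (Cn n)} :
    MeanVanishes ω μ r s ↔ ∀ ε : ℝ≥0, ε ≠ 0 → ∃ R < 1, ∀ w : Cn n, R < ‖w‖ → ‖w‖ < 1 →
      μ (hypBall w r) ≤ ε * size W w ^ s := by
  obtain ⟨C, hC0, hC⟩ := exists_weightedMean_comparison (n := n) hn hW hω hr hr1 hs
  have hC0' : (C : ℝ≥0∞) ≠ 0 := by simpa using hC0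
  have hiff : MeanVanishes ω μ r s ↔ ∀ ε : ℝ≥0∞, 0 < ε → ∃ R < 1, ∀ w : Cn n, R < ‖w‖ → ‖w‖ < 1 →
      weightedMean ω μ r s w ≤ ε := by
    rw [MeanVanishes, ENNReal.tendsto_nhds_zero]
    refine forall₂_congr fun ε _ => ?_
    rw [Filter.Eventually, mem_comap]
    constructor
    · rintro ⟨t, ht, hsub⟩
      obtain ⟨R, hR, hRt⟩ := (mem_nhdsLT_iff_exists_Ioo_subset).1 ht
      exact ⟨R, hR, fun w h1 h2 => hsub (hRt ⟨h1, h2⟩)⟩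
    · rintro ⟨R, hR, h⟩
      exact ⟨Ioo R 1, Ioo_mem_nhdsLT hR, fun w hw => h w hw.1 hw.2⟩
  rw [hiff]
  constructor
  · intro h ε hε
    obtain ⟨R, hR, h1⟩ := h ((C : ℝ≥0∞)⁻¹ * ε) (ENNReal.mul_pos (by simp) (by simpa using hε))
    refine ⟨R, hR, fun w hw hw1 => ((hC μ w hw1).1).trans ?_⟩
    gcongr
    calc (C : ℝ≥0∞) * weightedMean ω μ r s w ≤ C * ((C : ℝ≥0∞)⁻¹ * ε) := by gcongr; exact h1 w hw hw1
      _ = ε := by rw [← mul_assoc, ENNReal.mul_inv_cancel hC0' ENNReal.coe_ne_top, one_mul]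
  · intro h ε hε
    obtain ⟨δ, hδ, hδε⟩ := ENNReal.exists_nnreal_pos_mul_lt (ENNReal.coe_ne_top (r := C)) hε.ne'
    obtain ⟨R, hR, h1⟩ := h δ hδ.ne'
    refine ⟨R, hR, fun w hw hw1 => ((hC μ w hw1).2 δ (h1 w hw hw1)).trans ?_⟩
    rw [mul_comm]; exact hδε.le

theorem closedBall_subset_unitBall {R : ℝ} (hR : R < 1) :
    Metric.closedBall (0 : Cn n) R ⊆ unitBall n := Metric.closedBall_subset_ball hR

theorem size_lower_bound {u : ℝ} {z : Cn n} (hz : ‖z‖ ≤ u) :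
    ENNReal.ofReal (1 - u) ^ n * mass W u ≤ size W z := by
  rw [size]
  gcongr
  exact mass_anti W hz

theorem size_lower_bound_ne_zero (hW : IsDoublingProfile W A B K) {u : ℝ} (hu : u ∈ Ico (0 : ℝ) 1) :
    ENNReal.ofReal (1 - u) ^ n * mass W u ≠ 0 :=
  mul_ne_zero (pow_ne_zero _ (by simpa using hu.2)) (hW.ne_zero _ hu)

/-- Hyperbolic balls with centres in |w| ≤ R stay inside one compact ball, on which μ is finite, and
S is bounded below at those centres; so the estimate extends inwards with a larger constant. -/
theorem forall_measure_hypBall_le_of_near_boundary (hW : IsDoublingProfile W A B K) {r : ℝ}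
    (hr : 0 < r) (hr1 : r < 1) {s : ℝ} (hs : 0 ≤ s) {μ : Measure (Cn n)}
    (hμ : ∀ K ⊆ unitBall n, IsCompact K → μ K < ∞) {R : ℝ} (hR : R < 1) {M : ℝ≥0}
    (h : ∀ w : Cn n, R < ‖w‖ → ‖w‖ < 1 → μ (hypBall w r) ≤ M * size W w ^ s) :
    ∃ M' : ℝ≥0, ∀ w : Cn n, ‖w‖ < 1 → μ (hypBall w r) ≤ M' * size W w ^ s := by
  set u := max R 0
  have hu1 : u ∈ Ico (0 : ℝ) 1 := ⟨le_max_right _ _, max_lt hR one_pos⟩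
  have hl : 0 < 1 - r ^ 2 := by nlinarith
  set R' := 1 - (1 - r ^ 2) / 4 * (1 - u) with hR'
  have hR'1 : R' < 1 := by
    have := mul_pos (div_pos hl (by norm_num : (0 : ℝ) < 4)) (sub_pos.2 hu1.2)
    linarith
  have hfin := hμ _ (closedBall_subset_unitBall (n := n) hR'1) (isCompact_closedBall 0 R')
  set b := ENNReal.ofReal (1 - u) ^ n * mass W u with hb
  have hb0 : b ≠ 0 := size_lower_bound_ne_zero hW hu1
  have hbs0 : b ^ s ≠ 0 := fun h0 => by
    rcases ENNReal.rpow_eq_zero_iff.1 h0 with h1 | h1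
    · exact hb0 h1.1
    · exact hs.not_gt h1.2
  have hK0 : μ (Metric.closedBall 0 R') / b ^ s ≠ ∞ := ENNReal.div_ne_top hfin.ne hbs0
  refine ⟨M + (μ (Metric.closedBall 0 R') / b ^ s).toNNReal, fun w hw => ?_⟩
  rw [ENNReal.coe_add, ENNReal.coe_toNNReal hK0, add_mul]
  rcases lt_or_ge R ‖w‖ with hRw | hRw
  · exact (h w hRw hw).trans le_self_add
  refine le_add_left ?_
  have hwu : ‖w‖ ≤ u := hRw.trans (le_max_left _ _)
  have hsub : hypBall w r ⊆ Metric.closedBall 0 R' := by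
    intro z hz
    rw [mem_closedBall_zero_iff]
    have h1 := one_sub_norm_le_of_mem_hypBall (mem_unitBall.1 hz.1) hr hr1
      ((mem_hypBall_comm hw (mem_unitBall.1 hz.1) hr).1 hz)
    rw [div_mul_eq_mul_div, lt_div_iff₀ hl] at h1
    have : (1 - u) * (1 - r ^ 2) ≤ (1 - ‖w‖) * (1 - r ^ 2) := by gcongr
    rw [hR']; linarith
  have hbt : b ^ s ≠ ∞ := ENNReal.rpow_ne_top_of_nonneg hs
    (ENNReal.mul_ne_top (by simp) (hW.ne_top _ hu1))
  calc μ (hypBall w r) ≤ μ (Metric.closedBall 0 R') := measure_mono hsub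
    _ = μ (Metric.closedBall 0 R') / b ^ s * b ^ s := (ENNReal.div_mul_cancel hbs0 hbt).symm
    _ ≤ _ := by gcongr; exact size_lower_bound hwu

/-- For R' close enough to 1, a hyperbolic ball meeting |z| > R' has its centre in |w| > R; the
others have measure zero for the restriction. Hence the small constant ε holds at all centres. -/
theorem restrict_norm_gt_hypBall_le {r : ℝ} (hr : 0 < r) (hr1 : r < 1) {s : ℝ}
    {μ : Measure (Cn n)} {R : ℝ} (hR : R < 1) {ε : ℝ≥0}
    (h : ∀ w : Cn n, R < ‖w‖ → ‖w‖ < 1 → μ (hypBall w r) ≤ ε * size W w ^ s) :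
    ∃ R' < 1, ∀ w : Cn n, ‖w‖ < 1 →
      (μ.restrict {z | R' < ‖z‖}) (hypBall w r) ≤ ε * size W w ^ s := by
  have hl : 0 < 1 - r ^ 2 := by nlinarith
  refine ⟨1 - (1 - r ^ 2) / 4 * (1 - R), ?_, fun w hw => ?_⟩
  · have := mul_pos (div_pos hl (by norm_num : (0 : ℝ) < 4)) (sub_pos.2 hR)
    linarith
  rw [Measure.restrict_apply (measurableSet_hypBall hw hr)]
  rcases eq_empty_or_nonempty (hypBall w r ∩ {z | 1 - (1 - r ^ 2) / 4 * (1 - R) < ‖z‖}) with h0 | h0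
  · simp [h0]
  obtain ⟨z, hz, hzR⟩ := h0
  refine (measure_mono inter_subset_left).trans (h w ?_ hw)
  have hzB := mem_unitBall.1 hz.1
  have h1 := one_sub_norm_le_of_mem_hypBall hzB hr hr1 ((mem_hypBall_comm hw hzB hr).1 hz)
  rw [div_mul_eq_mul_div, lt_div_iff₀ hl] at h1
  rw [mem_ofPred_eq] at hzR
  have h2 : (1 - ‖w‖) * (1 - r ^ 2) < (1 - R) * (1 - r ^ 2) := by linarith
  have := lt_of_mul_lt_mul_right h2 hl.le
  linarith

theorem lintegral_enorm_sub_rpow_le {α : Type*} [MeasurableSpace α] {ν : Measure α} {f g : α → ℂ}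
    (hf : AEStronglyMeasurable f ν) {p : ℝ} (hp : 0 ≤ p) :
    ∫⁻ z, ‖f z - g z‖ₑ ^ p ∂ν ≤ 2 ^ p * (∫⁻ z, ‖f z‖ₑ ^ p ∂ν + ∫⁻ z, ‖g z‖ₑ ^ p ∂ν) := by
  rw [← lintegral_add_left' (hf.enorm.pow_const p),
    ← lintegral_const_mul' _ _ (ENNReal.rpow_ne_top_of_nonneg hp (by simp))]
  refine lintegral_mono fun z => ?_
  have h1 : ‖f z - g z‖ₑ ≤ 2 * max ‖f z‖ₑ ‖g z‖ₑ := by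
    rw [two_mul]
    exact enorm_sub_le.trans (add_le_add (le_max_left _ _) (le_max_right _ _))
  calc ‖f z - g z‖ₑ ^ p ≤ (2 * max ‖f z‖ₑ ‖g z‖ₑ) ^ p := by gcongr
    _ = 2 ^ p * max ‖f z‖ₑ ‖g z‖ₑ ^ p := ENNReal.mul_rpow_of_nonneg _ _ hp
    _ ≤ _ := by
      gcongr
      rcases max_choice ‖f z‖ₑ ‖g z‖ₑ with h | h <;> rw [h]
      · exact le_self_add
      · exact le_add_self

theorem exists_uniform_bound (hn : 1 ≤ n) (hW : IsDoublingProfile W A B K) {p : ℝ} (hp : 0 < p)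
    {f : ℕ → Cn n → ℂ} (hf : ∀ k, DifferentiableOn ℂ (f k) (unitBall n)) {M : ℝ≥0}
    (hM : ∀ k, ∫⁻ z, ‖f k z‖ₑ ^ p ∂radialMeasure n W ≤ M) {u : ℝ} (hu : u < 1) :
    ∃ b : ℝ, ∀ k, ∀ z : Cn n, ‖z‖ ≤ u → ‖f k z‖ ≤ b := by
  obtain ⟨C, hC⟩ := size_mul_rpow_enorm_le hn hW
  rcases lt_or_ge u 0 with hu0 | hu0
  · exact ⟨0, fun k z hz => absurd (norm_nonneg z) (not_le.2 (hz.trans_lt hu0))⟩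
  have huI : u ∈ Ico (0 : ℝ) 1 := ⟨hu0, hu⟩
  set c := ENNReal.ofReal (1 - u) ^ n * mass W u with hc
  have hc0 : c ≠ 0 := size_lower_bound_ne_zero hW huI
  have hct : c ≠ ∞ := ENNReal.mul_ne_top (by simp) (hW.ne_top _ huI)
  have hbt : ((C * M : ℝ≥0∞) / c) ^ (1 / p) ≠ ∞ :=
    ENNReal.rpow_ne_top_of_nonneg (by positivity)
      (ENNReal.div_ne_top (ENNReal.mul_ne_top ENNReal.coe_ne_top ENNReal.coe_ne_top) hc0)
  refine ⟨(((C * M : ℝ≥0∞) / c) ^ (1 / p)).toReal, fun k z hz => ?_⟩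
  rw [← toReal_enorm]
  refine ENNReal.toReal_mono hbt ?_
  rw [one_div, ENNReal.le_rpow_inv_iff hp, ENNReal.le_div_iff_mul_le (Or.inl hc0) (Or.inl hct),
    mul_comm]
  calc c * ‖f k z‖ₑ ^ p ≤ size W z * ‖f k z‖ₑ ^ p := by gcongr; exact size_lower_bound hz
    _ ≤ C * ∫⁻ w, ‖f k w‖ₑ ^ p ∂radialMeasure n W := hC _ (hf k) p hp z (hz.trans_lt hu)
    _ ≤ C * M := by gcongr; exact hM k

end

section

/-! ### Characterization of vanishing Carleson measures -/

variable {n : ℕ} {W : ℝ → ℝ≥0∞} {A B : ℝ≥0} {K : ℝ}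

theorem isVanishingCarleson_of_measure_hypBall_le (hn : 1 ≤ n) (hW : IsDoublingProfile W A B K)
    {ω : ℝ → ℝ} (hω : weightMeasure n ω = radialMeasure n W) {r : ℝ} (hr : 0 < r) (hr1 : r < 1)
    {p q : ℝ} (hp : 0 < p) (hpq : p ≤ q) {μ : Measure (Cn n)}
    (hμ : ∀ K ⊆ unitBall n, IsCompact K → μ K < ∞)
    (h : ∀ ε : ℝ≥0, ε ≠ 0 → ∃ R < 1, ∀ w : Cn n, R < ‖w‖ → ‖w‖ < 1 →
      μ (hypBall w r) ≤ ε * size W w ^ (q / p)) :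
    IsVanishingCarleson n ω p q μ := by
  have hq : 0 < q := hp.trans_le hpq
  have hs : 0 ≤ q / p := by positivity
  obtain ⟨C, hC⟩ := lintegral_rpow_le_of_measure_hypBall_le hn hW hr hr1 hp hpq
  have hcarleson : IsCarleson n ω p q μ := by
    obtain ⟨R, hR, h1⟩ := h 1 one_ne_zero
    obtain ⟨M, hM⟩ := forall_measure_hypBall_le_of_near_boundary hW hr hr1 hs hμ hR h1
    refine isCarleson_of_measure_hypBall_le hn hW hω hr hr1 hp hpq (M := M) ?_
    filter_upwards [ae_restrict_mem isOpen_unitBall.measurableSet] with w hw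
    exact hM w (mem_unitBall.1 hw)
  refine ⟨hcarleson.1, ?_⟩
  rintro f hf ⟨M, hM⟩
  have hM' : ∀ k, ∫⁻ z, ‖f k z‖ₑ ^ p ∂radialMeasure n W ≤ (M ^ p : ℝ≥0) := fun k => by
    rw [lintegral_rpow_eq_eLpNorm_rpow hp, ENNReal.coe_rpow_of_nonneg _ hp.le, ← hω]
    gcongr
    exact hM k
  have hb := fun u hu => exists_uniform_bound (u := u) hn hW hp (fun k => (hf k).1) hM' hu
  obtain ⟨φ, hφ, g, hg⟩ := exists_subseq_tendsto_pointwise (fun k => (hf k).1) hb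
  set ν := μ.restrict (unitBall n) with hν
  have hfm : ∀ k, AEStronglyMeasurable (f k) ν := fun k =>
    aestronglyMeasurable_of_differentiableOn (hf k).1 μ
  have hae : ∀ᵐ z ∂ν, Tendsto (fun k => f (φ k) z) atTop (𝓝 (g z)) :=
    (ae_restrict_mem isOpen_unitBall.measurableSet).mono hg
  have hgm : AEStronglyMeasurable g ν :=
    aestronglyMeasurable_of_tendsto_ae atTop (fun k => hfm (φ k)) hae
  set T : ℝ≥0∞ := 2 ^ p * ((M ^ p : ℝ≥0) + (M ^ p : ℝ≥0)) with hT
  have hTt : T ≠ ∞ := ENNReal.mul_ne_top (ENNReal.rpow_ne_top_of_nonneg hp.le (by simp)) (by simp)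
  have hdiff : ∀ k l, ∫⁻ z, ‖f k z - f l z‖ₑ ^ p ∂radialMeasure n W ≤ T := fun k l => by
    have hm := (hf k).2.1
    rw [hω] at hm
    refine (lintegral_enorm_sub_rpow_le hm hp.le).trans ?_
    rw [hT]
    gcongr <;> exact hM' _
  have hmain : Tendsto (fun k => ∫⁻ z, ‖f (φ k) z - g z‖ₑ ^ q ∂ν) atTop (𝓝 0) := by
    rw [ENNReal.tendsto_nhds_zero]
    intro ε hε
    obtain ⟨δ, hδ, hδε⟩ := ENNReal.exists_nnreal_pos_mul_lt
      (ENNReal.mul_ne_top (ENNReal.coe_ne_top (r := C)) (ENNReal.rpow_ne_top_of_nonneg hs hTt))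
      (ENNReal.half_pos hε.ne').ne'
    obtain ⟨R, hR, hRδ⟩ := h δ hδ.ne'
    obtain ⟨u, hu, huδ⟩ := restrict_norm_gt_hypBall_le hr hr1 hR hRδ
    set S : Set (Cn n) := {z | u < ‖z‖} with hS
    have hSm : MeasurableSet S := measurableSet_lt measurable_const measurable_norm
    -- The limit g is not known to be holomorphic, so Fatou's lemma replaces it by f(φ l); the
    -- embedding for μ restricted to S then applies to a difference of Bergman functions.
    have houter : ∀ k, ∫⁻ z in S, ‖f (φ k) z - g z‖ₑ ^ q ∂ν ≤ ε / 2 := by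
      intro k
      have hfat : ∫⁻ z in S, ‖f (φ k) z - g z‖ₑ ^ q ∂ν
          ≤ liminf (fun l => ∫⁻ z in S, ‖f (φ k) z - f (φ l) z‖ₑ ^ q ∂ν) atTop := by
        refine le_trans (lintegral_mono_ae ?_) (lintegral_liminf_le' fun l =>
          ((((hfm (φ k)).sub (hfm (φ l))).enorm).pow_const q).restrict)
        filter_upwards [ae_restrict_of_ae hae] with z hz
        have h2 : Tendsto (fun l => ‖f (φ k) z - f (φ l) z‖ₑ ^ q) atTop
            (𝓝 (‖f (φ k) z - g z‖ₑ ^ q)) :=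
          ((ENNReal.continuous_rpow_const.tendsto _).comp
            ((continuous_enorm.tendsto _).comp (hz.const_sub _)))
        exact h2.liminf_eq.ge
      refine hfat.trans (liminf_le_of_frequently_le' (Frequently.of_forall fun l => ?_))
      have h3 := hC (μ.restrict S) δ (by
        filter_upwards [ae_restrict_mem isOpen_unitBall.measurableSet] with w hw
        exact huδ w (mem_unitBall.1 hw)) (fun z => f (φ k) z - f (φ l) z)
        ((hf _).1.sub (hf _).1)
      rw [hν, Measure.restrict_restrict hSm, inter_comm, ← Measure.restrict_restrict
        isOpen_unitBall.measurableSet]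
      refine h3.trans ?_
      calc C * δ * (∫⁻ z, ‖f (φ k) z - f (φ l) z‖ₑ ^ p ∂radialMeasure n W) ^ (q / p)
          ≤ C * δ * T ^ (q / p) := by gcongr; exact hdiff _ _
        _ = δ * (C * T ^ (q / p)) := by ring
        _ ≤ ε / 2 := hδε.le
    -- On |z| ≤ u the functions and their limit are bounded by b and μ is finite, so (2b)^q is a
    -- dominating constant.
    have hinner : Tendsto (fun k => ∫⁻ z in Sᶜ, ‖f (φ k) z - g z‖ₑ ^ q ∂ν) atTop (𝓝 0) := by
      obtain ⟨b, hbu⟩ := hb u hu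
      have hSc : ∀ᵐ z ∂ν.restrict Sᶜ, ‖z‖ ≤ u := by
        filter_upwards [ae_restrict_mem hSm.compl] with z hz
        exact not_lt.1 hz
      have haeS := ae_restrict_of_ae (s := Sᶜ) hae
      have hlim : Tendsto (fun k => ∫⁻ z in Sᶜ, ‖f (φ k) z - g z‖ₑ ^ q ∂ν) atTop
          (𝓝 (∫⁻ _ in Sᶜ, 0 ∂ν)) := by
        refine tendsto_lintegral_of_dominated_convergence'
          (fun _ => (ENNReal.ofReal (b + b)) ^ q)
          (fun k => ((((hfm (φ k)).sub hgm).enorm).pow_const q).restrict) (fun k => ?_) ?_ ?_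
        · filter_upwards [hSc, haeS] with z hz hzl
          have h4 : ‖g z‖ ≤ b := le_of_tendsto hzl.norm (Eventually.of_forall fun l => hbu _ z hz)
          gcongr
          rw [← ofReal_norm]
          exact ENNReal.ofReal_le_ofReal ((norm_sub_le _ _).trans (add_le_add (hbu _ z hz) h4))
        · rw [lintegral_const]
          refine ENNReal.mul_ne_top (ENNReal.rpow_ne_top_of_nonneg hq.le ENNReal.ofReal_ne_top) ?_
          rw [Measure.restrict_apply_univ]
          refine ne_of_lt (lt_of_le_of_lt ?_
            (hμ _ (closedBall_subset_unitBall hu) (isCompact_closedBall 0 u)))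
          refine (Measure.restrict_apply_le _ _).trans (measure_mono fun z hz => ?_)
          rw [mem_closedBall_zero_iff]
          exact not_lt.1 hz
        · filter_upwards [haeS] with z hz
          have h5 : Tendsto (fun k => ‖f (φ k) z - g z‖ₑ ^ q) atTop (𝓝 (‖g z - g z‖ₑ ^ q)) :=
            ((ENNReal.continuous_rpow_const.tendsto _).comp
              ((continuous_enorm.tendsto _).comp (hz.sub_const _)))
          simpa [ENNReal.zero_rpow_of_pos hq] using h5
      simpa using hlim
    filter_upwards [ENNReal.tendsto_nhds_zero.1 hinner (ε / 2) (ENNReal.half_pos hε.ne')]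
      with k hk
    rw [← lintegral_add_compl _ hSm, ← ENNReal.add_halves ε]
    exact add_le_add (houter k) hk
  have hlim : Tendsto (fun k => eLpNorm (f (φ k) - g) (ENNReal.ofReal q) ν) atTop (𝓝 0) := by
    have h6 : ∀ k, eLpNorm (f (φ k) - g) (ENNReal.ofReal q) ν
        = (∫⁻ z, ‖f (φ k) z - g z‖ₑ ^ q ∂ν) ^ (1 / q) := fun k => by
      rw [eLpNorm_eq_lintegral_rpow_enorm_toReal (by simpa using hq) ENNReal.ofReal_ne_top,
        ENNReal.toReal_ofReal hq.le]
      rfl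
    simp_rw [h6]
    have h7 := (ENNReal.continuous_rpow_const (y := 1 / q)).tendsto 0 |>.comp hmain
    rwa [ENNReal.zero_rpow_of_pos (by positivity)] at h7
  refine ⟨φ, hφ, g, ?_, hlim⟩
  obtain ⟨k, hk⟩ := (ENNReal.tendsto_nhds_zero.1 hlim 1 one_pos).exists
  have h8 : MemLp (f (φ k) - g) (ENNReal.ofReal q) ν :=
    ⟨(hfm _).sub hgm, hk.trans_lt ENNReal.one_lt_top⟩
  simpa using (hcarleson.1 _ (hf (φ k))).sub h8

/-- The test function `testFun a N`, scaled by `size W a ^ (-1 / p)`. -/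
def scaledTestFun (W : ℝ → ℝ≥0∞) (p : ℝ) (N : ℕ) (a z : Cn n) : ℂ :=
  (((size W a).toReal ^ (-(1 / p)) : ℝ) : ℂ) * testFun a N z

theorem enorm_scaledTestFun_rpow (hW : IsDoublingProfile W A B K) {p : ℝ} (N : ℕ)
    {a : Cn n} (ha : ‖a‖ < 1) (z : Cn n) {t : ℝ} (ht : 0 ≤ t) :
    ‖scaledTestFun W p N a z‖ₑ ^ t = (size W a ^ (t / p))⁻¹ * ‖testFun a N z‖ₑ ^ t := by
  have h0 := size_ne_zero hW ha
  have ht' := size_ne_top hW ha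
  have h1 : 0 < (size W a).toReal := ENNReal.toReal_pos h0 ht'
  rw [scaledTestFun, enorm_mul, ENNReal.mul_rpow_of_nonneg _ _ ht, ← ofReal_norm,
    Complex.norm_real, Real.norm_of_nonneg (by positivity), ← ENNReal.ofReal_rpow_of_pos h1,
    ENNReal.ofReal_toReal ht', ← ENNReal.rpow_mul, ← ENNReal.rpow_neg]
  congr 2
  ring

theorem scaledTestFun_mem_bergmanSpace (hW : IsDoublingProfile W A B K) {ω : ℝ → ℝ}
    (hω : weightMeasure n ω = radialMeasure n W) {p : ℝ} (hp : 0 < p) {N : ℕ} {C : ℝ≥0}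
    (hC : ∀ a : Cn n, ‖a‖ < 1 →
      ∫⁻ z, ENNReal.ofReal (kernelRatio a z ^ (N * p)) ∂radialMeasure n W ≤ C * size W a)
    {a : Cn n} (ha : ‖a‖ < 1) :
    scaledTestFun W p N a ∈ bergmanSpace n ω p ∧
      bergmanNorm n ω p (scaledTestFun W p N a) ≤ (C ^ (1 / p) : ℝ≥0) := by
  obtain ⟨⟨hd, hL⟩, hnorm⟩ := testFun_mem_bergmanSpace hW hω hp hC ha
  have h0 := size_ne_zero hW ha
  have ht := size_ne_top hW ha
  refine ⟨⟨hd.const_mul _, hL.const_mul _⟩, ?_⟩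
  rw [ENNReal.coe_rpow_of_nonneg _ (by positivity), one_div, ENNReal.le_rpow_inv_iff hp]
  rw [bergmanNorm, ← lintegral_rpow_eq_eLpNorm_rpow hp] at hnorm ⊢
  simp_rw [enorm_scaledTestFun_rpow hW N ha _ hp.le, div_self hp.ne', ENNReal.rpow_one]
  rw [lintegral_const_mul' _ _ (ENNReal.inv_ne_top.2 h0), mul_comm, ← div_eq_mul_inv,
    ENNReal.div_le_iff h0 ht]
  exact hnorm

/-- As |1-⟨z,a⟩| ≥ 1-|z|, the p-th power is at most S(a)^{-1}(1-|a|)^{Np}(1-|z|)^{-Np}. Of the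
exponent Np ≥ m₀+1, the part m₀ absorbs S(a)^{-1}, and one factor 1-|a| → 0 remains. -/
theorem tendsto_scaledTestFun (hW : IsDoublingProfile W A B K) {p : ℝ} (hp : 0 < p) {N : ℕ}
    {m₀ : ℝ} (hm₀ : 0 ≤ m₀) (hN : m₀ + 1 ≤ N * p) {C : ℝ≥0}
    (hC : ∀ a : Cn n, ‖a‖ < 1 → ENNReal.ofReal (1 - ‖a‖) ^ m₀ ≤ C * size W a)
    {a : ℕ → Cn n} (ha : ∀ k, ‖a k‖ < 1) (hlim : Tendsto (fun k => ‖a k‖) atTop (𝓝 1))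
    {z : Cn n} (hz : ‖z‖ < 1) :
    Tendsto (fun k => scaledTestFun W p N (a k) z) atTop (𝓝 0) := by
  have hz' : 0 < 1 - ‖z‖ := sub_pos.2 hz
  set D := ENNReal.ofReal ((1 - ‖z‖)⁻¹ ^ (N * p)) with hD
  have hbound : ∀ k, ‖scaledTestFun W p N (a k) z‖ₑ ^ p
      ≤ C * D * ENNReal.ofReal (1 - ‖a k‖) := by
    intro k
    have hd : 0 < 1 - ‖a k‖ := sub_pos.2 (ha k)
    have h0 := size_ne_zero hW (ha k)
    have ht := size_ne_top hW (ha k)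
    have h1 : kernelRatio (a k) z ≤ (1 - ‖a k‖) * (1 - ‖z‖)⁻¹ := by
      rw [kernelRatio, div_eq_mul_inv]
      gcongr
      rw [norm_one_sub_inner_comm]
      exact one_sub_norm_le_norm_one_sub_inner (ha k).le
    have h2 : ‖testFun (a k) N z‖ₑ ^ p ≤ ENNReal.ofReal (1 - ‖a k‖) ^ (N * p) * D := by
      rw [enorm_testFun_rpow (ha k) N z hp.le, hD, ENNReal.ofReal_rpow_of_pos hd,
        ← ENNReal.ofReal_mul (by positivity), ← Real.mul_rpow hd.le (by positivity)]
      exact ENNReal.ofReal_le_ofReal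
        (Real.rpow_le_rpow (kernelRatio_nonneg (ha k) z) h1 (by positivity))
    have h3 : ENNReal.ofReal (1 - ‖a k‖) ^ (N * p)
        ≤ C * size W (a k) * ENNReal.ofReal (1 - ‖a k‖) := by
      have h4 : ENNReal.ofReal (1 - ‖a k‖) ≤ 1 := by
        rw [ENNReal.ofReal_le_one]; linarith [norm_nonneg (a k)]
      calc _ ≤ ENNReal.ofReal (1 - ‖a k‖) ^ (m₀ + 1) := ENNReal.rpow_le_rpow_of_exponent_ge h4 hN
        _ = ENNReal.ofReal (1 - ‖a k‖) ^ m₀ * ENNReal.ofReal (1 - ‖a k‖) := by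
          rw [ENNReal.rpow_add_of_nonneg _ _ hm₀ zero_le_one, ENNReal.rpow_one]
        _ ≤ _ := by gcongr; exact hC _ (ha k)
    rw [enorm_scaledTestFun_rpow hW N (ha k) z hp.le, div_self hp.ne', ENNReal.rpow_one]
    calc (size W (a k))⁻¹ * ‖testFun (a k) N z‖ₑ ^ p
        ≤ (size W (a k))⁻¹ * ((C * size W (a k) * ENNReal.ofReal (1 - ‖a k‖)) * D) := by
          gcongr
          exact h2.trans (by gcongr)
      _ = ((size W (a k))⁻¹ * size W (a k)) * (C * D * ENNReal.ofReal (1 - ‖a k‖)) := by ring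
      _ = _ := by rw [ENNReal.inv_mul_cancel h0 ht, one_mul]
  have hz0 : Tendsto (fun k => C * D * ENNReal.ofReal (1 - ‖a k‖)) atTop (𝓝 0) := by
    have h5 : Tendsto (fun k => ENNReal.ofReal (1 - ‖a k‖)) atTop (𝓝 0) := by
      simpa using ENNReal.tendsto_ofReal (hlim.const_sub 1)
    simpa using ENNReal.Tendsto.const_mul h5 (Or.inr (ENNReal.mul_ne_top ENNReal.coe_ne_top
      ENNReal.ofReal_ne_top))
  have h6 := tendsto_of_tendsto_of_tendsto_of_le_of_le tendsto_const_nhds hz0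
    (fun _ => zero_le) hbound
  have h7 := (ENNReal.continuous_rpow_const (y := 1 / p)).tendsto 0 |>.comp h6
  rw [ENNReal.zero_rpow_of_pos (by positivity)] at h7
  rw [tendsto_zero_iff_enorm_tendsto_zero]
  refine h7.congr fun k => ?_
  rw [Function.comp_apply, ← ENNReal.rpow_mul, mul_one_div_cancel hp.ne', ENNReal.rpow_one]

theorem measure_hypBall_le_of_isVanishingCarleson (hn : 1 ≤ n) (hW : IsDoublingProfile W A B K)
    {ω : ℝ → ℝ} (hω : weightMeasure n ω = radialMeasure n W) {r : ℝ} (hr : 0 < r) (hr1 : r < 1)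
    {p q : ℝ} (hp : 0 < p) (hpq : p ≤ q) {μ : Measure (Cn n)} (h : IsVanishingCarleson n ω p q μ)
    (ε : ℝ≥0) (hε : ε ≠ 0) : ∃ R < 1, ∀ w : Cn n, R < ‖w‖ → ‖w‖ < 1 →
      μ (hypBall w r) ≤ ε * size W w ^ (q / p) := by
  have hq : 0 < q := hp.trans_le hpq
  have hs : 0 ≤ q / p := by positivity
  by_contra! hcon
  have hR : ∀ k : ℕ, 1 - 1 / ((k : ℝ) + 1) < 1 := fun k => by
    have : (0 : ℝ) < 1 / (k + 1) := by positivity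
    linarith
  -- Failure of the estimate yields points a_k → ∂B with μ(D(a_k,r)) > ε S(a_k)^{q/p}.
  choose a ha1 ha hεa using fun k : ℕ => hcon _ (hR k)
  have hlim : Tendsto (fun k => ‖a k‖) atTop (𝓝 1) := by
    refine tendsto_of_tendsto_of_tendsto_of_le_of_le ?_ tendsto_const_nhds
      (fun k => (ha1 k).le) (fun k => (ha k).le)
    simpa using (tendsto_one_div_add_atTop_nhds_zero_nat (𝕜 := ℝ)).const_sub 1
  obtain ⟨m₀, hm₀, hm, C', hC'⟩ := exists_exponent hn hW
  obtain ⟨N, hN⟩ := exists_nat_ge ((m₀ + 1) / p)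
  rw [div_le_iff₀ hp] at hN
  obtain ⟨C, hC⟩ := hm (N * p) (by linarith)
  have hmem := fun k => scaledTestFun_mem_bergmanSpace hW hω hp hC (ha k)
  obtain ⟨φ, hφ, g, hg, hφg⟩ := h.2 (fun k => scaledTestFun W p N (a k)) (fun k => (hmem k).1)
    ⟨_, fun k => (hmem k).2⟩
  set ν := μ.restrict (unitBall n) with hν
  have hpt : ∀ z ∈ unitBall n, Tendsto (fun k => scaledTestFun W p N (a (φ k)) z) atTop (𝓝 0) :=
    fun z hz => tendsto_scaledTestFun hW hp hm₀ hN hC' (fun k => ha (φ k))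
      (hlim.comp hφ.tendsto_atTop) (mem_unitBall.1 hz)
  have hint : Tendsto (fun k => ∫⁻ z, ‖scaledTestFun W p N (a (φ k)) z - g z‖ₑ ^ q ∂ν)
      atTop (𝓝 0) := by
    have h1 := (ENNReal.continuous_rpow_const (y := q)).tendsto 0 |>.comp hφg
    rw [ENNReal.zero_rpow_of_pos hq] at h1
    refine h1.congr fun k => ?_
    rw [Function.comp_apply, ← lintegral_rpow_eq_eLpNorm_rpow hq]
    rfl
  -- Fatou's lemma identifies the L^q limit with the pointwise limit 0 of the normalized test
  -- functions.
  have hg0 : g =ᵐ[ν] 0 := by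
    have h2 : ∫⁻ z, ‖g z‖ₑ ^ q ∂ν = 0 := by
      refine nonpos_iff_eq_zero.1 ?_
      calc ∫⁻ z, ‖g z‖ₑ ^ q ∂ν
          ≤ ∫⁻ z, liminf (fun k => ‖scaledTestFun W p N (a (φ k)) z - g z‖ₑ ^ q) atTop ∂ν := by
            refine lintegral_mono_ae ?_
            filter_upwards [ae_restrict_mem isOpen_unitBall.measurableSet] with z hz
            have h3 : Tendsto (fun k => ‖scaledTestFun W p N (a (φ k)) z - g z‖ₑ ^ q) atTop
                (𝓝 (‖0 - g z‖ₑ ^ q)) :=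
              ((ENNReal.continuous_rpow_const.tendsto _).comp
                ((continuous_enorm.tendsto _).comp ((hpt z hz).sub_const _)))
            rw [h3.liminf_eq, zero_sub, enorm_neg]
        _ ≤ liminf (fun k => ∫⁻ z, ‖scaledTestFun W p N (a (φ k)) z - g z‖ₑ ^ q ∂ν) atTop :=
            lintegral_liminf_le' fun k =>
              (((h.1 _ (hmem (φ k)).1).1.sub hg.1).enorm).pow_const q
        _ = 0 := hint.liminf_eq
    rw [lintegral_eq_zero_iff' (hg.1.enorm.pow_const q)] at h2
    filter_upwards [h2] with z hz
    simpa [ENNReal.rpow_eq_zero_iff, hq, hq.not_gt] using hz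
  have hr2 : 0 < (1 - r ^ 2) / 4 := by nlinarith
  set c := ENNReal.ofReal (((1 - r ^ 2) / 4) ^ (N * q)) with hc
  have hc0 : c ≠ 0 := by
    rw [hc, ENNReal.ofReal_ne_zero_iff]; exact Real.rpow_pos_of_pos hr2 _
  -- On D(a_k,r) the unscaled test function is bounded below, and the scaling divides by exactly
  -- S(a_k)^{q/p}. The integrals therefore stay above cε, contrary to their convergence to 0.
  have hlow : ∀ k, c * ε ≤ ∫⁻ z, ‖scaledTestFun W p N (a (φ k)) z - g z‖ₑ ^ q ∂ν := by
    intro k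
    have h4 := measure_hypBall_le_lintegral_testFun (ha (φ k)) hr hr1 N hq.le μ
    have h0 := size_ne_zero hW (ha (φ k))
    have ht := size_ne_top hW (ha (φ k))
    have hs0 : size W (a (φ k)) ^ (q / p) ≠ 0 := by
      rw [Ne, ENNReal.rpow_eq_zero_iff]; simp [h0, ht]
    have hst : size W (a (φ k)) ^ (q / p) ≠ ∞ := ENNReal.rpow_ne_top_of_nonneg hs ht
    calc c * ε = (size W (a (φ k)) ^ (q / p))⁻¹ * (c * (ε * size W (a (φ k)) ^ (q / p))) := by
          rw [mul_left_comm, mul_comm (ε : ℝ≥0∞), ← mul_assoc _ _ (ε : ℝ≥0∞),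
            ENNReal.inv_mul_cancel hs0 hst, one_mul]
      _ ≤ (size W (a (φ k)) ^ (q / p))⁻¹ * (c * μ (hypBall (a (φ k)) r)) := by
          gcongr; exact (hεa _).le
      _ ≤ (size W (a (φ k)) ^ (q / p))⁻¹ * ∫⁻ z, ‖testFun (a (φ k)) N z‖ₑ ^ q ∂ν := by
          gcongr
      _ = ∫⁻ z, ‖scaledTestFun W p N (a (φ k)) z‖ₑ ^ q ∂ν := by
          simp_rw [enorm_scaledTestFun_rpow hW N (ha (φ k)) _ hq.le]
          rw [lintegral_const_mul' _ _ (ENNReal.inv_ne_top.2 hs0)]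
      _ = _ := by
          refine lintegral_congr_ae ?_
          filter_upwards [hg0] with z hz
          rw [hz, Pi.zero_apply, sub_zero]
  have h5 := ge_of_tendsto' hint hlow
  rw [nonpos_iff_eq_zero, mul_eq_zero] at h5
  rcases h5 with h5 | h5
  · exact hc0 h5
  · exact hε (by simpa using h5)

end

end BergmanBall

end

theorem theorem3p2 (n : ℕ) (hn : 1 ≤ n) (ω : ℝ → ℝ) (hω : BergmanBall.IsTwoSidedDoubling n ω) :
    ∃ r₀ ∈ Set.Ioo (0 : ℝ) 1, ∀ (p q : ℝ), 0 < p → p ≤ q →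
      ∀ μ : MeasureTheory.Measure (BergmanBall.Cn n),
        ((BergmanBall.IsCarleson n ω p q μ ↔
            ∃ r ∈ Set.Ico r₀ 1, BergmanBall.MeanBounded ω μ r (q / p)) ∧
          (BergmanBall.IsCarleson n ω p q μ ↔
            ∀ r ∈ Set.Ico r₀ 1, BergmanBall.MeanBounded ω μ r (q / p))) ∧
        ((∀ K ⊆ BergmanBall.unitBall n, IsCompact K → μ K < ⊤) →
          (BergmanBall.IsVanishingCarleson n ω p q μ ↔
            ∃ r ∈ Set.Ico r₀ 1, BergmanBall.MeanVanishes ω μ r (q / p)) ∧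
          (BergmanBall.IsVanishingCarleson n ω p q μ ↔
            ∀ r ∈ Set.Ico r₀ 1, BergmanBall.MeanVanishes ω μ r (q / p))) := by
  open BergmanBall in
  obtain ⟨W, A, B, K, hW, hω'⟩ := exists_profile hn hω
  have ht := threshold_mem hW.one_lt
  -- r₀ depends only on the reverse doubling constant K, and is fixed before p, q and μ.
  refine ⟨threshold K, ht, fun p q hp hpq μ => ?_⟩
  have hs : 0 ≤ q / p := div_nonneg (hp.le.trans hpq) hp.le
  have hmem : threshold K ∈ Set.Ico (threshold K) 1 := ⟨le_rfl, ht.2⟩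
  have necessity : IsCarleson n ω p q μ → ∀ r ∈ Set.Ico (threshold K) 1,
      MeanBounded ω μ r (q / p) := fun h r hr => by
    obtain ⟨M, hM⟩ := measure_hypBall_le_of_isCarleson hn hW hω' (ht.1.trans_le hr.1) hr.2 hp hpq h
    exact meanBounded_of_measure_hypBall_le hn hW hω' hr.1 hr.2 hs hM
  have sufficiency : (∃ r ∈ Set.Ico (threshold K) 1, MeanBounded ω μ r (q / p)) →
      IsCarleson n ω p q μ := fun ⟨r, hr, h⟩ => by
    obtain ⟨M, hM⟩ := measure_hypBall_le_of_meanBounded hn hW hω' hr.1 hr.2 hs h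
    exact isCarleson_of_measure_hypBall_le hn hW hω' (ht.1.trans_le hr.1) hr.2 hp hpq hM
  refine ⟨⟨⟨fun h => ⟨_, hmem, necessity h _ hmem⟩, sufficiency⟩,
    ⟨necessity, fun h => sufficiency ⟨_, hmem, h _ hmem⟩⟩⟩, fun hμ => ?_⟩
  have vanishing_necessity : IsVanishingCarleson n ω p q μ → ∀ r ∈ Set.Ico (threshold K) 1,
      MeanVanishes ω μ r (q / p) := fun h r hr =>
    (meanVanishes_iff hn hW hω' hr.1 hr.2 hs).2
      (measure_hypBall_le_of_isVanishingCarleson hn hW hω' (ht.1.trans_le hr.1) hr.2 hp hpq h)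
  have vanishing_sufficiency : (∃ r ∈ Set.Ico (threshold K) 1, MeanVanishes ω μ r (q / p)) →
      IsVanishingCarleson n ω p q μ := fun ⟨r, hr, h⟩ =>
    isVanishingCarleson_of_measure_hypBall_le hn hW hω' (ht.1.trans_le hr.1) hr.2 hp hpq hμ
      ((meanVanishes_iff hn hW hω' hr.1 hr.2 hs).1 h)
  exact ⟨⟨fun h => ⟨_, hmem, vanishing_necessity h _ hmem⟩, vanishing_sufficiency⟩,
    ⟨vanishing_necessity, fun h => vanishing_sufficiency ⟨_, hmem, h _ hmem⟩⟩⟩
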